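/- For $L\in\mathbb N$ let $\Lambda=[-L,L]\cap\mathbb Z$, and for $n\in\mathbb N$ let $\mathcal X^n_\Lambda$ be the set of configurations $\mathbf x=(x_1<x_2<\dots<x_n)$ of $n$ sites of $\Lambda$. A cluster of $\mathbf x$ is a nonempty block of consecutive occupied sites that is not neighboring any other occupied site; $k(\mathbf x)$ denotes the number of clusters of $\mathbf x$, and $\mathcal C=\{\mathbf x\in\mathcal X^n_\Lambda: k(\mathbf x)=1\}$ is the set of (fully) clustered configurations. Put $d(\mathbf x,\mathbf y)=\sum_{j=1}^n|x_j-y_j|$. Let $\varrho\in L^\infty(\mathbb R)$ be a probability density with $\operatorname{supp}\varrho\subset[0,\omega_{\max}]$, and let $\{\omega(\alpha)\}_{\alpha\in\Lambda}$ be i.i.d. random variables with density $\varrho$; $\mathbb E$ denotes the corresponding expectation. For $g>1$ and $\lambda\ge 0$ let $H_\Lambda=-A+2gU+\lambda V$ on $\ell^2(\mathcal X^n_\Lambda)$, where, in the canonical orthonormal basis $\{\delta_{\mathbf x}\}$, $$A\delta_{\mathbf x}=\sum_{\mathbf y\in\mathcal X^n_\Lambda:\,d(\mathbf x,\mathbf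 y)=1}\delta_{\mathbf y},\qquad U\delta_{\mathbf x}=k(\mathbf x)\,\delta_{\mathbf x},\qquad V\delta_{\mathbf x}=\Bigl(\sum_{j=1}^n\omega(x_j)\Bigr)\delta_{\mathbf x}.$$ For an interval $I\subset\mathbb R$ the eigenfunction correlator is $$Q^{(n)}_\Lambda(\mathbf x,\mathbf y,I)=\sum_{E\in\sigma(H_\Lambda)\cap I}\bigl|\langle\delta_{\mathbf x},P_{\{E\}}(H_\Lambda)\,\delta_{\mathbf y}\rangle\bigr|,$$ where $P_{\{E\}}(H_\Lambda)$ is the orthogonal projection onto the eigenspace of $H_\Lambda$ at $E$. For $\mu>0$ set $$F_\mu(\mathbf x,\mathbf y)=\begin{cases} e^{-\mu|x_1-y_1|} & \text{if } \mathbf x,\mathbf y\in\mathcal C,\\ \sum_{\mathbf w\in\mathcal C}e^{-\mu(d(\mathbf x,\mathbf w)+|w_1-y_1|)} & \text{if } \mathbf x\notin\mathcal C,\ \mathbf y\in\mathcal C,\\ \sum_{\mathbf v\in\mathcal C}e^{-\mu(|x_1-v_1|+d(\mathbf v,\mathbf y))} & \text{if } \mathbf x\in\mathcal C,\ \mathbf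 y\notin\mathcal C,\\ \sum_{\mathbf w,\mathbf v\in\mathcal C}e^{-\mu(d(\mathbf x,\mathbf w)+d(\mathbf v,\mathbf y)+|w_1-v_1|)} & \text{if } \mathbf x,\mathbf y\notin\mathcal C. \end{cases}$$ **Theorem.** Let $g>1$ and $\mu_T>0$ be such that $E(g,\mu_T):=4g-12e^{\mu_T}>0$, let $I\subset[0,E(g,\mu_T))$ be a compact interval and let $\mu\in(0,\mu_T)$. Then there exist constants $\lambda_0,C\in(0,\infty)$ (depending only on $g,\mu_T,I,\mu$ and $\varrho$) such that for all $n\ge 2$, all $\Lambda=[-L,L]\cap\mathbb Z$, all $\mathbf x,\mathbf y\in\mathcal X^n_\Lambda$ and all $\lambda>\lambda_0$: $$\mathbb E\bigl[\,|Q^{(n)}_\Lambda(\mathbf x,\mathbf y,I)|\,\bigr]\le C\,F_\mu(\mathbf x,\mathbf y).$$ -/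

import Mathlib

open MeasureTheory ProbabilityTheory
open scoped ENNReal

namespace HardCore

noncomputable section

/-- The sites of the box `Λ = [-L, L] ∩ ℤ`. -/
abbrev Site (L : ℕ) : Type := ↥(Finset.Icc (-(L : ℤ)) (L : ℤ))

/-- Configurations of `n` hard-core particles on `Λ`: tuples `x_1 < x_2 < ... < x_n` of sites
(indexed here by `0, ..., n - 1`). -/
abbrev Config (L n : ℕ) : Type := Fin n ↪o Site L

/-- The position of the `j`-th particle, as an integer. -/
def pos {L n : ℕ} (x : Config L n) (j : Fin n) : ℤ := (x j : ℤ)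

/-- The configuration as a set of occupied sites. -/
def occupied {L n : ℕ} (x : Config L n) : Finset ℤ := Finset.univ.image (pos x)

/-- A cluster of `x`: a nonempty block of successive occupied sites that is not neighboring any
other occupied site. -/
def IsCluster {L n : ℕ} (x : Config L n) (B : Finset ℤ) : Prop :=
  ∃ a b : ℤ, a ≤ b ∧ B = Finset.Icc a b ∧ B ⊆ occupied x ∧
    a - 1 ∉ occupied x ∧ b + 1 ∉ occupied x

open scoped Classical in
/-- The number `k(x)` of clusters of `x`. -/
def numClusters {L n : ℕ} (x : Config L n) : ℕ :=
  ((occupied x).powerset.filter (IsCluster x)).card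

/-- The fully clustered configurations, i.e. those with exactly one cluster. -/
def IsClustered {L n : ℕ} (x : Config L n) : Prop := numClusters x = 1

/-- The `ℓ¹`-distance of configurations. -/
def dist₁ {L n : ℕ} (x y : Config L n) : ℤ := ∑ j, |pos x j - pos y j|

/-- The hopping term: adjacency matrix of the configuration space. -/
def adjacency (L n : ℕ) : Matrix (Config L n) (Config L n) ℂ :=
  Matrix.of fun x y => if dist₁ x y = 1 then 1 else 0

/-- The attractive interaction: multiplication by the number of clusters. -/
def interaction (L n : ℕ) : Matrix (Config L n) (Config L n) ℂ :=
  Matrix.diagonal fun x => (numClusters x : ℂ)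

/-- The potential `V(x) = ∑ⱼ η(xⱼ)` of a realization `η` of the site variables. -/
def potential {L : ℕ} (n : ℕ) (η : Site L → ℝ) : Matrix (Config L n) (Config L n) ℂ :=
  Matrix.diagonal fun x => ((∑ j, η (x j) : ℝ) : ℂ)

/-- The Hamiltonian `H_Λ = -A + 2 g U + lam V` in the basis `δ_x`. -/
def hamiltonian {L : ℕ} (n : ℕ) (g lam : ℝ) (η : Site L → ℝ) :
    Matrix (Config L n) (Config L n) ℂ :=
  -adjacency L n + ((2 * g : ℝ) : ℂ) • interaction L n + (lam : ℂ) • potential n η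

/-- The spectral projection `P_{E}(H)`: the orthogonal projection of `ℓ²` onto the eigenspace
of `H` at `E`. -/
def eigenprojection {ι : Type} [Fintype ι] [DecidableEq ι] (H : Matrix ι ι ℂ) (E : ℝ) :
    EuclideanSpace ℂ ι →L[ℂ] EuclideanSpace ℂ ι :=
  (Module.End.eigenspace (Matrix.toEuclideanLin H) (E : ℂ)).starProjection

open scoped Classical in
/-- The eigenfunction correlator
`Q(x, y, I) = ∑_{E ∈ σ(H) ∩ I} |⟨δ_x, P_{E}(H) δ_y⟩|` of a matrix `H`. -/
def correlator {ι : Type} [Fintype ι] [DecidableEq ι] (H : Matrix ι ι ℂ) (I : Set ℝ)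
    (x y : ι) : ℝ :=
  ∑ E ∈ (Matrix.finite_real_spectrum (A := H)).toFinset.filter (fun E => E ∈ I),
    ‖inner ℂ (EuclideanSpace.single x (1 : ℂ))
      (eigenprojection H E (EuclideanSpace.single y (1 : ℂ)))‖

open scoped Classical in
/-- The decay function `F_μ(x, y)`. -/
def decay {L n : ℕ} [NeZero n] (μ : ℝ) (x y : Config L n) : ℝ :=
  if IsClustered x then
    if IsClustered y then
      Real.exp (-μ * |pos x 0 - pos y 0|)
    else
      ∑ v : Config L n with IsClustered v,
        Real.exp (-μ * (|pos x 0 - pos v 0| + dist₁ v y))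
  else
    if IsClustered y then
      ∑ w : Config L n with IsClustered w,
        Real.exp (-μ * (dist₁ x w + |pos w 0 - pos y 0|))
    else
      ∑ w : Config L n with IsClustered w, ∑ v : Config L n with IsClustered v,
        Real.exp (-μ * (dist₁ x w + dist₁ v y + |pos w 0 - pos v 0|))

/-- The energy threshold `E(g, μ_T) = 4 g - 12 exp(μ_T)`. -/
def threshold (g μT : ℝ) : ℝ := 4 * g - 12 * Real.exp μT

/-- `ρ` is a bounded probability density with support in `[0, ωmax]`. -/
structure IsBoundedDensity (ρ : ℝ → ℝ) (ωmax : ℝ) : Prop where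
  nonneg : 0 ≤ᵐ[volume] ρ
  memLp_top : MemLp ρ ∞ volume
  support : ∀ᵐ t ∂volume, t ∉ Set.Icc 0 ωmax → ρ t = 0
  lintegral_eq_one : ∫⁻ t, ENNReal.ofReal (ρ t) = 1

/-- The random variables `ω α` are independent and identically distributed with density `ρ`. -/
structure IsIIDWithDensity {S Ω : Type*} [MeasurableSpace Ω] (P : Measure Ω)
    (ω : S → Ω → ℝ) (ρ : ℝ → ℝ) : Prop where
  measurable : ∀ α, Measurable (ω α)
  indep : iIndepFun ω P
  law : ∀ α, P.map (ω α) = volume.withDensity fun t => ENNReal.ofReal (ρ t)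

end

end HardCore

namespace HardCore

noncomputable section

/-! ### A mean value inequality on the half-plane -/

/-! The proof is a fractional moment argument for an effectively one-dimensional system. A clustered
configuration is determined by its first site. A configuration with k ≥ 2 clusters has at most 2k
neighbours, while for energies E in [0, 4g - 12 exp μT) its diagonal term exceeds E by at least 6k
exp μT. A maximum principle (`le_sum_clustered_of_subharmonic`, `norm_le_sum_clustered`) therefore
bounds solutions of the eigenvalue equation by their clustered values, with weight exp(-μT d). Sums
over configurations near a clustered one are bounded uniformly in n and L by a partition count
(`sum_exp_dist₁_le`).

Disorder enters one site at a time. As a function of the potential at a site u, the resolvent form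
is holomorphic in the lower half-plane with nonnegative imaginary part, and a bounded compactly
supported density is dominated by the Cauchy density. The mean value inequality
`lintegral_re_mul_cauchy_le` then yields two estimates for configurations occupying u: fractional
moments of the resolvent of order lam^(-s) (`lintegral_cauchy_norm_rpow_inv_pencil_le`), and
spectral averaging, by which the averaged spectral measure has density at most of order 1/lam
(`lintegral_spectralMeasure_perturbed_le`).

Let H_b be the Hamiltonian on configurations with first site at least b. A solution on a larger
half-line is expressed on [b, ∞) through the resolvent of H_b and the values of the solution at
configurations starting at b - 1 (`eq_sum_green_mul`). If x starts at u = b - 1, the resolvent of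
H_b does not depend on the potential at u, and the other factor is averaged over that potential.
Combined with the passage to clustered configurations, this bounds the moments by themselves with a
factor at most 1/2 for large lam; iteration gives exponential decay between clustered configurations
(`lintegral_green_le`).

The same decoupling is applied to the eigenfunctions P_E(·, x). Hölder interpolation bounds Q^(2-s)
by a sum of |P_E(x,y)|^s P_E(x,x)^(1-s), decoupling turns this into integrals of |G_b|^s against
spectral measures at configurations occupying u, and spectral averaging replaces those measures by
Lebesgue measure on I (`lintegral_correlator_rpow_le`). Jensen's inequality yields the bound between
clustered configurations; the maximum principle in each argument of the correlator produces the
remaining cases of `decay`. -/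

/-- A Cayley transform from the unit disc to the lower half-plane. -/
def cayley (w : ℂ) : ℂ := Complex.I * ((w - 1) / (w + 1))

theorem cayley_zero : cayley 0 = -Complex.I := by
  simp [cayley]

theorem cayley_im (w : ℂ) : (cayley w).im = (Complex.normSq w - 1) / Complex.normSq (w + 1) := by
  simp only [cayley, Complex.mul_im, Complex.I_re, Complex.I_im, Complex.div_re, Complex.sub_re,
    Complex.add_re, Complex.sub_im, Complex.add_im, Complex.one_re, Complex.one_im,
    Complex.normSq_apply]
  ring

theorem add_one_ne_zero_of_norm_lt_one {w : ℂ} (hw : ‖w‖ < 1) : w + 1 ≠ 0 := by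
  intro h
  have : w = -1 := eq_neg_of_add_eq_zero_left h
  simp [this] at hw

theorem cayley_im_neg {w : ℂ} (hw : ‖w‖ < 1) : (cayley w).im < 0 := by
  rw [cayley_im]
  apply div_neg_of_neg_of_pos
  · rw [Complex.normSq_eq_norm_sq]; nlinarith [norm_nonneg w]
  · exact Complex.normSq_pos.2 (add_one_ne_zero_of_norm_lt_one hw)

theorem differentiableAt_cayley {w : ℂ} (hw : w + 1 ≠ 0) : DifferentiableAt ℂ cayley w := by
  unfold cayley
  fun_prop (disch := assumption)

/-- Half-angle substitution: exp(-i arctan t) = (1 - it)/√(1 + t²), then squared. The sign is the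
one for which `cayley` sends the boundary point back to t. -/
theorem circleMap_neg_two_arctan (t : ℝ) :
    circleMap 0 1 (-(2 * Real.arctan t)) = (1 - t * Complex.I) / (1 + t * Complex.I) := by
  have h1 : (1 : ℂ) + t * Complex.I ≠ 0 := by
    intro h
    have := congrArg Complex.re h
    simp at this
  have hsq : Real.sqrt (1 + t ^ 2) ^ 2 = 1 + t ^ 2 := Real.sq_sqrt (by positivity)
  have hpos : 0 < 1 + t ^ 2 := by positivity
  have hexp : Complex.exp ((-Real.arctan t : ℝ) * Complex.I)
      = (1 - t * Complex.I) / (Real.sqrt (1 + t ^ 2) : ℝ) := by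
    rw [Complex.exp_mul_I, ← Complex.ofReal_cos, ← Complex.ofReal_sin, Real.cos_neg, Real.sin_neg,
      Real.cos_arctan, Real.sin_arctan]
    push_cast
    ring
  have : circleMap 0 1 (-(2 * Real.arctan t))
      = Complex.exp ((-Real.arctan t : ℝ) * Complex.I) ^ 2 := by
    rw [circleMap, ← Complex.exp_nat_mul]
    push_cast
    rw [zero_add, one_mul]
    congr 1
    ring
  rw [this, hexp, div_pow, eq_div_iff h1, ← Complex.ofReal_pow, hsq]
  have h2 : ((1 + t ^ 2 : ℝ) : ℂ) ≠ 0 := by exact_mod_cast hpos.ne'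
  rw [div_mul_eq_mul_div, div_eq_iff h2]
  push_cast
  have : Complex.I ^ 2 = -1 := Complex.I_sq
  linear_combination (-(1 - t * Complex.I) * t ^ 2) * this

theorem cayley_circleMap (t : ℝ) : cayley (circleMap 0 1 (-(2 * Real.arctan t))) = t := by
  rw [circleMap_neg_two_arctan, cayley]
  have h1 : (1 : ℂ) + t * Complex.I ≠ 0 := by
    intro h
    have := congrArg Complex.re h
    simp at this
  have : (1 - t * Complex.I) / (1 + t * Complex.I) + 1 = 2 / (1 + t * Complex.I) := by
    field_simp; ring
  have h' : (1 - t * Complex.I) / (1 + t * Complex.I) - 1 = -2 * t * Complex.I / (1 + t * Complex.I) := by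
    field_simp; ring
  rw [this, h', div_div_div_cancel_right₀ h1]
  linear_combination (-t : ℂ) * Complex.I_sq

theorem circleMap_add_one_ne_zero (t : ℝ) :
    circleMap 0 1 (-(2 * Real.arctan t)) + 1 ≠ 0 := by
  rw [circleMap_neg_two_arctan]
  have h1 : (1 : ℂ) + t * Complex.I ≠ 0 := by
    intro h
    have := congrArg Complex.re h
    simp at this
  have : (1 - t * Complex.I) / (1 + t * Complex.I) + 1 = 2 / (1 + t * Complex.I) := by
    field_simp; ring
  rw [this]
  exact div_ne_zero two_ne_zero h1

theorem image_neg_two_arctan :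
    (fun t : ℝ => -(2 * Real.arctan t)) '' Set.univ = Set.Ioo (-Real.pi) Real.pi := by
  ext θ
  simp only [Set.image_univ, Set.mem_range, Set.mem_Ioo]
  constructor
  · rintro ⟨t, rfl⟩
    have := Real.arctan_lt_pi_div_two t
    have := Real.neg_pi_div_two_lt_arctan t
    constructor <;> linarith
  · rintro ⟨h1, h2⟩
    refine ⟨Real.tan (-(θ / 2)), ?_⟩
    rw [Real.arctan_tan (by linarith) (by linarith)]
    ring

/-- Mean value property on a circle of radius r < 1, whose closed disc is mapped into the open
half-plane; the centre goes to -i. -/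
theorem integral_circleMap_cayley {h : ℂ → ℂ} (hd : ∀ ξ : ℂ, ξ.im < 0 → DifferentiableAt ℂ h ξ)
    {r : ℝ} (hr0 : 0 < r) (hr : r < 1) :
    ∫ θ in (-Real.pi)..Real.pi, h (cayley (circleMap 0 r θ)) = 2 * Real.pi * h (-Complex.I) := by
  have hD : DiffContOnCl ℂ (fun w => h (cayley w)) (Metric.ball 0 |r|) := by
    apply DifferentiableOn.diffContOnCl
    intro w hw
    have hw' : ‖w‖ < 1 := by
      have := Metric.closure_ball_subset_closedBall hw
      rw [mem_closedBall_zero_iff, abs_of_pos hr0] at this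
      linarith
    exact ((hd _ (cayley_im_neg hw')).comp w
      (differentiableAt_cayley (add_one_ne_zero_of_norm_lt_one hw'))).differentiableWithinAt
  have h1 := hD.circleAverage
  rw [Real.circleAverage_def, cayley_zero] at h1
  have hper : Function.Periodic (fun θ => h (cayley (circleMap 0 r θ))) (2 * Real.pi) := by
    intro θ
    simp only [periodic_circleMap 0 r θ]
  have h2 := hper.intervalIntegral_add_eq (-Real.pi) 0
  rw [show -Real.pi + 2 * Real.pi = Real.pi by ring, zero_add] at h2
  rw [h2, ← h1, Complex.real_smul]
  push_cast
  have : (Real.pi : ℂ) ≠ 0 := by exact_mod_cast Real.pi_ne_zero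
  field_simp

/-- A function on the closed lower half-plane that is holomorphic in the interior, continuous at
real points and has nonnegative real part satisfies a mean value inequality with respect to the
Cauchy density. -/
theorem lintegral_re_mul_cauchy_le {h : ℂ → ℂ}
    (hd : ∀ ξ : ℂ, ξ.im < 0 → DifferentiableAt ℂ h ξ)
    (hc : ∀ t : ℝ, ContinuousAt h t) (hpos : ∀ ξ : ℂ, ξ.im < 0 → 0 ≤ (h ξ).re) :
    ∫⁻ t : ℝ, ENNReal.ofReal ((1 + t ^ 2)⁻¹) * ENNReal.ofReal (h t).re
      ≤ ENNReal.ofReal (Real.pi * (h (-Complex.I)).re) := by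
  set F : ℝ → ℝ → ℝ := fun r θ => (h (cayley (circleMap 0 r θ))).re with hF
  have hcont : ∀ r, 0 < r → r < 1 → Continuous fun θ => h (cayley (circleMap 0 r θ)) := by
    intro r hr0 hr
    rw [continuous_iff_continuousAt]
    intro θ
    have hw' : ‖circleMap 0 r θ‖ < 1 := by
      rw [norm_circleMap_zero, abs_of_pos hr0]; exact hr
    exact ((hd _ (cayley_im_neg hw')).continuousAt.comp
      (differentiableAt_cayley (add_one_ne_zero_of_norm_lt_one hw')).continuousAt).comp
      (continuous_circleMap 0 r).continuousAt
  have hint : ∀ r, 0 < r → r < 1 → ∫⁻ θ in Set.Ioo (-Real.pi) Real.pi, ENNReal.ofReal (F r θ)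
      = ENNReal.ofReal (2 * Real.pi * (h (-Complex.I)).re) := by
    intro r hr0 hr
    have hcr := hcont r hr0 hr
    have hii : Integrable (fun θ => h (cayley (circleMap 0 r θ)))
        (volume.restrict (Set.Ioo (-Real.pi) Real.pi)) :=
      (hcr.integrableOn_Icc (a := -Real.pi) (b := Real.pi)).mono_set Set.Ioo_subset_Icc_self
    rw [← ofReal_integral_eq_lintegral_ofReal]
    · congr 1
      have h1 := integral_circleMap_cayley hd hr0 hr
      rw [intervalIntegral.integral_of_le (by linarith [Real.pi_pos]),
        integral_Ioc_eq_integral_Ioo] at h1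
      have h2 := congrArg Complex.re h1
      rw [show (∫ θ in Set.Ioo (-Real.pi) Real.pi, F r θ)
        = (∫ θ in Set.Ioo (-Real.pi) Real.pi, h (cayley (circleMap 0 r θ))).re from
          integral_re hii, h2]
      rw [show (2 * Real.pi : ℂ) = ((2 * Real.pi : ℝ) : ℂ) by push_cast; rfl,
        Complex.re_ofReal_mul]
    · exact hii.re
    · refine Filter.Eventually.of_forall fun θ => hpos _ (cayley_im_neg ?_)
      rw [norm_circleMap_zero, abs_of_pos hr0]; exact hr
  have hderiv : ∀ t ∈ (Set.univ : Set ℝ), HasDerivWithinAt (fun t : ℝ => -(2 * Real.arctan t))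
      (-(2 * (1 / (1 + t ^ 2)))) Set.univ t := fun t _ =>
    (((Real.hasDerivAt_arctan t).const_mul 2).neg).hasDerivWithinAt
  have hinj : Set.InjOn (fun t : ℝ => -(2 * Real.arctan t)) Set.univ := by
    intro a _ b _ hab
    have : Real.arctan a = Real.arctan b := by
      simp only at hab; linarith
    exact Real.arctan_injective this
  have hcv := lintegral_image_eq_lintegral_abs_deriv_mul MeasurableSet.univ hderiv hinj
    (fun θ => ENNReal.ofReal (F 1 θ))
  rw [image_neg_two_arctan, Measure.restrict_univ] at hcv
  have hlhs : ∫⁻ t : ℝ, ENNReal.ofReal ((1 + t ^ 2)⁻¹) * ENNReal.ofReal (h t).re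
      = ENNReal.ofReal (1 / 2) * ∫⁻ θ in Set.Ioo (-Real.pi) Real.pi, ENNReal.ofReal (F 1 θ) := by
    rw [hcv, ← lintegral_const_mul' _ _ ENNReal.ofReal_ne_top]
    refine lintegral_congr fun t => ?_
    have h0 : (0 : ℝ) < 1 + t ^ 2 := by positivity
    have h1 : 1 / 2 * |(-(2 * (1 / (1 + t ^ 2))))| = (1 + t ^ 2)⁻¹ := by
      rw [abs_neg, abs_of_pos (by positivity)]
      ring
    rw [← mul_assoc, ← ENNReal.ofReal_mul (p := 1 / 2) (by norm_num), h1]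
    simp only [hF, cayley_circleMap]
  rw [hlhs]
  -- Nonnegativity allows Fatou's lemma as the radius tends to 1. Only an inequality survives, since
  -- mass may escape to w = -1, the point sent to infinity.
  have hfatou : ∫⁻ θ in Set.Ioo (-Real.pi) Real.pi, ENNReal.ofReal (F 1 θ)
      ≤ ENNReal.ofReal (2 * Real.pi * (h (-Complex.I)).re) := by
    set r : ℕ → ℝ := fun k => 1 - 1 / ((k : ℝ) + 2) with hr
    have hr0 : ∀ k, 0 < r k := fun k => by
      have : (1 : ℝ) / (k + 2) ≤ 1 / 2 := one_div_le_one_div_of_le (by norm_num) (by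
        have : (0 : ℝ) ≤ k := k.cast_nonneg
        linarith)
      simp only [hr]; linarith
    have hr1 : ∀ k, r k < 1 := fun k => by
      have : (0 : ℝ) < 1 / (k + 2) := by positivity
      simp only [hr]; linarith
    have hrt : Filter.Tendsto r Filter.atTop (nhds 1) := by
      have h0 : Filter.Tendsto (fun k : ℕ => (1 : ℝ) / ((k : ℝ) + 2)) Filter.atTop (nhds 0) := by
        have := (tendsto_one_div_add_atTop_nhds_zero_nat (𝕜 := ℝ)).comp (Filter.tendsto_add_atTop_nat 1)
        refine this.congr fun k => ?_
        simp only [Function.comp]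
        push_cast
        ring_nf
      simpa [hr] using tendsto_const_nhds.sub h0 (a := (1 : ℝ))
    calc ∫⁻ θ in Set.Ioo (-Real.pi) Real.pi, ENNReal.ofReal (F 1 θ)
        = ∫⁻ θ in Set.Ioo (-Real.pi) Real.pi,
            Filter.liminf (fun k => ENNReal.ofReal (F (r k) θ)) Filter.atTop := by
          refine setLIntegral_congr_fun measurableSet_Ioo fun θ hθ => ?_
          have ht : ∃ t : ℝ, -(2 * Real.arctan t) = θ := by
            have : θ ∈ (fun t : ℝ => -(2 * Real.arctan t)) '' Set.univ := by
              rw [image_neg_two_arctan]; exact hθ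
            obtain ⟨t, -, ht⟩ := this
            exact ⟨t, ht⟩
          obtain ⟨t, rfl⟩ := ht
          symm
          apply Filter.Tendsto.liminf_eq
          refine (ENNReal.continuous_ofReal.tendsto _).comp ?_
          refine (Complex.continuous_re.tendsto _).comp ?_
          have e1 : ContinuousAt h (cayley (circleMap 0 1 (-(2 * Real.arctan t)))) := by
            rw [cayley_circleMap]; exact hc t
          refine Filter.Tendsto.comp e1 ?_
          refine Filter.Tendsto.comp (g := cayley)
            (differentiableAt_cayley (circleMap_add_one_ne_zero t)).continuousAt ?_
          have : Continuous fun ρ : ℝ => circleMap 0 ρ (-(2 * Real.arctan t)) := by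
            unfold circleMap; fun_prop
          exact (this.tendsto 1).comp hrt
      _ ≤ Filter.liminf (fun k => ∫⁻ θ in Set.Ioo (-Real.pi) Real.pi,
            ENNReal.ofReal (F (r k) θ)) Filter.atTop := by
          refine lintegral_liminf_le fun k => ?_
          exact ENNReal.measurable_ofReal.comp
            (Complex.continuous_re.comp (hcont _ (hr0 k) (hr1 k))).measurable
      _ = _ := by
          simp only [fun k => hint _ (hr0 k) (hr1 k), Filter.liminf_const]
  calc _ ≤ ENNReal.ofReal (1 / 2) * ENNReal.ofReal (2 * Real.pi * (h (-Complex.I)).re) := by gcongr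
    _ = _ := by
      rw [← ENNReal.ofReal_mul (by norm_num)]
      congr 1
      ring

end

end HardCore

namespace HardCore

noncomputable section

open scoped Matrix

/-! ### Resolvents of Hermitian matrices with a diagonal perturbation -/

section Resolvent

variable {ι : Type*} [Fintype ι] [DecidableEq ι]

/-- The matrix `H₀ + ξ lam N - ζ`. -/
def pencil (H₀ : Matrix ι ι ℂ) (N : ι → ℝ) (lam : ℝ) (ζ ξ : ℂ) : Matrix ι ι ℂ :=
  H₀ + (ξ * lam) • Matrix.diagonal (fun i => (N i : ℂ)) - ζ • (1 : Matrix ι ι ℂ)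

/-- The Hermitian part has a real quadratic form, so only ξ and ζ contribute. For Im ξ ≤ 0 < Im ζ
the two contributions have the same sign, the source of both invertibility and positivity below. -/
theorem quadratic_im_pencil {H₀ : Matrix ι ι ℂ} (hH : H₀.IsHermitian) (N : ι → ℝ) (lam : ℝ)
    (ζ ξ : ℂ) (φ : ι → ℂ) :
    (star φ ⬝ᵥ (pencil H₀ N lam ζ ξ *ᵥ φ)).im
      = ξ.im * lam * (∑ i, N i * ‖φ i‖ ^ 2) - ζ.im * ∑ i, ‖φ i‖ ^ 2 := by
  have h0 : (star φ ⬝ᵥ (H₀ *ᵥ φ)).im = 0 := by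
    simpa using hH.im_star_dotProduct_mulVec_self φ
  have hsq : ∀ i, star (φ i) * φ i = ((‖φ i‖ ^ 2 : ℝ) : ℂ) := fun i => by
    rw [Complex.star_def, ← Complex.normSq_eq_conj_mul_self, Complex.normSq_eq_norm_sq]
  have h1 : star φ ⬝ᵥ (Matrix.diagonal (fun i => (N i : ℂ)) *ᵥ φ)
      = ((∑ i, N i * ‖φ i‖ ^ 2 : ℝ) : ℂ) := by
    simp only [dotProduct, Matrix.mulVec_diagonal, Pi.star_apply, Complex.ofReal_sum]
    refine Finset.sum_congr rfl fun i _ => ?_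
    rw [Complex.ofReal_mul, ← hsq]; ring
  have h2 : star φ ⬝ᵥ φ = ((∑ i, ‖φ i‖ ^ 2 : ℝ) : ℂ) := by
    simp only [dotProduct, Pi.star_apply, Complex.ofReal_sum]
    exact Finset.sum_congr rfl fun i _ => hsq i
  rw [pencil, Matrix.sub_mulVec, Matrix.add_mulVec, dotProduct_sub, dotProduct_add,
    Matrix.smul_mulVec, Matrix.smul_mulVec, Matrix.one_mulVec, dotProduct_smul, dotProduct_smul,
    h1, h2, Complex.sub_im, Complex.add_im, h0, smul_eq_mul, smul_eq_mul, Complex.im_mul_ofReal,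
    Complex.im_mul_ofReal, Complex.im_mul_ofReal, zero_add]

theorem det_pencil_ne_zero {H₀ : Matrix ι ι ℂ} (hH : H₀.IsHermitian) {N : ι → ℝ}
    (hN : ∀ i, 0 ≤ N i) {lam : ℝ} (hlam : 0 ≤ lam) {ζ ξ : ℂ} (hζ : 0 < ζ.im) (hξ : ξ.im ≤ 0) :
    (pencil H₀ N lam ζ ξ).det ≠ 0 := by
  intro hdet
  obtain ⟨φ, hφ, h⟩ := Matrix.exists_mulVec_eq_zero_iff.2 hdet
  have h1 := quadratic_im_pencil hH N lam ζ ξ φ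
  rw [h, dotProduct_zero, Complex.zero_im] at h1
  have h2 : 0 < ∑ i, ‖φ i‖ ^ 2 := by
    obtain ⟨i, hi⟩ := Function.ne_iff.1 hφ
    exact Finset.sum_pos' (fun i _ => by positivity)
      ⟨i, Finset.mem_univ i, by have := norm_pos_iff.2 hi; positivity⟩
  have h3 : 0 ≤ ∑ i, N i * ‖φ i‖ ^ 2 :=
    Finset.sum_nonneg fun i _ => mul_nonneg (hN i) (by positivity)
  have h4 : ξ.im * lam * (∑ i, N i * ‖φ i‖ ^ 2) ≤ 0 :=
    mul_nonpos_of_nonpos_of_nonneg (mul_nonpos_of_nonpos_of_nonneg hξ hlam) h3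
  nlinarith [mul_pos hζ h2]

theorem differentiableAt_det {M : ℂ → Matrix ι ι ℂ} {ξ : ℂ}
    (hM : ∀ i j, DifferentiableAt ℂ (fun z => M z i j) ξ) :
    DifferentiableAt ℂ (fun z => (M z).det) ξ := by
  simp only [Matrix.det_apply]
  refine DifferentiableAt.fun_sum fun σ _ => ?_
  refine DifferentiableAt.const_smul ?_ _
  exact DifferentiableAt.fun_finsetProd fun i _ => hM _ _

/-- Cramer's rule: entries of the inverse are cofactors divided by the determinant. -/
theorem differentiableAt_inv {M : ℂ → Matrix ι ι ℂ} {ξ : ℂ}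
    (hM : ∀ i j, DifferentiableAt ℂ (fun z => M z i j) ξ) (hdet : (M ξ).det ≠ 0) (i j : ι) :
    DifferentiableAt ℂ (fun z => (M z)⁻¹ i j) ξ := by
  simp only [Matrix.inv_def, Ring.inverse_eq_inv', Matrix.smul_apply, smul_eq_mul]
  refine ((differentiableAt_det hM).inv hdet).mul ?_
  simp only [Matrix.adjugate_apply]
  refine differentiableAt_det fun k l => ?_
  by_cases hk : k = j
  · subst hk; simp [Matrix.updateRow_self]
  · simp only [Matrix.updateRow_ne hk]; exact hM k l

/-! ### Positivity and fractional moments of the resolvent form -/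

/-- The quadratic form of the resolvent. -/
def quadResolvent (H₀ : Matrix ι ι ℂ) (N : ι → ℝ) (lam : ℝ) (ζ : ℂ) (v : ι → ℂ) (ξ : ℂ) : ℂ :=
  star v ⬝ᵥ ((pencil H₀ N lam ζ ξ)⁻¹ *ᵥ v)

theorem differentiableAt_quadResolvent {H₀ : Matrix ι ι ℂ} (hH : H₀.IsHermitian) {N : ι → ℝ}
    (hN : ∀ i, 0 ≤ N i) {lam : ℝ} (hlam : 0 ≤ lam) {ζ ξ : ℂ} (hζ : 0 < ζ.im) (hξ : ξ.im ≤ 0)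
    (v : ι → ℂ) : DifferentiableAt ℂ (quadResolvent H₀ N lam ζ v) ξ := by
  unfold quadResolvent
  simp only [dotProduct, Matrix.mulVec]
  refine DifferentiableAt.fun_sum fun i _ => DifferentiableAt.const_mul ?_ _
  refine DifferentiableAt.fun_sum fun j _ => DifferentiableAt.mul_const ?_ _
  refine differentiableAt_inv (fun k l => ?_) (det_pencil_ne_zero hH hN hlam hζ hξ) i j
  simp only [pencil, Matrix.sub_apply, Matrix.add_apply, Matrix.smul_apply]
  fun_prop

/-- The imaginary part of the quadratic form of the resolvent. -/
theorem exists_quadResolvent_eq {H₀ : Matrix ι ι ℂ} (hH : H₀.IsHermitian) {N : ι → ℝ}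
    (hN : ∀ i, 0 ≤ N i) {lam : ℝ} (hlam : 0 ≤ lam) {ζ ξ : ℂ} (hζ : 0 < ζ.im) (hξ : ξ.im ≤ 0)
    (v : ι → ℂ) : ∃ φ : ι → ℂ, pencil H₀ N lam ζ ξ *ᵥ φ = v ∧
      quadResolvent H₀ N lam ζ v ξ = star v ⬝ᵥ φ ∧
      (quadResolvent H₀ N lam ζ v ξ).im
        = -(ξ.im * lam * (∑ i, N i * ‖φ i‖ ^ 2)) + ζ.im * ∑ i, ‖φ i‖ ^ 2 := by
  have hdet := det_pencil_ne_zero hH hN hlam hζ hξ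
  refine ⟨(pencil H₀ N lam ζ ξ)⁻¹ *ᵥ v, ?_, rfl, ?_⟩
  · rw [Matrix.mulVec_mulVec, Matrix.mul_nonsing_inv _ (Ne.isUnit hdet), Matrix.one_mulVec]
  · set φ := (pencil H₀ N lam ζ ξ)⁻¹ *ᵥ v with hφ
    have h1 : pencil H₀ N lam ζ ξ *ᵥ φ = v := by
      rw [hφ, Matrix.mulVec_mulVec, Matrix.mul_nonsing_inv _ (Ne.isUnit hdet), Matrix.one_mulVec]
    -- With M φ = v, the form ⟨v, φ⟩ is the conjugate of ⟨φ, M φ⟩, whose imaginary part is known.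
    have h2 : quadResolvent H₀ N lam ζ v ξ
        = star (star φ ⬝ᵥ (pencil H₀ N lam ζ ξ *ᵥ φ)) := by
      rw [h1, quadResolvent, ← hφ, Matrix.star_dotProduct]
    rw [h2, Complex.star_def, Complex.conj_im, quadratic_im_pencil hH]
    ring

theorem quadResolvent_im_nonneg {H₀ : Matrix ι ι ℂ} (hH : H₀.IsHermitian) {N : ι → ℝ}
    (hN : ∀ i, 0 ≤ N i) {lam : ℝ} (hlam : 0 ≤ lam) {ζ ξ : ℂ} (hζ : 0 < ζ.im) (hξ : ξ.im ≤ 0)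
    (v : ι → ℂ) : 0 ≤ (quadResolvent H₀ N lam ζ v ξ).im := by
  obtain ⟨φ, -, -, h⟩ := exists_quadResolvent_eq hH hN hlam hζ hξ v
  rw [h]
  have h3 : 0 ≤ ∑ i, N i * ‖φ i‖ ^ 2 :=
    Finset.sum_nonneg fun i _ => mul_nonneg (hN i) (by positivity)
  have h4 : ξ.im * lam * (∑ i, N i * ‖φ i‖ ^ 2) ≤ 0 :=
    mul_nonpos_of_nonpos_of_nonneg (mul_nonpos_of_nonpos_of_nonneg hξ hlam) h3
  have : 0 ≤ ζ.im * ∑ i, ‖φ i‖ ^ 2 := by positivity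
  linarith

theorem quadResolvent_im_pos {H₀ : Matrix ι ι ℂ} (hH : H₀.IsHermitian) {N : ι → ℝ}
    (hN : ∀ i, 0 ≤ N i) {lam : ℝ} (hlam : 0 ≤ lam) {ζ ξ : ℂ} (hζ : 0 < ζ.im) (hξ : ξ.im ≤ 0)
    {v : ι → ℂ} (hv : v ≠ 0) : 0 < (quadResolvent H₀ N lam ζ v ξ).im := by
  obtain ⟨φ, hφ, -, h⟩ := exists_quadResolvent_eq hH hN hlam hζ hξ v
  rw [h]
  have h3 : 0 ≤ ∑ i, N i * ‖φ i‖ ^ 2 :=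
    Finset.sum_nonneg fun i _ => mul_nonneg (hN i) (by positivity)
  have h4 : ξ.im * lam * (∑ i, N i * ‖φ i‖ ^ 2) ≤ 0 :=
    mul_nonpos_of_nonpos_of_nonneg (mul_nonpos_of_nonpos_of_nonneg hξ hlam) h3
  have hφ0 : φ ≠ 0 := by
    rintro rfl
    exact hv (by rw [← hφ, Matrix.mulVec_zero])
  have h2 : 0 < ∑ i, ‖φ i‖ ^ 2 := by
    obtain ⟨i, hi⟩ := Function.ne_iff.1 hφ0
    exact Finset.sum_pos' (fun i _ => by positivity)
      ⟨i, Finset.mem_univ i, by have := norm_pos_iff.2 hi; positivity⟩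
  have := mul_pos hζ h2
  linarith

/-- At ξ = -i the perturbation is itself dissipative: with a the norm of the form and φ the
resolvent applied to v, lam ∑ N|φ|² ≤ a. Since v lives where N = 1, Cauchy–Schwarz gives a² ≤ ‖v‖² ∑
N|φ|², hence a bound that is uniform in ζ and in the dimension. -/
theorem norm_quadResolvent_neg_I_le {H₀ : Matrix ι ι ℂ} (hH : H₀.IsHermitian) {N : ι → ℝ}
    (hN : ∀ i, 0 ≤ N i) {lam : ℝ} (hlam : 0 < lam) {ζ : ℂ} (hζ : 0 < ζ.im)
    {v : ι → ℂ} (hv : ∀ i, v i ≠ 0 → N i = 1) :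
    ‖quadResolvent H₀ N lam ζ v (-Complex.I)‖ ≤ (∑ i, ‖v i‖ ^ 2) / lam := by
  obtain ⟨φ, hφ, h1, h⟩ := exists_quadResolvent_eq hH hN hlam.le hζ
    (ξ := -Complex.I) (by simp) v
  set a := ‖quadResolvent H₀ N lam ζ v (-Complex.I)‖ with ha
  have h2 : lam * (∑ i, N i * ‖φ i‖ ^ 2) ≤ a := by
    have := Complex.im_le_norm (quadResolvent H₀ N lam ζ v (-Complex.I))
    rw [h] at this
    have h0 : 0 ≤ ζ.im * ∑ i, ‖φ i‖ ^ 2 := by positivity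
    simp at this
    linarith
  have h3 : a ^ 2 ≤ (∑ i, ‖v i‖ ^ 2) * (∑ i, N i * ‖φ i‖ ^ 2) := by
    have h4 : a ≤ ∑ i, ‖v i‖ * (Real.sqrt (N i) * ‖φ i‖) := by
      rw [ha, h1, dotProduct]
      refine (norm_sum_le _ _).trans (Finset.sum_le_sum fun i _ => ?_)
      rw [norm_mul, Pi.star_apply, norm_star]
      by_cases hi : v i = 0
      · simp [hi]
      · rw [hv i hi]; simp
    have h5 := Finset.sum_mul_sq_le_sq_mul_sq Finset.univ (fun i => ‖v i‖)
      (fun i => Real.sqrt (N i) * ‖φ i‖)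
    calc a ^ 2 ≤ (∑ i, ‖v i‖ * (Real.sqrt (N i) * ‖φ i‖)) ^ 2 :=
          pow_le_pow_left₀ (norm_nonneg _) h4 2
      _ ≤ _ := h5
      _ = _ := by
        congr 1
        refine Finset.sum_congr rfl fun i _ => ?_
        rw [mul_pow, Real.sq_sqrt (hN i)]
  have hv0 : 0 ≤ ∑ i, ‖v i‖ ^ 2 := by positivity
  have ha0 : 0 ≤ a := norm_nonneg _
  rw [le_div_iff₀ hlam]
  rcases ha0.eq_or_lt with h0 | h0
  · rw [← h0]; simpa using hv0
  · refine le_of_mul_le_mul_left ?_ h0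
    nlinarith [mul_le_mul_of_nonneg_left h2 hv0, mul_le_mul_of_nonneg_left h3 hlam.le]

/-- Averaging the imaginary part of the resolvent over the strength of the perturbation. -/
theorem lintegral_cauchy_im_quadResolvent_le {H₀ : Matrix ι ι ℂ} (hH : H₀.IsHermitian)
    {N : ι → ℝ} (hN : ∀ i, 0 ≤ N i) {lam : ℝ} (hlam : 0 < lam) {ζ : ℂ} (hζ : 0 < ζ.im)
    {v : ι → ℂ} (hv : ∀ i, v i ≠ 0 → N i = 1) :
    ∫⁻ t : ℝ, ENNReal.ofReal ((1 + t ^ 2)⁻¹) *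
        ENNReal.ofReal (quadResolvent H₀ N lam ζ v t).im
      ≤ ENNReal.ofReal (Real.pi * ((∑ i, ‖v i‖ ^ 2) / lam)) := by
  have hre : ∀ ξ, (-Complex.I * quadResolvent H₀ N lam ζ v ξ).re
      = (quadResolvent H₀ N lam ζ v ξ).im := fun ξ => by simp
  have := lintegral_re_mul_cauchy_le (h := fun ξ => -Complex.I * quadResolvent H₀ N lam ζ v ξ)
    (fun ξ hξ => (differentiableAt_quadResolvent hH hN hlam.le hζ hξ.le v).const_mul _)
    (fun t => ((differentiableAt_quadResolvent hH hN hlam.le hζ (by simp) v).const_mul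
      _).continuousAt)
    (fun ξ hξ => by rw [hre]; exact quadResolvent_im_nonneg hH hN hlam.le hζ hξ.le v)
  simp only [hre] at this
  refine this.trans (ENNReal.ofReal_le_ofReal ?_)
  gcongr
  exact (Complex.im_le_norm _).trans (norm_quadResolvent_neg_I_le hH hN hlam hζ hv)

/-- The argument of z^s lies in [0, πs]. Rotation by -πs/2 centres this sector on the positive real
axis, where the real part controls the modulus because s < 1. -/
theorem cos_mul_norm_rpow_le_re {z : ℂ} (hz : 0 < z.im) {s : ℝ} (hs0 : 0 < s) (hs1 : s < 1) :
    Real.cos (Real.pi * s / 2) * ‖z‖ ^ s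
      ≤ (Complex.exp (-(Real.pi * s / 2 : ℝ) * Complex.I) * z ^ (s : ℂ)).re := by
  have hz0 : z ≠ 0 := by rintro rfl; simp at hz
  have harg0 : 0 ≤ Complex.arg z := Complex.arg_nonneg_iff.2 hz.le
  have harg1 : Complex.arg z ≤ Real.pi := Complex.arg_le_pi z
  have hpow : z ^ (s : ℂ) = (‖z‖ ^ s : ℝ) * Complex.exp ((s * Complex.arg z : ℝ) * Complex.I) := by
    rw [Complex.cpow_def_of_ne_zero hz0, Complex.log, add_mul, Complex.exp_add,
      Real.rpow_def_of_pos (norm_pos_iff.2 hz0)]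
    push_cast
    congr 2
    ring
  have : Complex.exp (-(Real.pi * s / 2 : ℝ) * Complex.I) * z ^ (s : ℂ)
      = (‖z‖ ^ s : ℝ) * Complex.exp ((s * Complex.arg z - Real.pi * s / 2 : ℝ) * Complex.I) := by
    rw [hpow, mul_left_comm, ← Complex.exp_add]
    congr 2
    push_cast
    ring
  rw [this, Complex.re_ofReal_mul, Complex.exp_ofReal_mul_I_re, mul_comm]
  refine mul_le_mul_of_nonneg_left ?_ (by positivity)
  rw [← Real.cos_abs (s * Complex.arg z - Real.pi * s / 2)]
  have hpi := Real.pi_pos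
  refine Real.cos_le_cos_of_nonneg_of_le_pi (abs_nonneg _) (by nlinarith) ?_
  rw [abs_le]
  constructor <;> nlinarith

/-- Fractional moments of the quadratic form of the resolvent. -/
theorem lintegral_cauchy_norm_rpow_quadResolvent_le {H₀ : Matrix ι ι ℂ} (hH : H₀.IsHermitian)
    {N : ι → ℝ} (hN : ∀ i, 0 ≤ N i) {lam : ℝ} (hlam : 0 < lam) {ζ : ℂ} (hζ : 0 < ζ.im)
    {v : ι → ℂ} (hv : ∀ i, v i ≠ 0 → N i = 1) {s : ℝ} (hs0 : 0 < s) (hs1 : s < 1) :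
    ∫⁻ t : ℝ, ENNReal.ofReal ((1 + t ^ 2)⁻¹) *
        ENNReal.ofReal (‖quadResolvent H₀ N lam ζ v t‖ ^ s)
      ≤ ENNReal.ofReal (Real.pi * ((∑ i, ‖v i‖ ^ 2) / lam) ^ s / Real.cos (Real.pi * s / 2)) := by
  have hpi := Real.pi_pos
  have hcos : 0 < Real.cos (Real.pi * s / 2) :=
    Real.cos_pos_of_mem_Ioo ⟨by nlinarith, by nlinarith⟩
  by_cases hv0 : v = 0
  · subst hv0
    simp [quadResolvent, Real.zero_rpow hs0.ne']
  -- The rotated power of the form is holomorphic with nonnegative real part, so the mean value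
  -- inequality applies to it directly.
  set h : ℂ → ℂ := fun ξ => Complex.exp (-(Real.pi * s / 2 : ℝ) * Complex.I) *
    quadResolvent H₀ N lam ζ v ξ ^ (s : ℂ) with hh
  have him : ∀ ξ : ℂ, ξ.im ≤ 0 → 0 < (quadResolvent H₀ N lam ζ v ξ).im := fun ξ hξ =>
    quadResolvent_im_pos hH hN hlam.le hζ hξ hv0
  have hdiff : ∀ ξ : ℂ, ξ.im ≤ 0 → DifferentiableAt ℂ h ξ := fun ξ hξ => by
    refine DifferentiableAt.const_mul ?_ _
    refine (differentiableAt_quadResolvent hH hN hlam.le hζ hξ v).cpow_const ?_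
    exact Or.inr (him ξ hξ).ne'
  have hlow : ∀ ξ : ℂ, ξ.im ≤ 0 →
      Real.cos (Real.pi * s / 2) * ‖quadResolvent H₀ N lam ζ v ξ‖ ^ s ≤ (h ξ).re :=
    fun ξ hξ => cos_mul_norm_rpow_le_re (him ξ hξ) hs0 hs1
  have hmain := lintegral_re_mul_cauchy_le (h := h) (fun ξ hξ => hdiff ξ hξ.le)
    (fun t => (hdiff t (by simp)).continuousAt)
    (fun ξ hξ => le_trans (by positivity) (hlow ξ hξ.le))
  have hnorm : (h (-Complex.I)).re ≤ ((∑ i, ‖v i‖ ^ 2) / lam) ^ s := by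
    refine (Complex.re_le_norm _).trans ?_
    rw [hh, norm_mul, Complex.norm_exp, Complex.norm_cpow_real]
    have h0 : (-((Real.pi * s / 2 : ℝ) : ℂ) * Complex.I).re = 0 := by simp
    rw [h0, Real.exp_zero, one_mul]
    exact Real.rpow_le_rpow (norm_nonneg _) (norm_quadResolvent_neg_I_le hH hN hlam hζ hv) hs0.le
  calc ∫⁻ t : ℝ, ENNReal.ofReal ((1 + t ^ 2)⁻¹) *
        ENNReal.ofReal (‖quadResolvent H₀ N lam ζ v t‖ ^ s)
      ≤ ∫⁻ t : ℝ, ENNReal.ofReal (Real.cos (Real.pi * s / 2))⁻¹ *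
        (ENNReal.ofReal ((1 + t ^ 2)⁻¹) * ENNReal.ofReal (h t).re) := by
        refine lintegral_mono fun t => ?_
        rw [mul_left_comm, ← ENNReal.ofReal_mul (p := (Real.cos (Real.pi * s / 2))⁻¹) (by positivity)]
        refine mul_le_mul_right (ENNReal.ofReal_le_ofReal ?_) _
        rw [inv_mul_eq_div, le_div_iff₀ hcos, mul_comm]
        exact hlow t (by simp)
    _ ≤ ENNReal.ofReal (Real.cos (Real.pi * s / 2))⁻¹ *
        ENNReal.ofReal (Real.pi * (h (-Complex.I)).re) := by
        rw [lintegral_const_mul' _ _ ENNReal.ofReal_ne_top]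
        exact mul_le_mul_right hmain _
    _ ≤ _ := by
        rw [← ENNReal.ofReal_mul (by positivity)]
        refine ENNReal.ofReal_le_ofReal ?_
        rw [inv_mul_eq_div]
        gcongr

/-- Reduces matrix elements to quadratic forms of vectors supported on {x, z}, so that the
requirement N = 1 on the support only concerns x and z. -/
theorem polarization (R : Matrix ι ι ℂ) (x z : ι) :
    4 * R x z = star (Pi.single x 1 + Pi.single z 1 : ι → ℂ) ⬝ᵥ (R *ᵥ (Pi.single x 1 + Pi.single z 1))
      - star (Pi.single x 1 + Pi.single z (-1) : ι → ℂ) ⬝ᵥ (R *ᵥ (Pi.single x 1 + Pi.single z (-1)))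
      - Complex.I * (star (Pi.single x 1 + Pi.single z Complex.I : ι → ℂ) ⬝ᵥ
          (R *ᵥ (Pi.single x 1 + Pi.single z Complex.I)))
      + Complex.I * (star (Pi.single x 1 + Pi.single z (-Complex.I) : ι → ℂ) ⬝ᵥ
          (R *ᵥ (Pi.single x 1 + Pi.single z (-Complex.I)))) := by
  have key : ∀ β : ℂ, star (Pi.single x 1 + Pi.single z β : ι → ℂ) ⬝ᵥ
      (R *ᵥ (Pi.single x 1 + Pi.single z β))
      = R x x + β * R x z + star β * R z x + star β * β * R z z := by
    intro β
    simp only [star_add, add_dotProduct, Matrix.mulVec_add, dotProduct_add, ← Pi.single_star,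
      single_dotProduct, Matrix.mulVec_single, Pi.smul_apply, Matrix.col_apply,
      MulOpposite.smul_eq_mul_unop, MulOpposite.unop_op, star_one]
    ring
  rw [key, key, key, key]
  simp only [star_one, star_neg, Complex.star_def, Complex.conj_I]
  linear_combination (2 * R x z - 2 * R z x) * Complex.I_sq

theorem sum_norm_sq_single_add_le {x z : ι} {β : ℂ} (hβ : ‖β‖ = 1) :
    ∑ i, ‖(Pi.single x 1 + Pi.single z β : ι → ℂ) i‖ ^ 2 ≤ 4 := by
  have h1 : ∀ (w : ι) (γ : ℂ), ‖γ‖ = 1 →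
      ∑ i, ‖(Pi.single w γ : ι → ℂ) i‖ ^ 2 = 1 := by
    intro w γ hγ
    rw [Finset.sum_eq_single w]
    · simp [hγ]
    · intro b _ hb; simp [Pi.single_eq_of_ne hb]
    · simp
  calc ∑ i, ‖(Pi.single x 1 + Pi.single z β : ι → ℂ) i‖ ^ 2
      ≤ ∑ i, (2 * ‖(Pi.single x 1 : ι → ℂ) i‖ ^ 2 + 2 * ‖(Pi.single z β : ι → ℂ) i‖ ^ 2) := by
        refine Finset.sum_le_sum fun i _ => ?_
        have := norm_add_le ((Pi.single x 1 : ι → ℂ) i) ((Pi.single z β : ι → ℂ) i)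
        rw [Pi.add_apply]
        have h0 := norm_nonneg ((Pi.single x 1 : ι → ℂ) i + (Pi.single z β : ι → ℂ) i)
        nlinarith [sq_nonneg (‖(Pi.single x 1 : ι → ℂ) i‖ - ‖(Pi.single z β : ι → ℂ) i‖),
          mul_self_le_mul_self h0 this]
    _ = 4 := by
        rw [Finset.sum_add_distrib, ← Finset.mul_sum, ← Finset.mul_sum, h1 x 1 (by simp), h1 z β hβ]
        norm_num

theorem continuous_quadResolvent {H₀ : Matrix ι ι ℂ} (hH : H₀.IsHermitian) {N : ι → ℝ}
    (hN : ∀ i, 0 ≤ N i) {lam : ℝ} (hlam : 0 ≤ lam) {ζ : ℂ} (hζ : 0 < ζ.im) (v : ι → ℂ) :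
    Continuous fun t : ℝ => quadResolvent H₀ N lam ζ v t :=
  continuous_iff_continuousAt.2 fun t => ContinuousAt.comp (f := fun t : ℝ => (t : ℂ))
    (differentiableAt_quadResolvent hH hN hlam hζ (by simp) v).continuousAt
    Complex.continuous_ofReal.continuousAt

/-- The a priori bound on fractional moments of matrix elements of the resolvent, averaged over the
strength of a diagonal perturbation. -/
theorem lintegral_cauchy_norm_rpow_inv_pencil_le {H₀ : Matrix ι ι ℂ} (hH : H₀.IsHermitian)
    {N : ι → ℝ} (hN : ∀ i, 0 ≤ N i) {lam : ℝ} (hlam : 0 < lam) {ζ : ℂ} (hζ : 0 < ζ.im)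
    {x z : ι} (hx : N x = 1) (hz : N z = 1) {s : ℝ} (hs0 : 0 < s) (hs1 : s < 1) :
    ∫⁻ t : ℝ, ENNReal.ofReal ((1 + t ^ 2)⁻¹) * ‖(pencil H₀ N lam ζ t)⁻¹ x z‖ₑ ^ s
      ≤ ENNReal.ofReal (4 * (Real.pi * (4 / lam) ^ s / Real.cos (Real.pi * s / 2))) := by
  have hpi := Real.pi_pos
  have hcos : 0 < Real.cos (Real.pi * s / 2) :=
    Real.cos_pos_of_mem_Ioo ⟨by nlinarith, by nlinarith⟩
  set q : ℂ → ℝ → ℂ := fun β t =>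
    quadResolvent H₀ N lam ζ (Pi.single x 1 + Pi.single z β) t with hq
  have hmeas : ∀ β, Measurable fun t : ℝ => ENNReal.ofReal ((1 + t ^ 2)⁻¹) * ‖q β t‖ₑ ^ s := by
    intro β
    have h1 : Measurable (q β) := (continuous_quadResolvent hH hN hlam.le hζ _).measurable
    fun_prop
  have hbound : ∀ β : ℂ, ‖β‖ = 1 → ∫⁻ t : ℝ, ENNReal.ofReal ((1 + t ^ 2)⁻¹) * ‖q β t‖ₑ ^ s
      ≤ ENNReal.ofReal (Real.pi * (4 / lam) ^ s / Real.cos (Real.pi * s / 2)) := by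
    intro β hβ
    have h1 := lintegral_cauchy_norm_rpow_quadResolvent_le hH hN hlam hζ
      (v := Pi.single x 1 + Pi.single z β) (fun i hi => by
        by_cases h1 : i = x
        · rw [h1, hx]
        · by_cases h2 : i = z
          · rw [h2, hz]
          · simp [Pi.single_eq_of_ne h1, Pi.single_eq_of_ne h2] at hi) hs0 hs1
    calc _ = _ := by
          refine lintegral_congr fun t => ?_
          rw [← ofReal_norm, ENNReal.ofReal_rpow_of_nonneg (norm_nonneg _) hs0.le]
      _ ≤ _ := h1
      _ ≤ _ := by
          refine ENNReal.ofReal_le_ofReal ?_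
          gcongr
          exact sum_norm_sq_single_add_le hβ
  -- The factor 4 from polarization is simply dropped; t ↦ t^s is subadditive for 0 < s < 1.
  have hpt : ∀ t : ℝ, ‖(pencil H₀ N lam ζ t)⁻¹ x z‖ₑ ^ s
      ≤ ‖q 1 t‖ₑ ^ s + ‖q (-1) t‖ₑ ^ s + ‖q Complex.I t‖ₑ ^ s + ‖q (-Complex.I) t‖ₑ ^ s := by
    intro t
    have hle : ‖(pencil H₀ N lam ζ t)⁻¹ x z‖ₑ
        ≤ ‖q 1 t‖ₑ + ‖q (-1) t‖ₑ + ‖q Complex.I t‖ₑ + ‖q (-Complex.I) t‖ₑ := by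
      have hp := polarization (pencil H₀ N lam ζ t)⁻¹ x z
      have h4 : ‖(pencil H₀ N lam ζ t)⁻¹ x z‖ₑ ≤ ‖4 * (pencil H₀ N lam ζ t)⁻¹ x z‖ₑ := by
        rw [enorm_le_iff_norm_le, norm_mul]
        simp only [Complex.norm_ofNat]
        linarith [norm_nonneg ((pencil H₀ N lam ζ t)⁻¹ x z)]
      refine h4.trans ?_
      rw [hp]
      refine (enorm_add_le _ _).trans ?_
      refine add_le_add ((enorm_sub_le).trans (add_le_add enorm_sub_le ?_)) ?_
      · rw [enorm_mul]; simp [hq, quadResolvent, enorm_eq_nnnorm]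
      · rw [enorm_mul]; simp [hq, quadResolvent, enorm_eq_nnnorm]
    refine (ENNReal.rpow_le_rpow hle hs0.le).trans ?_
    refine (ENNReal.rpow_add_le_add_rpow _ _ hs0.le hs1.le).trans (add_le_add_left ?_ _)
    refine (ENNReal.rpow_add_le_add_rpow _ _ hs0.le hs1.le).trans (add_le_add_left ?_ _)
    exact ENNReal.rpow_add_le_add_rpow _ _ hs0.le hs1.le
  calc _ ≤ ∫⁻ t : ℝ, (ENNReal.ofReal ((1 + t ^ 2)⁻¹) * ‖q 1 t‖ₑ ^ s
          + ENNReal.ofReal ((1 + t ^ 2)⁻¹) * ‖q (-1) t‖ₑ ^ s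
          + ENNReal.ofReal ((1 + t ^ 2)⁻¹) * ‖q Complex.I t‖ₑ ^ s
          + ENNReal.ofReal ((1 + t ^ 2)⁻¹) * ‖q (-Complex.I) t‖ₑ ^ s) := by
        refine lintegral_mono fun t => ?_
        rw [← mul_add, ← mul_add, ← mul_add]
        exact mul_le_mul_right (hpt t) _
    _ ≤ _ := by
        rw [lintegral_add_right _ (hmeas _), lintegral_add_right _ (hmeas _),
          lintegral_add_right _ (hmeas _)]
        refine (add_le_add (add_le_add (add_le_add (hbound 1 (by simp)) (hbound (-1) (by simp)))
          (hbound Complex.I (by simp))) (hbound (-Complex.I) (by simp))).trans ?_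
        have h0 : 0 ≤ Real.pi * (4 / lam) ^ s / Real.cos (Real.pi * s / 2) := by positivity
        rw [← ENNReal.ofReal_add h0 h0, ← ENNReal.ofReal_add (by positivity) h0,
          ← ENNReal.ofReal_add (by positivity) h0]
        refine ENNReal.ofReal_le_ofReal (le_of_eq ?_)
        ring

end Resolvent

/-- Integrals with respect to a bounded density of compact support are controlled by the Cauchy
density. -/
theorem exists_lintegral_density_le {ρ : ℝ → ℝ} {ωmax : ℝ} (hρ : IsBoundedDensity ρ ωmax) :
    ∃ K : ℝ, 0 < K ∧ ∀ g : ℝ → ℝ≥0∞,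
      ∫⁻ t, g t ∂(volume.withDensity fun t => ENNReal.ofReal (ρ t))
        ≤ ENNReal.ofReal K * ∫⁻ t : ℝ, ENNReal.ofReal ((1 + t ^ 2)⁻¹) * g t := by
  set B := (eLpNormEssSup ρ volume).toReal with hB
  have hBfin : eLpNormEssSup ρ volume < ∞ := by
    have := hρ.memLp_top.2
    rwa [eLpNorm_exponent_top] at this
  have hB0 : 0 ≤ B := ENNReal.toReal_nonneg
  -- On the support 1 + t² ≤ 1 + ωmax², which compares ρ with the Cauchy density; B + 1 replaces the
  -- essential bound B so that positivity is immediate.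
  have hK : 0 < (B + 1) * (1 + ωmax ^ 2) := by positivity
  refine ⟨(B + 1) * (1 + ωmax ^ 2), hK, fun g => ?_⟩
  have hle : (fun t => ENNReal.ofReal (ρ t)) ≤ᵐ[volume]
      fun t => ENNReal.ofReal ((B + 1) * (1 + ωmax ^ 2)) * ENNReal.ofReal ((1 + t ^ 2)⁻¹) := by
    filter_upwards [hρ.support, ae_le_eLpNormEssSup (f := ρ) (μ := volume)] with t h1 h2
    by_cases ht : t ∈ Set.Icc 0 ωmax
    · rw [← ENNReal.ofReal_mul hK.le]
      refine ENNReal.ofReal_le_ofReal ?_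
      have h3 : ρ t ≤ B := by
        have : ‖ρ t‖ ≤ B := by
          rw [hB, ← ENNReal.ofReal_le_iff_le_toReal hBfin.ne, ofReal_norm]
          exact h2
        exact (le_abs_self _).trans this
      rw [← div_eq_mul_inv, le_div_iff₀ (by positivity)]
      have h4 : t ^ 2 ≤ ωmax ^ 2 := pow_le_pow_left₀ ht.1 ht.2 2
      have h5 : 0 ≤ t ^ 2 := sq_nonneg t
      calc ρ t * (1 + t ^ 2) ≤ (B + 1) * (1 + t ^ 2) := by gcongr; linarith
        _ ≤ _ := by gcongr
    · simp [h1 ht]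
  refine (lintegral_mono' (withDensity_mono hle) le_rfl).trans ?_
  refine (lintegral_withDensity_le_lintegral_mul _ (by fun_prop) g).trans ?_
  rw [← lintegral_const_mul' _ _ ENNReal.ofReal_ne_top]
  refine le_of_eq (lintegral_congr fun t => ?_)
  simp only [Pi.mul_apply, mul_assoc]

end

end HardCore

namespace HardCore

noncomputable section

open scoped Matrix

/-! ### Spectral decomposition of Hermitian matrices -/

section Spectral

variable {ι : Type} [Fintype ι] [DecidableEq ι]

/-- The real spectrum as a finite set. -/
def realSpectrum (H : Matrix ι ι ℂ) : Finset ℝ := (Matrix.finite_real_spectrum (A := H)).toFinset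

/-- The matrix elements of the spectral projections. -/
def spectralEntry (H : Matrix ι ι ℂ) (E : ℝ) (x y : ι) : ℂ :=
  inner ℂ (EuclideanSpace.single x (1 : ℂ))
      (eigenprojection H E (EuclideanSpace.single y (1 : ℂ)))

/-- The diagonal matrix elements of the spectral projections. -/
def spectralWeight (H : Matrix ι ι ℂ) (E : ℝ) (x : ι) : ℝ :=
  ‖eigenprojection H E (EuclideanSpace.single x (1 : ℂ))‖ ^ 2

theorem spectralWeight_nonneg (H : Matrix ι ι ℂ) (E : ℝ) (x : ι) : 0 ≤ spectralWeight H E x :=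
  sq_nonneg _

theorem spectralEntry_eq_apply (H : Matrix ι ι ℂ) (E : ℝ) (x y : ι) :
    spectralEntry H E x y = (eigenprojection H E (EuclideanSpace.single y (1 : ℂ))).ofLp x := by
  rw [spectralEntry, EuclideanSpace.inner_single_left]
  simp

/-- The columns of a spectral projection are eigenfunctions (or zero), so deterministic estimates
for solutions apply to them. -/
theorem mulVec_spectralEntry (H : Matrix ι ι ℂ) (E : ℝ) (y : ι) :
    H *ᵥ (fun x => spectralEntry H E x y) = (E : ℂ) • fun x => spectralEntry H E x y := by
  have hmem : eigenprojection H E (EuclideanSpace.single y (1 : ℂ)) ∈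
      Module.End.eigenspace (Matrix.toEuclideanLin H) (E : ℂ) :=
    Submodule.starProjection_apply_mem _ _
  rw [Module.End.mem_eigenspace_iff] at hmem
  have h := congrArg WithLp.ofLp hmem
  simp only [spectralEntry_eq_apply]
  simpa using h

theorem spectralEntry_eq_inner (H : Matrix ι ι ℂ) (E : ℝ) (x y : ι) :
    spectralEntry H E x y = inner ℂ (eigenprojection H E (EuclideanSpace.single x (1 : ℂ)))
      (eigenprojection H E (EuclideanSpace.single y (1 : ℂ))) := by
  have hmem : eigenprojection H E (EuclideanSpace.single y (1 : ℂ)) ∈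
      Module.End.eigenspace (Matrix.toEuclideanLin H) (E : ℂ) :=
    Submodule.starProjection_apply_mem _ _
  rw [spectralEntry]
  conv_rhs => rw [eigenprojection, Submodule.inner_starProjection_left_eq_right]
  rw [Submodule.starProjection_eq_self_iff.2]
  · rfl
  · exact hmem

theorem spectralEntry_symm (H : Matrix ι ι ℂ) (E : ℝ) (x y : ι) :
    ‖spectralEntry H E x y‖ = ‖spectralEntry H E y x‖ := by
  rw [spectralEntry_eq_inner, spectralEntry_eq_inner, norm_inner_symm]

theorem spectralEntry_self (H : Matrix ι ι ℂ) (E : ℝ) (x : ι) :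
    spectralEntry H E x x = (spectralWeight H E x : ℂ) := by
  rw [spectralEntry_eq_inner, inner_self_eq_norm_sq_to_K, spectralWeight]
  push_cast
  rfl

theorem norm_spectralEntry_sq_le (H : Matrix ι ι ℂ) (E : ℝ) (x y : ι) :
    ‖spectralEntry H E x y‖ ^ 2 ≤ spectralWeight H E x * spectralWeight H E y := by
  rw [spectralEntry_eq_inner, spectralWeight, spectralWeight, ← mul_pow]
  exact pow_le_pow_left₀ (norm_nonneg _) (norm_inner_le_norm _ _) 2

theorem mem_realSpectrum_of_hasEigenvalue {H : Matrix ι ι ℂ} {E : ℝ}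
    (h : Module.End.HasEigenvalue (Matrix.toEuclideanLin H) (E : ℂ)) : E ∈ realSpectrum H := by
  rw [realSpectrum, Set.Finite.mem_toFinset, ← spectrum.algebraMap_mem_iff ℂ]
  rw [Module.End.hasEigenvalue_iff_mem_spectrum] at h
  rwa [← Matrix.spectrum_toLpLin 2]

theorem sum_eigenprojection {H : Matrix ι ι ℂ} (hH : H.IsHermitian) (v : EuclideanSpace ℂ ι) :
    ∑ E ∈ realSpectrum H, eigenprojection H E v = v := by
  have hT : (Matrix.toEuclideanLin H).IsSymmetric := Matrix.isSymmetric_toEuclideanLin_iff.2 hH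
  have hof := (hT.orthogonalFamily_eigenspaces).comp (γ := realSpectrum H)
    (f := fun E => ((E : ℝ) : ℂ)) (fun a b h => Subtype.ext (by simpa using h))
  -- Completeness is known for eigenspaces over all complex μ; symmetry makes every eigenvalue real,
  -- so the real spectrum already indexes all nonzero ones.
  have htop : ⨆ E : realSpectrum H,
      Module.End.eigenspace (Matrix.toEuclideanLin H) (((E : ℝ) : ℂ)) = ⊤ := by
    rw [eq_top_iff, ← Submodule.orthogonal_eq_bot_iff.1
      hT.orthogonalComplement_iSup_eigenspaces_eq_bot]
    refine iSup_le fun μ => ?_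
    by_cases hμ : Module.End.eigenspace (Matrix.toEuclideanLin H) μ = ⊥
    · rw [hμ]; exact bot_le
    · have hev : Module.End.HasEigenvalue (Matrix.toEuclideanLin H) μ := hμ
      have hreal : ((μ.re : ℝ) : ℂ) = μ :=
        Complex.conj_eq_iff_re.1 (hT.conj_eigenvalue_eq_self hev)
      have hmem : μ.re ∈ realSpectrum H :=
        mem_realSpectrum_of_hasEigenvalue (by rw [hreal]; exact hev)
      refine le_trans (le_of_eq ?_) (le_iSup _ (⟨μ.re, hmem⟩ : realSpectrum H))
      rw [hreal]
  have h := hof.sum_projection_of_mem_iSup v (by rw [htop]; exact Submodule.mem_top)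
  conv_rhs => rw [← h]
  rw [← Finset.sum_coe_sort]
  rfl

theorem sum_spectralEntry {H : Matrix ι ι ℂ} (hH : H.IsHermitian) (x y : ι) :
    ∑ E ∈ realSpectrum H, spectralEntry H E x y = (1 : Matrix ι ι ℂ) x y := by
  simp only [spectralEntry]
  rw [← inner_sum, sum_eigenprojection hH, EuclideanSpace.inner_single_left]
  simp [Matrix.one_apply]

theorem sum_spectralWeight {H : Matrix ι ι ℂ} (hH : H.IsHermitian) (x : ι) :
    ∑ E ∈ realSpectrum H, spectralWeight H E x = 1 := by
  have h := sum_spectralEntry hH x x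
  simp only [spectralEntry_self, Matrix.one_apply_eq] at h
  exact_mod_cast h

/-- Matrix elements of the inverse of a function of `H`. -/
theorem inv_apply_eq_sum {H : Matrix ι ι ℂ} (hH : H.IsHermitian) {M : Matrix ι ι ℂ} {p : ℝ → ℂ}
    (hM : ∀ (E : ℝ) (v : ι → ℂ), H *ᵥ v = (E : ℂ) • v → M *ᵥ v = p E • v)
    (hp : ∀ E, p E ≠ 0) (x y : ι) :
    M.det ≠ 0 ∧ M⁻¹ x y = ∑ E ∈ realSpectrum H, (p E)⁻¹ * spectralEntry H E x y := by
  set R : Matrix ι ι ℂ :=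
    Matrix.of fun x y => ∑ E ∈ realSpectrum H, (p E)⁻¹ * spectralEntry H E x y with hR
  have hMR : M * R = 1 := by
    ext a b
    rw [← sum_spectralEntry hH a b]
    have h1 : ∀ E, ∑ c, M a c * spectralEntry H E c b = p E * spectralEntry H E a b := by
      intro E
      have := congrFun (hM E _ (mulVec_spectralEntry H E b)) a
      simpa [Matrix.mulVec, dotProduct] using this
    simp only [Matrix.mul_apply, hR, Matrix.of_apply, Finset.mul_sum]
    rw [Finset.sum_comm]
    refine Finset.sum_congr rfl fun E _ => ?_
    calc ∑ c, M a c * ((p E)⁻¹ * spectralEntry H E c b)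
        = (p E)⁻¹ * ∑ c, M a c * spectralEntry H E c b := by
          rw [Finset.mul_sum]; exact Finset.sum_congr rfl fun c _ => by ring
      _ = spectralEntry H E a b := by rw [h1, inv_mul_cancel_left₀ (hp E)]
  refine ⟨fun h => ?_, ?_⟩
  · have := congrArg Matrix.det hMR
    rw [Matrix.det_mul, h, zero_mul, Matrix.det_one] at this
    exact zero_ne_one this
  · rw [Matrix.inv_eq_right_inv hMR]; rfl

/-- The spectral sum `∑_{E ∈ σ(H) ∩ J} ⟨δ_x, P_{E} δ_y⟩`. -/
def spectralSum (H : Matrix ι ι ℂ) (J : Set ℝ) (x y : ι) : ℂ :=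
  ∑ E ∈ realSpectrum H, J.indicator (fun E => spectralEntry H E x y) E

/-! ### Measurability -/

section Measurability

variable {Ω : Type*} [MeasurableSpace Ω]

/-- Matrix-valued functions with measurable entries. -/
def MeasurableEntries (M : Ω → Matrix ι ι ℂ) : Prop := ∀ i j, Measurable fun ω => M ω i j

theorem MeasurableEntries.det {M : Ω → Matrix ι ι ℂ} (hM : MeasurableEntries M) :
    Measurable fun ω => (M ω).det := by
  simp only [Matrix.det_apply]
  refine Finset.measurable_fun_sum _ fun σ _ => ?_
  refine Measurable.const_smul ?_ _
  exact Finset.measurable_fun_prod _ fun i _ => hM _ _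

theorem MeasurableEntries.inv {M : Ω → Matrix ι ι ℂ} (hM : MeasurableEntries M) :
    MeasurableEntries fun ω => (M ω)⁻¹ := by
  intro i j
  simp only [Matrix.inv_def, Ring.inverse_eq_inv', Matrix.smul_apply, smul_eq_mul]
  refine hM.det.inv.mul ?_
  simp only [Matrix.adjugate_apply]
  refine MeasurableEntries.det fun k l => ?_
  by_cases hk : k = j
  · subst hk; simp [Matrix.updateRow_self]
  · simp only [Matrix.updateRow_ne hk]; exact hM k l

theorem MeasurableEntries.mul {M N : Ω → Matrix ι ι ℂ} (hM : MeasurableEntries M)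
    (hN : MeasurableEntries N) : MeasurableEntries fun ω => M ω * N ω := by
  intro i j
  simp only [Matrix.mul_apply]
  exact Finset.measurable_fun_sum _ fun k _ => (hM i k).mul (hN k j)

theorem MeasurableEntries.pow {M : Ω → Matrix ι ι ℂ} (hM : MeasurableEntries M) (k : ℕ) :
    MeasurableEntries fun ω => M ω ^ k := by
  induction k with
  | zero => intro i j; simp only [pow_zero]; exact measurable_const
  | succ k ih => simp only [pow_succ]; exact ih.mul hM

/-- A rational function of `H` that approximates the spectral projection onto `[c - r, c + r]`. -/
def bumpMatrix (H : Matrix ι ι ℂ) (c r : ℝ) (m : ℕ) : Matrix ι ι ℂ :=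
  1 + ((m : ℂ) + 1)⁻¹ • (((r : ℂ)⁻¹ • (H - (c : ℂ) • (1 : Matrix ι ι ℂ))) ^ (2 * (m + 1)))

theorem pow_mulVec_of_eigen {M : Matrix ι ι ℂ} {v : ι → ℂ} {a : ℂ} (h : M *ᵥ v = a • v) (k : ℕ) :
    (M ^ k) *ᵥ v = a ^ k • v := by
  induction k with
  | zero => simp
  | succ k ih => rw [pow_succ, ← Matrix.mulVec_mulVec, h, Matrix.mulVec_smul, ih, smul_smul, pow_succ']

/-- With q = ((E - c)/r)², the term q^(m+1)/(m+1) tends to 0 for q ≤ 1 and to infinity for q > 1.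
The factor 1/(m+1) puts the endpoints q = 1 into the limit set. -/
theorem tendsto_bump (c : ℝ) {r : ℝ} (hr : 0 < r) (E : ℝ) :
    Filter.Tendsto (fun m : ℕ => (1 + ((m : ℝ) + 1)⁻¹ * (r⁻¹ * (E - c)) ^ (2 * (m + 1)))⁻¹)
      Filter.atTop (nhds ((Set.Icc (c - r) (c + r)).indicator (fun _ => (1 : ℝ)) E)) := by
  set q := (r⁻¹ * (E - c)) ^ 2 with hq
  have hq0 : 0 ≤ q := sq_nonneg _
  have hmem : E ∈ Set.Icc (c - r) (c + r) ↔ q ≤ 1 := by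
    rw [hq, sq_le_one_iff_abs_le_one, abs_mul, abs_of_pos (inv_pos.2 hr), inv_mul_le_iff₀ hr,
      mul_one, abs_le, Set.mem_Icc]
    constructor <;> rintro ⟨h1, h2⟩ <;> constructor <;> linarith
  have hinv : Filter.Tendsto (fun m : ℕ => ((m : ℝ) + 1)⁻¹) Filter.atTop (nhds 0) := by
    simpa using tendsto_one_div_add_atTop_nhds_zero_nat (𝕜 := ℝ)
  simp only [pow_mul, ← hq]
  by_cases h : q ≤ 1
  · rw [Set.indicator_of_mem (hmem.2 h)]
    have h0 : Filter.Tendsto (fun m : ℕ => ((m : ℝ) + 1)⁻¹ * q ^ (m + 1)) Filter.atTop (nhds 0) := by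
      refine squeeze_zero (fun m => by positivity) (fun m => ?_) hinv
      exact mul_le_of_le_one_right (by positivity) (pow_le_one₀ hq0 h)
    simpa using (h0.const_add 1).inv₀ (by norm_num)
  · rw [Set.indicator_of_notMem (fun h' => h (hmem.1 h'))]
    push Not at h
    refine Filter.Tendsto.inv_tendsto_atTop ?_
    refine Filter.tendsto_atTop_add_const_left _ _ ?_
    have h1 : Filter.Tendsto (fun m : ℕ => q ^ m / (m : ℝ) ^ 1) Filter.atTop Filter.atTop := by
      have h2 := tendsto_pow_const_div_const_pow_of_one_lt 1 h
      have h3 : Filter.Tendsto (fun m : ℕ => (m : ℝ) ^ 1 / q ^ m) Filter.atTop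
          (nhdsWithin 0 (Set.Ioi 0)) := by
        rw [tendsto_nhdsWithin_iff]
        refine ⟨h2, ?_⟩
        filter_upwards [Filter.eventually_gt_atTop 0] with m hm
        have : (0 : ℝ) < m := by exact_mod_cast hm
        have : 0 < q := by linarith
        simp only [Set.mem_Ioi]
        positivity
      refine h3.inv_tendsto_nhdsGT_zero.congr fun m => ?_
      simp
    refine (h1.comp (Filter.tendsto_add_atTop_nat 1)).congr fun m => ?_
    simp only [Function.comp]
    push_cast
    rw [pow_one]
    ring

theorem tendsto_bumpMatrix_inv {H : Matrix ι ι ℂ} (hH : H.IsHermitian) (c : ℝ) {r : ℝ} (hr : 0 < r)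
    (x y : ι) :
    Filter.Tendsto (fun m => (bumpMatrix H c r m)⁻¹ x y) Filter.atTop
      (nhds (spectralSum H (Set.Icc (c - r) (c + r)) x y)) := by
  set p : ℕ → ℝ → ℝ := fun m E => 1 + ((m : ℝ) + 1)⁻¹ * (r⁻¹ * (E - c)) ^ (2 * (m + 1)) with hp
  have hp0 : ∀ m E, 0 < p m E := fun m E => by
    have : 0 ≤ (r⁻¹ * (E - c)) ^ (2 * (m + 1)) := by rw [pow_mul]; positivity
    simp only [hp]; positivity
  have heq : ∀ m, (bumpMatrix H c r m)⁻¹ x y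
      = ∑ E ∈ realSpectrum H, (((p m E)⁻¹ : ℝ) : ℂ) * spectralEntry H E x y := by
    intro m
    have := (inv_apply_eq_sum hH (M := bumpMatrix H c r m) (p := fun E => (p m E : ℂ)) ?_ ?_ x y).2
    · simpa using this
    · intro E v hv
      have h1 : ((r : ℂ)⁻¹ • (H - (c : ℂ) • (1 : Matrix ι ι ℂ))) *ᵥ v
          = ((r : ℂ)⁻¹ * (E - c)) • v := by
        rw [Matrix.smul_mulVec, Matrix.sub_mulVec, hv, Matrix.smul_mulVec, Matrix.one_mulVec,
          ← sub_smul, smul_smul]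
      rw [bumpMatrix, Matrix.add_mulVec, Matrix.one_mulVec, Matrix.smul_mulVec,
        pow_mulVec_of_eigen h1, smul_smul]
      simp only [hp]
      push_cast
      rw [add_smul, one_smul]
    · intro E
      exact_mod_cast (hp0 m E).ne'
  simp only [heq, spectralSum]
  refine tendsto_finsetSum _ fun E _ => ?_
  have h1 := ((Complex.continuous_ofReal.tendsto _).comp (tendsto_bump c hr E)).mul_const
    (spectralEntry H E x y)
  have h2 : (Set.Icc (c - r) (c + r)).indicator (fun E => spectralEntry H E x y) E
      = (((Set.Icc (c - r) (c + r)).indicator (fun _ => (1 : ℝ)) E : ℝ) : ℂ) *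
        spectralEntry H E x y := by
    by_cases hE : E ∈ Set.Icc (c - r) (c + r)
    · rw [Set.indicator_of_mem hE, Set.indicator_of_mem hE]; simp
    · rw [Set.indicator_of_notMem hE, Set.indicator_of_notMem hE]; simp
  rw [h2]
  exact h1

theorem measurable_spectralSum_Icc {H : Ω → Matrix ι ι ℂ} (hm : MeasurableEntries H)
    (hH : ∀ ω, (H ω).IsHermitian) (c : ℝ) {r : ℝ} (hr : 0 < r) (x y : ι) :
    Measurable fun ω => spectralSum (H ω) (Set.Icc (c - r) (c + r)) x y := by
  refine measurable_of_tendsto_metrizable (f := fun m ω => (bumpMatrix (H ω) c r m)⁻¹ x y)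
    (fun m => ?_) (tendsto_pi_nhds.2 fun ω => tendsto_bumpMatrix_inv (hH ω) c hr x y)
  refine MeasurableEntries.inv (M := fun ω => bumpMatrix (H ω) c r m) (fun i j => ?_) x y
  have h1 : MeasurableEntries fun ω =>
      ((r : ℂ)⁻¹ • (H ω - (c : ℂ) • (1 : Matrix ι ι ℂ))) := by
    intro k l
    simp only [Matrix.smul_apply, Matrix.sub_apply]
    have := hm k l
    fun_prop
  have h2 := h1.pow (2 * (m + 1)) i j
  have h3 : (fun ω => bumpMatrix (H ω) c r m i j) = fun ω => (1 : Matrix ι ι ℂ) i j +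
      ((m : ℂ) + 1)⁻¹ * (((r : ℂ)⁻¹ • (H ω - (c : ℂ) • (1 : Matrix ι ι ℂ))) ^ (2 * (m + 1))) i j :=
    rfl
  rw [h3]
  exact (h2.const_mul _).const_add _

/-- Closed intervals are limits of rational functions of H, whose entries are measurable by Cramer's
rule; a π-λ argument extends this to Borel sets. -/
theorem measurable_spectralSum {H : Ω → Matrix ι ι ℂ} (hm : MeasurableEntries H)
    (hH : ∀ ω, (H ω).IsHermitian) {J : Set ℝ} (hJ : MeasurableSet J) (x y : ι) :
    Measurable fun ω => spectralSum (H ω) J x y := by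
  refine MeasurableSpace.induction_on_inter
    (C := fun J _ => Measurable fun ω => spectralSum (H ω) J x y)
    ((BorelSpace.measurable_eq (α := ℝ)).trans (borel_eq_generateFrom_Icc ℝ))
    (isPiSystem_Icc id id) ?_ ?_ ?_ ?_ J hJ
  · simp [spectralSum]
  · rintro _ ⟨l, u, hlu, rfl⟩
    -- The interval may be a single point, whereas the bump functions need a positive radius; hence
    -- the approximation from outside.
    set ε : ℕ → ℝ := fun k => 1 / ((k : ℝ) + 1) with hε
    have hε0 : ∀ k, 0 < ε k := fun k => by simp only [hε]; positivity
    have hεt : Filter.Tendsto ε Filter.atTop (nhds 0) := tendsto_one_div_add_atTop_nhds_zero_nat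
    refine measurable_of_tendsto_metrizable
      (f := fun k ω => spectralSum (H ω)
        (Set.Icc ((l + u) / 2 - ((u - l) / 2 + ε k)) ((l + u) / 2 + ((u - l) / 2 + ε k))) x y)
      (fun k => measurable_spectralSum_Icc hm hH _ (by have := hε0 k; linarith) x y)
      (tendsto_pi_nhds.2 fun ω => ?_)
    refine tendsto_finsetSum _ fun E _ => tendsto_nhds_of_eventually_eq ?_
    by_cases hE : E ∈ Set.Icc l u
    · refine Filter.Eventually.of_forall fun k => ?_
      have := hε0 k
      rw [Set.indicator_of_mem hE, Set.indicator_of_mem]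
      exact ⟨by linarith [hE.1], by linarith [hE.2]⟩
    · have : 0 < max (l - E) (E - u) := by
        by_contra hcon
        push Not at hcon
        exact hE ⟨by linarith [le_max_left (l - E) (E - u)],
          by linarith [le_max_right (l - E) (E - u)]⟩
      filter_upwards [hεt.eventually_lt_const this] with k hk
      rw [Set.indicator_of_notMem hE, Set.indicator_of_notMem]
      rintro ⟨h1, h2⟩
      rcases lt_max_iff.1 hk with h | h <;> linarith
  · intro t ht ih
    have : (fun ω => spectralSum (H ω) tᶜ x y)
        = fun ω => (1 : Matrix ι ι ℂ) x y - spectralSum (H ω) t x y := by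
      funext ω
      rw [← sum_spectralEntry (hH ω) x y, spectralSum, spectralSum, ← Finset.sum_sub_distrib]
      refine Finset.sum_congr rfl fun E _ => ?_
      rw [Set.indicator_compl]
      rfl
    rw [this]
    exact ih.const_sub _
  · intro f hd hf ih
    refine measurable_of_tendsto_metrizable
      (f := fun k ω => ∑ i ∈ Finset.range k, spectralSum (H ω) (f i) x y)
      (fun k => Finset.measurable_fun_sum _ fun i _ => ih i) (tendsto_pi_nhds.2 fun ω => ?_)
    simp only [spectralSum]
    simp_rw [Finset.sum_comm (s := Finset.range _)]
    refine tendsto_finsetSum _ fun E _ => ?_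
    by_cases hE : E ∈ ⋃ i, f i
    · obtain ⟨j, hj⟩ := Set.mem_iUnion.1 hE
      refine tendsto_nhds_of_eventually_eq ?_
      filter_upwards [Filter.eventually_gt_atTop j] with k hk
      rw [Set.indicator_of_mem hE, Finset.sum_eq_single j, Set.indicator_of_mem hj]
      · intro i _ hij
        exact Set.indicator_of_notMem (fun hi => (Set.disjoint_left.1 (hd hij) hi hj)) _
      · intro h; exact absurd (Finset.mem_range.2 hk) h
    · refine tendsto_nhds_of_eventually_eq (Filter.Eventually.of_forall fun k => ?_)
      rw [Set.indicator_of_notMem hE]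
      refine Finset.sum_eq_zero fun i _ => Set.indicator_of_notMem (fun hi => hE ?_) _
      exact Set.mem_iUnion.2 ⟨i, hi⟩

/-- A grid of mesh 1/N with window [-N², N²] eventually contains the whole finite set and puts
distinct points into distinct cells. -/
theorem eventually_floor_separates (S : Finset ℝ) :
    ∀ᶠ N : ℕ in Filter.atTop, (∀ E ∈ S, ⌊(N : ℝ) * E⌋ ∈ Finset.Icc (-(N : ℤ) ^ 2) ((N : ℤ) ^ 2)) ∧
      ∀ E ∈ S, ∀ E' ∈ S, ⌊(N : ℝ) * E⌋ = ⌊(N : ℝ) * E'⌋ → E = E' := by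
  refine Filter.Eventually.and ?_ ?_
  · refine (Finset.eventually_all S).2 fun E _ => ?_
    filter_upwards [Filter.tendsto_atTop.1 tendsto_natCast_atTop_atTop (|E| + 1)] with N hN
    have h0 := abs_nonneg E
    have hNE : |(N : ℝ) * E| ≤ (N : ℝ) ^ 2 - 1 := by
      rw [abs_mul, Nat.abs_cast]
      nlinarith
    have := Int.floor_le ((N : ℝ) * E)
    have := Int.lt_floor_add_one ((N : ℝ) * E)
    have := abs_le.1 hNE
    rw [Finset.mem_Icc]
    constructor
    · have : (-(N : ℝ) ^ 2) < ⌊(N : ℝ) * E⌋ := by linarith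
      exact_mod_cast this.le
    · have : (⌊(N : ℝ) * E⌋ : ℝ) ≤ (N : ℝ) ^ 2 := by linarith
      exact_mod_cast this
  · refine (Finset.eventually_all S).2 fun E _ => (Finset.eventually_all S).2 fun E' _ => ?_
    by_cases h : E = E'
    · exact Filter.Eventually.of_forall fun N _ => h
    · have hpos : 0 < |E - E'| := abs_pos.2 (sub_ne_zero.2 h)
      filter_upwards [Filter.tendsto_atTop.1 tendsto_natCast_atTop_atTop (1 / |E - E'|)] with N hN hf
      have h1 := Int.abs_sub_lt_one_of_floor_eq_floor hf
      rw [← mul_sub, abs_mul, Nat.abs_cast] at h1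
      rw [div_le_iff₀ hpos] at hN
      linarith

theorem correlator_eq (H : Matrix ι ι ℂ) (I : Set ℝ) (x y : ι) :
    correlator H I x y
      = ∑ E ∈ realSpectrum H, I.indicator (fun E => ‖spectralEntry H E x y‖) E := by
  classical
  rw [correlator, Finset.sum_filter]
  refine Finset.sum_congr rfl fun E _ => ?_
  by_cases h : E ∈ I
  · rw [if_pos h, Set.indicator_of_mem h]; rfl
  · rw [if_neg h, Set.indicator_of_notMem h]

/-- The correlator takes absolute values eigenvalue by eigenvalue, so it is no single spectral sum.
Once each grid cell holds at most one eigenvalue, it is a sum of moduli of spectral sums over cells,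
which are measurable. -/
theorem correlator_eq_grid (H : Matrix ι ι ℂ) (I : Set ℝ) (x y : ι) (N : ℕ)
    (h1 : ∀ E ∈ realSpectrum H, ⌊(N : ℝ) * E⌋ ∈ Finset.Icc (-(N : ℤ) ^ 2) ((N : ℤ) ^ 2))
    (h2 : ∀ E ∈ realSpectrum H, ∀ E' ∈ realSpectrum H, ⌊(N : ℝ) * E⌋ = ⌊(N : ℝ) * E'⌋ → E = E') :
    ∑ k ∈ Finset.Icc (-(N : ℤ) ^ 2) ((N : ℤ) ^ 2),
      ‖spectralSum H (I ∩ {E | ⌊(N : ℝ) * E⌋ = k}) x y‖ = correlator H I x y := by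
  have hk : ∀ k : ℤ, ‖spectralSum H (I ∩ {E | ⌊(N : ℝ) * E⌋ = k}) x y‖
      = ∑ E ∈ realSpectrum H, (I ∩ {E | ⌊(N : ℝ) * E⌋ = k}).indicator
          (fun E => ‖spectralEntry H E x y‖) E := by
    intro k
    rw [spectralSum]
    by_cases hex : ∃ E₀ ∈ realSpectrum H, ⌊(N : ℝ) * E₀⌋ = k
    · obtain ⟨E₀, hE₀, rfl⟩ := hex
      rw [Finset.sum_eq_single_of_mem E₀ hE₀, Finset.sum_eq_single_of_mem E₀ hE₀,
        norm_indicator_eq_indicator_norm]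
      · intro E hE hne
        exact Set.indicator_of_notMem (fun h => hne (h2 E hE E₀ hE₀ h.2)) _
      · intro E hE hne
        exact Set.indicator_of_notMem (fun h => hne (h2 E hE E₀ hE₀ h.2)) _
    · push Not at hex
      rw [Finset.sum_eq_zero, Finset.sum_eq_zero, norm_zero]
      · exact fun E hE => Set.indicator_of_notMem (fun h => hex E hE h.2) _
      · exact fun E hE => Set.indicator_of_notMem (fun h => hex E hE h.2) _
  simp only [hk, correlator_eq]
  rw [Finset.sum_comm]
  refine Finset.sum_congr rfl fun E hE => ?_
  rw [Finset.sum_eq_single_of_mem _ (h1 E hE)]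
  · by_cases h : E ∈ I
    · rw [Set.indicator_of_mem h, Set.indicator_of_mem]
      exact ⟨h, rfl⟩
    · rw [Set.indicator_of_notMem h, Set.indicator_of_notMem]
      exact fun h' => h h'.1
  · intro k _ hne
    exact Set.indicator_of_notMem (fun h => hne h.2.symm) _

theorem measurable_correlator {H : Ω → Matrix ι ι ℂ} (hm : MeasurableEntries H)
    (hH : ∀ ω, (H ω).IsHermitian) {I : Set ℝ} (hI : MeasurableSet I) (x y : ι) :
    Measurable fun ω => correlator (H ω) I x y := by
  refine measurable_of_tendsto_metrizable
    (f := fun (N : ℕ) ω => ∑ k ∈ Finset.Icc (-(N : ℤ) ^ 2) ((N : ℤ) ^ 2),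
      ‖spectralSum (H ω) (I ∩ {E | ⌊(N : ℝ) * E⌋ = k}) x y‖) (fun N => ?_)
    (tendsto_pi_nhds.2 fun ω => tendsto_nhds_of_eventually_eq ?_)
  · refine Finset.measurable_fun_sum _ fun k _ => (measurable_spectralSum hm hH ?_ x y).norm
    refine hI.inter ?_
    exact measurableSet_eq_fun (Int.measurable_floor.comp (measurable_const_mul _))
      measurable_const
  · filter_upwards [eventually_floor_separates (realSpectrum (H ω))] with N hN
    exact correlator_eq_grid (H ω) I x y N hN.1 hN.2

end Measurability

theorem correlator_nonneg (H : Matrix ι ι ℂ) (I : Set ℝ) (x y : ι) : 0 ≤ correlator H I x y := by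
  rw [correlator_eq]
  exact Finset.sum_nonneg fun E _ => Set.indicator_nonneg (fun _ _ => norm_nonneg _) _

theorem correlator_symm (H : Matrix ι ι ℂ) (I : Set ℝ) (x y : ι) :
    correlator H I x y = correlator H I y x := by
  rw [correlator_eq, correlator_eq]
  simp only [spectralEntry_symm H _ x y]

/-- Cauchy–Schwarz and the arithmetic-geometric mean inequality bound each term by the mean of the
two spectral weights, and the weights sum to 1. -/
theorem correlator_le_one {H : Matrix ι ι ℂ} (hH : H.IsHermitian) (I : Set ℝ) (x y : ι) :
    correlator H I x y ≤ 1 := by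
  rw [correlator_eq]
  calc _ ≤ ∑ E ∈ realSpectrum H, (spectralWeight H E x + spectralWeight H E y) / 2 := by
        refine Finset.sum_le_sum fun E _ => ?_
        refine (Set.indicator_le_self' (fun _ _ => norm_nonneg _) E).trans ?_
        have h1 := norm_spectralEntry_sq_le H E x y
        have h2 := spectralWeight_nonneg H E x
        have h3 := spectralWeight_nonneg H E y
        refine le_of_sq_le_sq ?_ (by positivity)
        nlinarith [sq_nonneg (spectralWeight H E x - spectralWeight H E y)]
    _ = 1 := by
        rw [← Finset.sum_div, Finset.sum_add_distrib, sum_spectralWeight hH, sum_spectralWeight hH]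
        norm_num

end Spectral

end

end HardCore

namespace HardCore

noncomputable section

open scoped Matrix

/-! ### Spectral averaging -/

/-- A measure on the line that is dominated on closed intervals by Lebesgue measure is dominated
by Lebesgue measure. -/
theorem measure_le_of_Icc_le {m : Measure ℝ} {c : ℝ≥0∞} (hc0 : c ≠ 0) (hc : c ≠ ∞)
    (h : ∀ a b : ℝ, a < b → m (Set.Icc a b) ≤ c * ENNReal.ofReal (b - a)) :
    m ≤ c • volume := by
  -- Lebesgue outer measure is the largest outer measure dominated by interval lengths, so
  -- domination on intervals suffices.
  have key : (c⁻¹ • m).toOuterMeasure ≤ StieltjesFunction.id.outer := by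
    rw [StieltjesFunction.outer, OuterMeasure.le_ofFunction]
    intro s
    rw [StieltjesFunction.length_eq]
    refine le_iInf fun a => le_iInf fun b => le_iInf fun hs => ?_
    -- The length function may exclude a least element of the order; the real line has none.
    have hs' : s ⊆ Set.Ioc a b := by
      intro x hx
      refine hs ⟨hx, fun hbot => ?_⟩
      have := hbot (x - 1)
      linarith
    rcases lt_or_ge a b with hab | hab
    · calc (c⁻¹ • m).toOuterMeasure s ≤ (c⁻¹ • m) (Set.Icc a b) :=
            measure_mono (hs'.trans Set.Ioc_subset_Icc_self)
        _ ≤ c⁻¹ * (c * ENNReal.ofReal (b - a)) := by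
            rw [Measure.smul_apply, smul_eq_mul]
            gcongr
            exact h a b hab
        _ = _ := by
            rw [← mul_assoc, ENNReal.inv_mul_cancel hc0 hc, one_mul]
            rfl
    · have : s = ∅ := Set.subset_empty_iff.1 (by rwa [Set.Ioc_eq_empty (not_lt.2 hab)] at hs')
      rw [this]
      simp
  refine Measure.le_iff.2 fun s _ => ?_
  have h1 : (c⁻¹ • m) s ≤ volume s := by
    rw [Real.volume_val, StieltjesFunction.measure_def]
    exact key s
  rw [Measure.smul_apply, smul_eq_mul] at h1 ⊢
  calc m s = c * (c⁻¹ * m s) := by rw [← mul_assoc, ENNReal.mul_inv_cancel hc0 hc, one_mul]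
    _ ≤ _ := by gcongr

section Averaging

variable {ι : Type} [Fintype ι] [DecidableEq ι]

/-- The spectral measure of a Hermitian matrix at a basis vector. -/
def spectralMeasure (H : Matrix ι ι ℂ) (x : ι) : Measure ℝ :=
  ∑ E ∈ realSpectrum H, ENNReal.ofReal (spectralWeight H E x) • Measure.dirac E

theorem lintegral_spectralMeasure (H : Matrix ι ι ℂ) (x : ι) (f : ℝ → ℝ≥0∞) :
    ∫⁻ E, f E ∂spectralMeasure H x
      = ∑ E ∈ realSpectrum H, ENNReal.ofReal (spectralWeight H E x) * f E := by
  rw [spectralMeasure, lintegral_finsetSum_measure]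
  refine Finset.sum_congr rfl fun E _ => ?_
  rw [lintegral_smul_measure, lintegral_dirac, smul_eq_mul]

theorem spectralMeasure_apply (H : Matrix ι ι ℂ) (x : ι) {J : Set ℝ} (hJ : MeasurableSet J) :
    spectralMeasure H x J = ENNReal.ofReal (spectralSum H J x x).re := by
  have hs : spectralSum H J x x
      = ((∑ E ∈ realSpectrum H, J.indicator (fun E => spectralWeight H E x) E : ℝ) : ℂ) := by
    rw [spectralSum, Complex.ofReal_sum]
    refine Finset.sum_congr rfl fun E _ => ?_
    by_cases h : E ∈ J
    · rw [Set.indicator_of_mem h, Set.indicator_of_mem h, spectralEntry_self]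
    · rw [Set.indicator_of_notMem h, Set.indicator_of_notMem h, Complex.ofReal_zero]
  rw [hs, Complex.ofReal_re, ENNReal.ofReal_sum_of_nonneg fun E _ =>
    Set.indicator_nonneg (fun E _ => spectralWeight_nonneg H E x) E]
  rw [← lintegral_indicator_one hJ, lintegral_spectralMeasure]
  refine Finset.sum_congr rfl fun E _ => ?_
  by_cases h : E ∈ J
  · rw [Set.indicator_of_mem h, Set.indicator_of_mem h, Pi.one_apply, mul_one]
  · rw [Set.indicator_of_notMem h, Set.indicator_of_notMem h, mul_zero, ENNReal.ofReal_zero]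

theorem measurable_spectralMeasure {Ω : Type*} [MeasurableSpace Ω] {H : Ω → Matrix ι ι ℂ}
    (hm : MeasurableEntries H) (hH : ∀ ω, (H ω).IsHermitian) (x : ι) :
    Measurable fun ω => spectralMeasure (H ω) x := by
  refine Measure.measurable_of_measurable_coe _ fun s hs => ?_
  simp only [spectralMeasure_apply _ _ hs]
  exact ENNReal.measurable_ofReal.comp
    (Complex.measurable_re.comp (measurable_spectralSum hm hH hs x x))

/-- The matrix `H₀ + t lam N` for real `t`. -/
def perturbed (H₀ : Matrix ι ι ℂ) (N : ι → ℝ) (lam t : ℝ) : Matrix ι ι ℂ :=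
  H₀ + ((t : ℂ) * lam) • Matrix.diagonal (fun i => (N i : ℂ))

theorem isHermitian_perturbed {H₀ : Matrix ι ι ℂ} (hH : H₀.IsHermitian) (N : ι → ℝ) (lam t : ℝ) :
    (perturbed H₀ N lam t).IsHermitian := by
  refine hH.add ?_
  rw [Matrix.IsHermitian, Matrix.conjTranspose_smul, Matrix.diagonal_conjTranspose]
  congr 1
  · simp
  · congr 1
    funext i
    simp

theorem pencil_ofReal (H₀ : Matrix ι ι ℂ) (N : ι → ℝ) (lam t : ℝ) (ζ : ℂ) :
    pencil H₀ N lam ζ t = perturbed H₀ N lam t - ζ • (1 : Matrix ι ι ℂ) := rfl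

/-- The indicator of [c - r, c + r] is at most 2r times the Poisson kernel r/((E - c)² + r²), whose
spectral integral is the imaginary part of the resolvent at c + ir. -/
theorem spectralMeasure_Icc_le {H₀ : Matrix ι ι ℂ} (hH : H₀.IsHermitian) (N : ι → ℝ) (lam t : ℝ)
    (c : ℝ) {r : ℝ} (hr : 0 < r) (x : ι) :
    spectralMeasure (perturbed H₀ N lam t) x (Set.Icc (c - r) (c + r))
      ≤ ENNReal.ofReal (2 * r) * ENNReal.ofReal
        (quadResolvent H₀ N lam (c + r * Complex.I) (Pi.single x 1) t).im := by
  set H := perturbed H₀ N lam t with hHdef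
  have hHh : H.IsHermitian := isHermitian_perturbed hH N lam t
  have hq : quadResolvent H₀ N lam (c + r * Complex.I) (Pi.single x 1) t
      = ∑ E ∈ realSpectrum H, ((E : ℂ) - (c + r * Complex.I))⁻¹ * (spectralWeight H E x : ℂ) := by
    have h1 : quadResolvent H₀ N lam (c + r * Complex.I) (Pi.single x 1) t
        = (pencil H₀ N lam (c + r * Complex.I) t)⁻¹ x x := by
      rw [quadResolvent, ← Pi.single_star, single_dotProduct]
      simp [Matrix.mulVec_single]
    rw [h1, (inv_apply_eq_sum hHh (p := fun E => (E : ℂ) - (c + r * Complex.I)) ?_ ?_ x x).2]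
    · exact Finset.sum_congr rfl fun E _ => by rw [spectralEntry_self]
    · intro E v hv
      rw [pencil_ofReal, Matrix.sub_mulVec, hv, Matrix.smul_mulVec, Matrix.one_mulVec, ← sub_smul]
    · intro E h
      have := congrArg Complex.im h
      simp at this
      exact hr.ne' this
  have him : (quadResolvent H₀ N lam (c + r * Complex.I) (Pi.single x 1) t).im
      = ∑ E ∈ realSpectrum H, r / ((E - c) ^ 2 + r ^ 2) * spectralWeight H E x := by
    rw [hq, Complex.im_sum]
    refine Finset.sum_congr rfl fun E _ => ?_
    rw [Complex.im_mul_ofReal, Complex.inv_im]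
    congr 1
    simp only [Complex.normSq_apply, Complex.sub_re, Complex.sub_im, Complex.add_re,
      Complex.add_im, Complex.mul_re, Complex.mul_im, Complex.ofReal_re, Complex.ofReal_im,
      Complex.I_re, Complex.I_im]
    ring_nf
  rw [spectralMeasure_apply _ _ measurableSet_Icc, him, ← ENNReal.ofReal_mul (by positivity)]
  refine ENNReal.ofReal_le_ofReal ?_
  rw [spectralSum, Complex.re_sum, Finset.mul_sum]
  refine Finset.sum_le_sum fun E _ => ?_
  have hw := spectralWeight_nonneg H E x
  by_cases h : E ∈ Set.Icc (c - r) (c + r)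
  · rw [Set.indicator_of_mem h, spectralEntry_self, Complex.ofReal_re, ← mul_assoc]
    refine le_mul_of_one_le_left hw ?_
    rw [← mul_div_assoc, one_le_div (by positivity)]
    nlinarith [h.1, h.2]
  · rw [Set.indicator_of_notMem h, Complex.zero_re]
    positivity

/-- Spectral averaging: after averaging over the strength of a diagonal perturbation with a
measure controlled by the Cauchy density, the spectral measure has a bounded density. -/
theorem lintegral_spectralMeasure_perturbed_le {H₀ : Matrix ι ι ℂ} (hH : H₀.IsHermitian)
    {N : ι → ℝ} (hN : ∀ i, 0 ≤ N i) {lam : ℝ} (hlam : 0 < lam) {ν : Measure ℝ} {K : ℝ}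
    (hK : 0 < K) (hν : ∀ g : ℝ → ℝ≥0∞, ∫⁻ t, g t ∂ν
        ≤ ENNReal.ofReal K * ∫⁻ t : ℝ, ENNReal.ofReal ((1 + t ^ 2)⁻¹) * g t)
    {x : ι} (hx : N x = 1) {f : ℝ → ℝ≥0∞} (hf : Measurable f) :
    ∫⁻ t, ∫⁻ E, f E ∂spectralMeasure (perturbed H₀ N lam t) x ∂ν
      ≤ ENNReal.ofReal (K * Real.pi / lam) * ∫⁻ E, f E := by
  have hpi := Real.pi_pos
  have hm : MeasurableEntries fun t => perturbed H₀ N lam t := by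
    intro i j
    simp only [perturbed, Matrix.add_apply, Matrix.smul_apply]
    fun_prop
  have hmeas : Measurable fun t => spectralMeasure (perturbed H₀ N lam t) x :=
    measurable_spectralMeasure hm (fun t => isHermitian_perturbed hH N lam t) x
  rw [← Measure.lintegral_bind hmeas.aemeasurable hf.aemeasurable]
  have hle : ν.bind (fun t => spectralMeasure (perturbed H₀ N lam t) x)
      ≤ ENNReal.ofReal (K * Real.pi / lam) • volume := by
    refine measure_le_of_Icc_le (by positivity) ENNReal.ofReal_ne_top fun a b hab => ?_
    rw [Measure.bind_apply measurableSet_Icc hmeas.aemeasurable]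
    set r := (b - a) / 2 with hr
    have hr0 : 0 < r := by rw [hr]; linarith
    have hIcc : Set.Icc a b = Set.Icc ((a + b) / 2 - r) ((a + b) / 2 + r) := by
      rw [hr]; congr 1 <;> ring
    have hζ : 0 < (((a + b) / 2 : ℝ) + r * Complex.I : ℂ).im := by simp [hr0]
    rw [hIcc]
    calc _ ≤ ∫⁻ t, ENNReal.ofReal (2 * r) * ENNReal.ofReal
            (quadResolvent H₀ N lam (((a + b) / 2 : ℝ) + r * Complex.I) (Pi.single x 1) t).im ∂ν :=
          lintegral_mono fun t => spectralMeasure_Icc_le hH N lam t _ hr0 x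
      _ ≤ ENNReal.ofReal (2 * r) * (ENNReal.ofReal K * ENNReal.ofReal (Real.pi * (1 / lam))) := by
          rw [lintegral_const_mul' _ _ ENNReal.ofReal_ne_top]
          refine mul_le_mul_right ((hν _).trans (mul_le_mul_right ?_ _)) _
          have h1 := lintegral_cauchy_im_quadResolvent_le hH hN hlam hζ (v := Pi.single x 1)
            (fun i hi => by
              by_cases h : i = x
              · rw [h, hx]
              · simp [Pi.single_eq_of_ne h] at hi)
          have h2 : ∑ i, ‖(Pi.single x 1 : ι → ℂ) i‖ ^ 2 = 1 := by
            rw [Finset.sum_eq_single x]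
            · simp
            · intro b _ hb; simp [Pi.single_eq_of_ne hb]
            · simp
          rwa [h2] at h1
      _ = _ := by
          rw [← ENNReal.ofReal_mul hK.le, ← ENNReal.ofReal_mul (by positivity),
            ← ENNReal.ofReal_mul (by positivity)]
          congr 1
          rw [hr]
          ring
  calc _ ≤ ∫⁻ E, f E ∂(ENNReal.ofReal (K * Real.pi / lam) • volume) := lintegral_mono' hle le_rfl
    _ = _ := by rw [lintegral_smul_measure, smul_eq_mul]

end Averaging

end

end HardCore

namespace HardCore

noncomputable section

/-! ### Geometry of the configuration space -/

section Geometry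

variable {L n : ℕ}

theorem pos_strictMono (x : Config L n) : StrictMono (pos x) := fun i j h => by
  have : x i < x j := x.strictMono h
  exact_mod_cast this

theorem config_ext {x y : Config L n} (h : ∀ j, pos x j = pos y j) : x = y :=
  DFunLike.ext _ _ fun j => Subtype.ext (h j)

theorem mem_occupied {x : Config L n} {p : ℤ} : p ∈ occupied x ↔ ∃ j, pos x j = p := by
  simp [occupied]

/-- The right ends of clusters. -/
def rightEnds (x : Config L n) : Finset ℤ := (occupied x).filter fun p => p + 1 ∉ occupied x

/-- The left ends of clusters. -/
def leftEnds (x : Config L n) : Finset ℤ := (occupied x).filter fun p => p - 1 ∉ occupied x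

/-- The longest run of occupied sites ending at p is a cluster. -/
theorem exists_isCluster_of_mem_rightEnds {x : Config L n} {p : ℤ} (hp : p ∈ rightEnds x) :
    ∃ a, a ≤ p ∧ IsCluster x (Finset.Icc a p) := by
  obtain ⟨h1, h2⟩ := Finset.mem_filter.1 hp
  set S := (occupied x).filter fun a => a ≤ p ∧ Finset.Icc a p ⊆ occupied x with hS
  have hne : S.Nonempty := ⟨p, by simp [hS, h1]⟩
  have hmin := S.min'_mem hne
  obtain ⟨h3, h4, h5⟩ := Finset.mem_filter.1 hmin
  refine ⟨S.min' hne, h4, S.min' hne, p, h4, rfl, h5, fun h => ?_, h2⟩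
  have : S.min' hne - 1 ∈ S := by
    refine Finset.mem_filter.2 ⟨h, by linarith, fun q hq => ?_⟩
    rw [Finset.mem_Icc] at hq
    rcases eq_or_lt_of_le hq.1 with h6 | h6
    · rw [← h6]; exact h
    · exact h5 (Finset.mem_Icc.2 ⟨by linarith [Int.add_one_le_of_lt h6], hq.2⟩)
  have := S.min'_le _ this
  linarith

theorem exists_isCluster_of_mem_leftEnds {x : Config L n} {p : ℤ} (hp : p ∈ leftEnds x) :
    ∃ b, p ≤ b ∧ IsCluster x (Finset.Icc p b) := by
  obtain ⟨h1, h2⟩ := Finset.mem_filter.1 hp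
  set S := (occupied x).filter fun b => p ≤ b ∧ Finset.Icc p b ⊆ occupied x with hS
  have hne : S.Nonempty := ⟨p, by simp [hS, h1]⟩
  have hmax := S.max'_mem hne
  obtain ⟨h3, h4, h5⟩ := Finset.mem_filter.1 hmax
  refine ⟨S.max' hne, h4, p, S.max' hne, h4, rfl, h5, h2, fun h => ?_⟩
  have : S.max' hne + 1 ∈ S := by
    refine Finset.mem_filter.2 ⟨h, by linarith, fun q hq => ?_⟩
    rw [Finset.mem_Icc] at hq
    rcases eq_or_lt_of_le hq.2 with h6 | h6
    · rw [h6]; exact h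
    · exact h5 (Finset.mem_Icc.2 ⟨hq.1, by linarith [Int.le_sub_one_of_lt h6]⟩)
  have := S.le_max' _ this
  linarith

/-- A cluster is recovered from its right end, and conversely. Only this inequality is needed: it
bounds the number of possible moves and detects clustered configurations. -/
theorem card_rightEnds_le (x : Config L n) : (rightEnds x).card ≤ numClusters x := by
  classical
  choose! a ha hc using fun p => exists_isCluster_of_mem_rightEnds (x := x) (p := p)
  refine Finset.card_le_card_of_injOn (fun p => Finset.Icc (a p) p) (fun p hp => ?_) ?_
  · have h := hc p hp
    refine Finset.mem_filter.2 ⟨Finset.mem_powerset.2 ?_, h⟩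
    obtain ⟨_, _, _, _, h', _⟩ := h
    exact h'
  · intro p hp q hq hpq
    simp only at hpq
    have h1 : p ∈ Finset.Icc (a q) q := by rw [← hpq]; exact Finset.right_mem_Icc.2 (ha p hp)
    have h2 : q ∈ Finset.Icc (a p) p := by rw [hpq]; exact Finset.right_mem_Icc.2 (ha q hq)
    exact le_antisymm (Finset.mem_Icc.1 h1).2 (Finset.mem_Icc.1 h2).2

theorem card_leftEnds_le (x : Config L n) : (leftEnds x).card ≤ numClusters x := by
  classical
  choose! b hb hc using fun p => exists_isCluster_of_mem_leftEnds (x := x) (p := p)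
  refine Finset.card_le_card_of_injOn (fun p => Finset.Icc p (b p)) (fun p hp => ?_) ?_
  · have h := hc p hp
    refine Finset.mem_filter.2 ⟨Finset.mem_powerset.2 ?_, h⟩
    obtain ⟨_, _, _, _, h', _⟩ := h
    exact h'
  · intro p hp q hq hpq
    simp only at hpq
    have h1 : p ∈ Finset.Icc q (b q) := by rw [← hpq]; exact Finset.left_mem_Icc.2 (hb p hp)
    have h2 : q ∈ Finset.Icc p (b p) := by rw [hpq]; exact Finset.left_mem_Icc.2 (hb q hq)
    exact le_antisymm (Finset.mem_Icc.1 h2).1 (Finset.mem_Icc.1 h1).1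

theorem exists_eq_of_dist₁_eq_one {x y : Config L n} (h : dist₁ x y = 1) :
    ∃ j, |pos x j - pos y j| = 1 ∧ ∀ i, i ≠ j → pos y i = pos x i := by
  have hex : ∃ j, pos x j - pos y j ≠ 0 := by
    by_contra hcon
    push Not at hcon
    rw [dist₁, Finset.sum_eq_zero (fun j _ => by rw [hcon j, abs_zero])] at h
    exact zero_ne_one h
  obtain ⟨j, hj⟩ := hex
  have h1 : 1 ≤ |pos x j - pos y j| := Int.one_le_abs hj
  rw [dist₁, ← Finset.add_sum_erase _ _ (Finset.mem_univ j)] at h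
  have h2 : 0 ≤ ∑ i ∈ Finset.univ.erase j, |pos x i - pos y i| :=
    Finset.sum_nonneg fun i _ => abs_nonneg _
  have h3 : ∑ i ∈ Finset.univ.erase j, |pos x i - pos y i| = 0 := by linarith
  refine ⟨j, by linarith, fun i hi => ?_⟩
  have := (Finset.sum_eq_zero_iff_of_nonneg (fun i _ => abs_nonneg _)).1 h3 i
    (Finset.mem_erase.2 ⟨hi, Finset.mem_univ i⟩)
  rw [abs_eq_zero] at this
  linarith

/-- The hopping degree is at most twice the number of clusters. -/
theorem card_neighbors_le [NeZero n] (x : Config L n) :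
    (Finset.univ.filter fun y : Config L n => dist₁ x y = 1).card ≤ 2 * numClusters x := by
  classical
  choose! j hj1 hj2 using fun y (h : dist₁ x y = 1) => exists_eq_of_dist₁_eq_one h
  have hcard : ((rightEnds x ×ˢ {(1 : ℤ)}) ∪ (leftEnds x ×ˢ {(-1 : ℤ)})).card
      ≤ 2 * numClusters x := by
    refine (Finset.card_union_le _ _).trans ?_
    simp only [Finset.card_product, Finset.card_singleton, mul_one]
    have := card_rightEnds_le x
    have := card_leftEnds_le x
    omega
  -- A neighbour is encoded by the site being vacated and the direction ±1. The target site must be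
  -- free, so rightward moves start at right ends and leftward moves at left ends.
  refine le_trans (Finset.card_le_card_of_injOn
    (fun y => (pos x (j y), pos y (j y) - pos x (j y))) (fun y hy => ?_) ?_) hcard
  · have hy : dist₁ x y = 1 := (Finset.mem_filter.1 hy).2
    have hocc : pos x (j y) ∈ occupied x := mem_occupied.2 ⟨_, rfl⟩
    have hfree : pos y (j y) ∉ occupied x := by
      intro hmem
      obtain ⟨i, hi⟩ := mem_occupied.1 hmem
      by_cases hij : i = j y
      · rw [hij] at hi
        have := hj1 y hy
        rw [hi] at this
        simp at this
      · rw [← hj2 y hy i hij] at hi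
        exact hij ((pos_strictMono y).injective hi)
    rcases (abs_eq one_pos.le).1 (hj1 y hy) with h | h
    · refine Finset.mem_union_right _ (Finset.mem_product.2 ⟨Finset.mem_filter.2 ⟨hocc, ?_⟩, ?_⟩)
      · rwa [show pos x (j y) - 1 = pos y (j y) by linarith]
      · rw [Finset.mem_singleton]; linarith
    · refine Finset.mem_union_left _ (Finset.mem_product.2 ⟨Finset.mem_filter.2 ⟨hocc, ?_⟩, ?_⟩)
      · rwa [show pos x (j y) + 1 = pos y (j y) by linarith]
      · rw [Finset.mem_singleton]; linarith
  · intro y hy z hz hyz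
    have hy : dist₁ x y = 1 := (Finset.mem_filter.1 hy).2
    have hz : dist₁ x z = 1 := (Finset.mem_filter.1 hz).2
    obtain ⟨h1, h2⟩ := Prod.mk.inj hyz
    have h3 : j y = j z := (pos_strictMono x).injective h1
    refine config_ext fun i => ?_
    by_cases hi : i = j y
    · rw [hi]
      rw [← h3] at h2
      linarith
    · rw [hj2 y hy i hi, hj2 z hz i (by rwa [← h3])]

theorem rightEnds_nonempty [NeZero n] (x : Config L n) : (rightEnds x).Nonempty := by
  have hne : (occupied x).Nonempty := ⟨pos x 0, mem_occupied.2 ⟨0, rfl⟩⟩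
  refine ⟨(occupied x).max' hne, Finset.mem_filter.2 ⟨Finset.max'_mem _ _, fun h => ?_⟩⟩
  have := Finset.le_max' _ _ h
  linarith

theorem two_le_numClusters [NeZero n] {x : Config L n} (hx : ¬ IsClustered x) :
    2 ≤ numClusters x := by
  have h1 := card_rightEnds_le x
  have h2 := Finset.card_pos.2 (rightEnds_nonempty x)
  have h3 : numClusters x ≠ 1 := hx
  omega

/-- The last particle is always a right end. With one cluster it is the only one, so every other
particle has an occupied right neighbour. -/
theorem pos_succ_of_isClustered {x : Config L n} (hx : IsClustered x) {j : ℕ} (hj : j + 1 < n) :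
    pos x ⟨j + 1, hj⟩ = pos x ⟨j, by omega⟩ + 1 := by
  have hcard : (rightEnds x).card ≤ 1 := (card_rightEnds_le x).trans (le_of_eq hx)
  have hlast : pos x ⟨n - 1, by omega⟩ ∈ rightEnds x := by
    refine Finset.mem_filter.2 ⟨mem_occupied.2 ⟨_, rfl⟩, fun h => ?_⟩
    obtain ⟨i, hi⟩ := mem_occupied.1 h
    have : pos x i ≤ pos x ⟨n - 1, by omega⟩ :=
      (pos_strictMono x).monotone (Fin.mk_le_mk.2 (by have := i.2; omega) : i ≤ ⟨n - 1, by omega⟩)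
    linarith
  have hocc : pos x ⟨j, by omega⟩ + 1 ∈ occupied x := by
    by_contra hcon
    have hmem : pos x ⟨j, by omega⟩ ∈ rightEnds x :=
      Finset.mem_filter.2 ⟨mem_occupied.2 ⟨_, rfl⟩, hcon⟩
    have := (pos_strictMono x).injective (Finset.card_le_one.1 hcard _ hmem _ hlast)
    have := congrArg Fin.val this
    simp at this
    omega
  obtain ⟨i, hi⟩ := mem_occupied.1 hocc
  have h1 : (⟨j, by omega⟩ : Fin n) < i := (pos_strictMono x).lt_iff_lt.1 (by linarith)
  have h2 : pos x ⟨j + 1, hj⟩ ≤ pos x i :=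
    (pos_strictMono x).monotone (Fin.mk_le_mk.2 (Nat.succ_le_of_lt h1) : (⟨j + 1, hj⟩ : Fin n) ≤ i)
  have h3 : pos x ⟨j, by omega⟩ < pos x ⟨j + 1, hj⟩ :=
    pos_strictMono x (Fin.mk_lt_mk.2 (Nat.lt_succ_self j))
  linarith [Int.add_one_le_of_lt h3]

theorem pos_eq_of_isClustered [NeZero n] {x : Config L n} (hx : IsClustered x) (j : Fin n) :
    pos x j = pos x 0 + (j : ℕ) := by
  obtain ⟨j, hj⟩ := j
  induction j with
  | zero => simp
  | succ j ih =>
    rw [pos_succ_of_isClustered hx hj, ih (by omega)]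
    push_cast
    ring

theorem eq_of_isClustered [NeZero n] {x y : Config L n} (hx : IsClustered x) (hy : IsClustered y)
    (h : pos x 0 = pos y 0) : x = y :=
  config_ext fun j => by rw [pos_eq_of_isClustered hx, pos_eq_of_isClustered hy, h]

theorem dist₁_nonneg (x y : Config L n) : 0 ≤ dist₁ x y := Finset.sum_nonneg fun _ _ => abs_nonneg _

theorem dist₁_self (x : Config L n) : dist₁ x x = 0 := by simp [dist₁]

theorem dist₁_comm (x y : Config L n) : dist₁ x y = dist₁ y x := by
  simp only [dist₁, abs_sub_comm]

theorem dist₁_triangle (x y z : Config L n) : dist₁ x z ≤ dist₁ x y + dist₁ y z := by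
  rw [dist₁, dist₁, dist₁, ← Finset.sum_add_distrib]
  exact Finset.sum_le_sum fun j _ => abs_sub_le _ _ _

theorem abs_pos_sub_le_dist₁ (x y : Config L n) (j : Fin n) : |pos x j - pos y j| ≤ dist₁ x y :=
  Finset.single_le_sum (f := fun j => |pos x j - pos y j|) (fun _ _ => abs_nonneg _)
    (Finset.mem_univ j)

/-! ### Sums over configurations -/

/-- The sum `∑_{k ∈ ℤ} exp(-κ |k|)`. -/
def expSum (κ : ℝ) : ℝ := ∑' k : ℤ, Real.exp (-κ * |k|)

theorem summable_exp_abs {κ : ℝ} (hκ : 0 < κ) : Summable fun k : ℤ => Real.exp (-κ * |k|) := by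
  have h : Summable fun k : ℕ => Real.exp (-κ) ^ k :=
    summable_geometric_of_lt_one (Real.exp_pos _).le (Real.exp_zero ▸ Real.exp_lt_exp.2 (by linarith))
  refine Summable.of_nat_of_neg (h.congr fun k => ?_) (h.congr fun k => ?_)
  · rw [← Real.exp_nat_mul]; congr 1; push_cast; simp; ring
  · rw [← Real.exp_nat_mul]; congr 1; push_cast; simp; ring

theorem sum_exp_abs_le {κ : ℝ} (hκ : 0 < κ) (T : Finset ℤ) :
    ∑ k ∈ T, Real.exp (-κ * |k|) ≤ expSum κ :=
  (summable_exp_abs hκ).sum_le_tsum _ fun _ _ => (Real.exp_pos _).le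

theorem expSum_pos {κ : ℝ} (hκ : 0 < κ) : 0 < expSum κ :=
  lt_of_lt_of_le (by simp) (sum_exp_abs_le hκ {0})

open scoped Classical in
/-- Sums over the positions of a clustered configuration. -/
theorem sum_clustered_exp_le [NeZero n] {κ : ℝ} (hκ : 0 < κ) (a : ℤ) :
    ∑ v : Config L n with IsClustered v, Real.exp (-κ * |pos v 0 - a|) ≤ expSum κ := by
  have hinj : Set.InjOn (fun v : Config L n => pos v 0 - a)
      (Finset.univ.filter fun v : Config L n => IsClustered v) := by
    intro v hv w hw h
    simp only [Finset.coe_filter, Finset.mem_univ, true_and, Set.mem_ofPred_eq] at hv hw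
    exact eq_of_isClustered hv hw (by simp only at h; linarith)
  have := sum_exp_abs_le hκ ((Finset.univ.filter fun v : Config L n => IsClustered v).image
    (fun v => pos v 0 - a))
  rw [Finset.sum_image hinj] at this
  exact_mod_cast this

/-- Consecutive gaps are at least 1 in w and exactly 1 in v. -/
theorem monotone_pos_sub [NeZero n] {v : Config L n} (hv : IsClustered v) (w : Config L n) :
    Monotone fun j => pos w j - pos v j := by
  have key : ∀ i k : ℕ, (h : i + k < n) → pos w ⟨i, by omega⟩ + k ≤ pos w ⟨i + k, h⟩ := by
    intro i k
    induction k with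
    | zero => intro h; simp
    | succ k ih =>
      intro h
      have h1 := ih (by omega)
      have h2 : pos w ⟨i + k, by omega⟩ < pos w ⟨i + (k + 1), h⟩ :=
        pos_strictMono w (Fin.mk_lt_mk.2 (by omega))
      have := Int.add_one_le_of_lt h2
      push_cast
      linarith
  intro i j hij
  simp only
  rw [pos_eq_of_isClustered hv i, pos_eq_of_isClustered hv j]
  have hij' : (i : ℕ) ≤ j := hij
  have h1 := key i (j - i) (by have := j.2; omega)
  have h2 : (⟨(i : ℕ) + (j - i), by have := j.2; omega⟩ : Fin n) = j := Fin.ext (by simp; omega)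
  rw [h2] at h1
  push_cast [Nat.cast_sub hij'] at h1
  have h3 : (⟨(i : ℕ), by omega⟩ : Fin n) = i := rfl
  rw [h3] at h1
  linarith

/-- The number of particles displaced by `k`, for nonzero `k` in the range of displacements. -/
def displacementCount (v w : Config L n)
    (k : ((Finset.Icc (-(2 * L : ℤ)) (2 * L)).erase 0 : Finset ℤ)) : ℕ :=
  (Finset.univ.filter fun j => pos w j - pos v j = k).card

theorem pos_mem (x : Config L n) (j : Fin n) : -(L : ℤ) ≤ pos x j ∧ pos x j ≤ L :=
  Finset.mem_Icc.1 (x j).2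

theorem displacement_mem (v w : Config L n) (j : Fin n) :
    pos w j - pos v j ∈ Finset.Icc (-(2 * L : ℤ)) (2 * L) := by
  have h1 := pos_mem v j
  have h2 := pos_mem w j
  rw [Finset.mem_Icc]
  constructor <;> linarith

theorem eq_of_monotone_of_card_eq {f g : Fin n → ℤ} (hf : Monotone f) (hg : Monotone g)
    (h : ∀ k, (Finset.univ.filter fun j => f j = k).card
      = (Finset.univ.filter fun j => g j = k).card) : f = g := by
  have hm : Multiset.map f Finset.univ.val = Multiset.map g Finset.univ.val := by
    ext k
    rw [Multiset.count_map, Multiset.count_map]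
    have := h k
    simp only [Finset.card, Finset.filter_val] at this
    simpa [eq_comm] using this
  rw [Fin.univ_val_map, Fin.univ_val_map, Multiset.coe_eq_coe] at hm
  exact List.ofFn_injective (hm.eq_of_sortedLE hf.sortedLE_ofFn hg.sortedLE_ofFn)

/-- The displacements from a clustered configuration are monotone in the particle index, so their
multiset determines w. The multiplicity of 0 need not be recorded, since the total is n. -/
theorem displacementCount_injective [NeZero n] {v : Config L n} (hv : IsClustered v) :
    Function.Injective (displacementCount v) := by
  intro w w' h
  have hk : ∀ k, k ≠ 0 → (Finset.univ.filter fun j => pos w j - pos v j = k).card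
      = (Finset.univ.filter fun j => pos w' j - pos v j = k).card := by
    intro k hk0
    by_cases hk : k ∈ Finset.Icc (-(2 * L : ℤ)) (2 * L)
    · exact congrFun h ⟨k, Finset.mem_erase.2 ⟨hk0, hk⟩⟩
    · rw [Finset.filter_false_of_mem, Finset.filter_false_of_mem]
      · rintro j - rfl; exact hk (displacement_mem v w' j)
      · rintro j - rfl; exact hk (displacement_mem v w j)
  have htot : ∀ u : Config L n, ∑ k ∈ Finset.Icc (-(2 * L : ℤ)) (2 * L),
      (Finset.univ.filter fun j => pos u j - pos v j = k).card = n := by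
    intro u
    have := Finset.card_eq_sum_card_fiberwise (s := (Finset.univ : Finset (Fin n)))
      (t := Finset.Icc (-(2 * L : ℤ)) (2 * L)) (f := fun j => pos u j - pos v j)
      (fun j _ => displacement_mem v u j)
    simpa using this.symm
  have h0mem : (0 : ℤ) ∈ Finset.Icc (-(2 * L : ℤ)) (2 * L) := by simp
  have h0 : (Finset.univ.filter fun j => pos w j - pos v j = 0).card
      = (Finset.univ.filter fun j => pos w' j - pos v j = 0).card := by
    have h1 := htot w
    have h2 := htot w'
    rw [← Finset.add_sum_erase _ _ h0mem] at h1 h2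
    have h3 : ∑ k ∈ (Finset.Icc (-(2 * L : ℤ)) (2 * L)).erase 0,
        (Finset.univ.filter fun j => pos w j - pos v j = k).card
        = ∑ k ∈ (Finset.Icc (-(2 * L : ℤ)) (2 * L)).erase 0,
        (Finset.univ.filter fun j => pos w' j - pos v j = k).card :=
      Finset.sum_congr rfl fun k hk' => hk k (Finset.ne_of_mem_erase hk')
    omega
  have := eq_of_monotone_of_card_eq (monotone_pos_sub hv w) (monotone_pos_sub hv w') fun k => by
    by_cases hk0 : k = 0
    · subst hk0; exact h0
    · exact hk k hk0
  exact config_ext fun j => by have := congrFun this j; linarith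

theorem dist₁_eq_sum_displacementCount (v w : Config L n) :
    dist₁ w v = ∑ k : ((Finset.Icc (-(2 * L : ℤ)) (2 * L)).erase 0 : Finset ℤ),
      |(k : ℤ)| * (displacementCount v w k : ℤ) := by
  have h1 := Finset.sum_fiberwise_of_maps_to (s := (Finset.univ : Finset (Fin n)))
      (t := Finset.Icc (-(2 * L : ℤ)) (2 * L)) (g := fun j => pos w j - pos v j)
      (fun j _ => displacement_mem v w j) (fun j => |pos w j - pos v j|)
  rw [dist₁, ← h1]
  have h2 : ∀ k ∈ Finset.Icc (-(2 * L : ℤ)) (2 * L),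
      ∑ j with pos w j - pos v j = k, |pos w j - pos v j|
      = |k| * ((Finset.univ.filter fun j => pos w j - pos v j = k).card : ℤ) := by
    intro k _
    rw [Finset.sum_congr rfl (fun j hj => by rw [(Finset.mem_filter.1 hj).2]), Finset.sum_const,
      nsmul_eq_mul, mul_comm]
  rw [Finset.sum_congr rfl h2]
  have h0mem : (0 : ℤ) ∈ Finset.Icc (-(2 * L : ℤ)) (2 * L) := by simp
  rw [← Finset.add_sum_erase _ _ h0mem, abs_zero, zero_mul, zero_add, ← Finset.sum_coe_sort]
  rfl

/-- A bound for the number of configurations near a clustered one, weighted exponentially. -/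
def clusterSum (κ : ℝ) : ℝ := Real.exp (expSum κ / (1 - Real.exp (-κ)))

theorem clusterSum_pos (κ : ℝ) : 0 < clusterSum κ := Real.exp_pos _

/-- Uses 1/(1 - a) = 1 + a/(1 - a) ≤ exp(a/(1 - a)), where a = exp(-κ|k|) ≤ exp(-κ) makes the
denominator independent of k. The product over k then becomes a convergent sum in the exponent. -/
theorem geom_le_exp {κ : ℝ} (hκ : 0 < κ) (N : ℕ) {k : ℤ} (hk : k ≠ 0) :
    ∑ m ∈ Finset.range N, Real.exp (-κ * |k|) ^ m
      ≤ Real.exp (Real.exp (-κ * |k|) / (1 - Real.exp (-κ))) := by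
  set a := Real.exp (-κ * |k|) with ha
  have hk1 : (1 : ℝ) ≤ |(k : ℝ)| := by exact_mod_cast Int.one_le_abs hk
  have hq : Real.exp (-κ) < 1 := Real.exp_zero ▸ Real.exp_lt_exp.2 (by linarith)
  have hak : a ≤ Real.exp (-κ) := Real.exp_le_exp.2 (by push_cast; nlinarith)
  have ha0 : 0 < a := Real.exp_pos _
  have h1 : ∑ m ∈ Finset.range N, a ^ m ≤ (1 - a)⁻¹ := by
    rw [← tsum_geometric_of_lt_one ha0.le (by linarith)]
    exact (summable_geometric_of_lt_one ha0.le (by linarith)).sum_le_tsum _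
      fun _ _ => by positivity
  refine h1.trans ?_
  have h2 : (1 - a)⁻¹ ≤ a / (1 - Real.exp (-κ)) + 1 := by
    have h3 : (1 - a)⁻¹ = a / (1 - a) + 1 := by
      have : 1 - a ≠ 0 := by linarith
      field_simp
      ring
    rw [h3]
    gcongr
  exact h2.trans (Real.add_one_le_exp _)

/-- The distance is ∑ |k| m_k over the displacement multiplicities m_k. Summing over all m,
admissible or not, gives a product of geometric series as in the generating function of partitions,
bounded independently of n and L. -/
theorem sum_exp_dist₁_le [NeZero n] {κ : ℝ} (hκ : 0 < κ) {v : Config L n} (hv : IsClustered v) :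
    ∑ w : Config L n, Real.exp (-κ * dist₁ w v) ≤ clusterSum κ := by
  classical
  set T : Finset ℤ := (Finset.Icc (-(2 * L : ℤ)) (2 * L)).erase 0 with hT
  have hq : Real.exp (-κ) < 1 := Real.exp_zero ▸ Real.exp_lt_exp.2 (by linarith)
  have hw : ∀ w : Config L n, Real.exp (-κ * dist₁ w v)
      = ∏ k : T, Real.exp (-κ * |(k : ℤ)|) ^ displacementCount v w k := by
    intro w
    rw [dist₁_eq_sum_displacementCount]
    simp only [← Real.exp_nat_mul]
    rw [← Real.exp_sum]
    congr 1
    push_cast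
    rw [Finset.mul_sum]
    exact Finset.sum_congr rfl fun k _ => by ring
  have hmem : ∀ w : Config L n, displacementCount v w ∈
      Fintype.piFinset fun _ : T => Finset.range (n + 1) := by
    intro w
    rw [Fintype.mem_piFinset]
    intro k
    rw [Finset.mem_range, Nat.lt_succ_iff]
    exact (Finset.card_le_univ _).trans (by simp)
  calc ∑ w : Config L n, Real.exp (-κ * dist₁ w v)
      = ∑ m ∈ Finset.univ.image (displacementCount v),
          ∏ k : T, Real.exp (-κ * |(k : ℤ)|) ^ m k := by
        rw [Finset.sum_image fun a _ b _ h => displacementCount_injective hv h]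
        exact Finset.sum_congr rfl fun w _ => hw w
    _ ≤ ∑ m ∈ Fintype.piFinset fun _ : T => Finset.range (n + 1),
          ∏ k : T, Real.exp (-κ * |(k : ℤ)|) ^ m k := by
        refine Finset.sum_le_sum_of_subset_of_nonneg ?_ fun m _ _ => by positivity
        intro m hm
        obtain ⟨w, -, rfl⟩ := Finset.mem_image.1 hm
        exact hmem w
    _ = ∏ k : T, ∑ m ∈ Finset.range (n + 1), Real.exp (-κ * |(k : ℤ)|) ^ m := by
        rw [Finset.prod_univ_sum]
    _ ≤ ∏ k : T, Real.exp (Real.exp (-κ * |(k : ℤ)|) / (1 - Real.exp (-κ))) := by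
        refine Finset.prod_le_prod (fun k _ => by positivity) fun k _ => ?_
        exact geom_le_exp hκ _ (Finset.ne_of_mem_erase k.2)
    _ ≤ clusterSum κ := by
        rw [← Real.exp_sum, ← Finset.sum_div, clusterSum]
        refine Real.exp_le_exp.2 (div_le_div_of_nonneg_right ?_ (by linarith))
        rw [Finset.sum_coe_sort T fun k : ℤ => Real.exp (-κ * |(k : ℤ)|)]
        exact sum_exp_abs_le hκ T

/-! ### A maximum principle off the clustered configurations -/

open scoped Classical in
-- The comparison function h on the right grows by at most exp μ per hop and dominates f on
-- clustered configurations. A maximum of f/h at an unclustered configuration is excluded unless f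
-- vanishes, because its at most 2k neighbours contribute at most 2k exp μ, less than 6k exp μ.
theorem le_sum_clustered_of_subharmonic [NeZero n] {μ : ℝ} (hμ : 0 ≤ μ) {f : Config L n → ℝ}
    (hf0 : ∀ w, 0 ≤ f w)
    (hf : ∀ w, ¬ IsClustered w →
      6 * numClusters w * Real.exp μ * f w ≤ ∑ y with dist₁ w y = 1, f y) (w : Config L n) :
    f w ≤ ∑ v : Config L n with IsClustered v, Real.exp (-μ * dist₁ w v) * f v := by
  set h : Config L n → ℝ := fun w =>
    ∑ v : Config L n with IsClustered v, Real.exp (-μ * dist₁ w v) * f v with hh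
  have hh0 : ∀ w, 0 ≤ h w := fun w =>
    Finset.sum_nonneg fun v _ => mul_nonneg (Real.exp_pos _).le (hf0 v)
  have hstep : ∀ w y, dist₁ w y = 1 → h y ≤ Real.exp μ * h w := by
    intro w y hwy
    simp only [hh, Finset.mul_sum]
    refine Finset.sum_le_sum fun v _ => ?_
    rw [← mul_assoc, ← Real.exp_add]
    refine mul_le_mul_of_nonneg_right (Real.exp_le_exp.2 ?_) (hf0 v)
    have h1 := dist₁_triangle w y v
    rw [hwy] at h1
    have h2 : (dist₁ w v : ℝ) ≤ 1 + dist₁ y v := by exact_mod_cast h1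
    nlinarith
  have hclust : ∀ v, IsClustered v → f v ≤ h v := by
    intro v hv
    have : Real.exp (-μ * dist₁ v v) * f v ≤ h v :=
      Finset.single_le_sum (f := fun u => Real.exp (-μ * dist₁ v u) * f u)
        (fun u _ => mul_nonneg (Real.exp_pos _).le (hf0 u))
        (Finset.mem_filter.2 ⟨Finset.mem_univ v, hv⟩)
    rwa [dist₁_self, Int.cast_zero, mul_zero, Real.exp_zero, one_mul] at this
  -- The ε keeps the denominator h + ε positive even where h vanishes.
  refine le_of_forall_pos_le_add fun ε hε => ?_
  have hexp1 : 1 ≤ Real.exp μ := Real.one_le_exp hμ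
  obtain ⟨w₀, -, hw₀⟩ := Finset.exists_max_image Finset.univ
    (fun w => f w / (h w + ε)) ⟨w, Finset.mem_univ w⟩
  set m := f w₀ / (h w₀ + ε) with hm
  have hpos : ∀ w, 0 < h w + ε := fun w => by linarith [hh0 w]
  have hm0 : 0 ≤ m := div_nonneg (hf0 w₀) (hpos w₀).le
  have hle : ∀ w, f w ≤ m * (h w + ε) := fun w =>
    (div_le_iff₀ (hpos w)).1 (hw₀ w (Finset.mem_univ w))
  have hm1 : m ≤ 1 := by
    by_cases hc : IsClustered w₀
    · rw [hm, div_le_one (hpos w₀)]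
      linarith [hclust w₀ hc]
    · have hk : (2 : ℝ) ≤ numClusters w₀ := by exact_mod_cast two_le_numClusters hc
      have h1 : ∑ y with dist₁ w₀ y = 1, f y
          ≤ (2 * numClusters w₀) * (m * (Real.exp μ * (h w₀ + ε))) := by
        calc ∑ y with dist₁ w₀ y = 1, f y
            ≤ ∑ y : Config L n with dist₁ w₀ y = 1, m * (Real.exp μ * (h w₀ + ε)) := by
              refine Finset.sum_le_sum fun y hy => (hle y).trans ?_
              have := hstep w₀ y (Finset.mem_filter.1 hy).2
              refine mul_le_mul_of_nonneg_left ?_ hm0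
              nlinarith
          _ = ((Finset.univ.filter fun y : Config L n => dist₁ w₀ y = 1).card : ℝ) *
                (m * (Real.exp μ * (h w₀ + ε))) := by
              rw [Finset.sum_const, nsmul_eq_mul]
          _ ≤ _ := by
              refine mul_le_mul_of_nonneg_right ?_
                (mul_nonneg hm0 (mul_nonneg (Real.exp_pos _).le (hpos w₀).le))
              exact_mod_cast card_neighbors_le w₀
      have h2 := (hf w₀ hc).trans h1
      have h3 : f w₀ = m * (h w₀ + ε) := (div_mul_cancel₀ _ (hpos w₀).ne').symm
      rw [h3] at h2
      set B := (numClusters w₀ : ℝ) * Real.exp μ * (h w₀ + ε) with hB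
      have hB0 : 0 < B := by have := hpos w₀; positivity
      have h4 : 6 * (m * B) ≤ 2 * (m * B) := by
        calc 6 * (m * B) = 6 * numClusters w₀ * Real.exp μ * (m * (h w₀ + ε)) := by rw [hB]; ring
          _ ≤ _ := h2
          _ = _ := by rw [hB]; ring
      have h5 : m * B ≤ 0 := by linarith
      nlinarith
  calc f w ≤ m * (h w + ε) := hle w
    _ ≤ 1 * (h w + ε) := mul_le_mul_of_nonneg_right hm1 (hpos w).le
    _ = _ := one_mul _

end Geometry

end

end HardCore

namespace HardCore

noncomputable section

open scoped Matrix

/-! ### The Hamiltonian on half-lines -/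

section Model

variable {L n : ℕ}

/-- The diagonal part of the Hamiltonian. -/
def diagEnergy (g lam : ℝ) (η : Site L → ℝ) (x : Config L n) : ℝ :=
  2 * g * numClusters x + lam * ∑ j, η (x j)

theorem hamiltonian_apply (g lam : ℝ) (η : Site L → ℝ) (x y : Config L n) :
    hamiltonian n g lam η x y
      = -(if dist₁ x y = 1 then 1 else 0) + if x = y then (diagEnergy g lam η x : ℂ) else 0 := by
  by_cases h : x = y
  · subst h
    simp [hamiltonian, adjacency, interaction, potential, diagEnergy, add_assoc]
  · simp [hamiltonian, adjacency, interaction, potential, h]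

/-- The Hamiltonian restricted to configurations in the half-line `[a, ∞)`, extended by zero. -/
def halfHamiltonian [NeZero n] (g lam : ℝ) (η : Site L → ℝ) (a : ℤ) :
    Matrix (Config L n) (Config L n) ℂ :=
  Matrix.of fun x y => if a ≤ pos x 0 ∧ a ≤ pos y 0 then hamiltonian n g lam η x y else 0

theorem halfHamiltonian_eq [NeZero n] (g lam : ℝ) (η : Site L → ℝ) :
    halfHamiltonian g lam η (-(L : ℤ)) = hamiltonian n g lam η := by
  ext x y
  simp only [halfHamiltonian, Matrix.of_apply]
  rw [if_pos ⟨(pos_mem x 0).1, (pos_mem y 0).1⟩]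

theorem hamiltonian_symm (g lam : ℝ) (η : Site L → ℝ) (x y : Config L n) :
    hamiltonian n g lam η x y = hamiltonian n g lam η y x := by
  rw [hamiltonian_apply, hamiltonian_apply, dist₁_comm]
  by_cases h : x = y
  · rw [h]
  · rw [if_neg h, if_neg (Ne.symm h)]

theorem halfHamiltonian_symm [NeZero n] (g lam : ℝ) (η : Site L → ℝ) (a : ℤ) (x y : Config L n) :
    halfHamiltonian g lam η a x y = halfHamiltonian g lam η a y x := by
  simp only [halfHamiltonian, Matrix.of_apply, and_comm (a := a ≤ pos x 0), hamiltonian_symm g lam η x y]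

theorem isHermitian_halfHamiltonian [NeZero n] (g lam : ℝ) (η : Site L → ℝ) (a : ℤ) :
    (halfHamiltonian (n := n) g lam η a).IsHermitian := by
  refine Matrix.IsHermitian.ext fun x y => ?_
  rw [halfHamiltonian_symm]
  simp only [halfHamiltonian, Matrix.of_apply, hamiltonian_apply]
  split_ifs <;> simp

theorem measurableEntries_halfHamiltonian [NeZero n] (g lam : ℝ) (a : ℤ) :
    MeasurableEntries fun η : Site L → ℝ => halfHamiltonian (n := n) g lam η a := by
  intro x y
  simp only [halfHamiltonian, Matrix.of_apply, hamiltonian_apply, diagEnergy]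
  split_ifs
  all_goals fun_prop

/-- The indicator of the configurations in `[a, ∞)` that occupy the site `u`. -/
def occupation [NeZero n] (a : ℤ) (u : Site L) (x : Config L n) : ℝ :=
  open scoped Classical in if a ≤ pos x 0 ∧ ∃ j, x j = u then 1 else 0

theorem occupation_nonneg [NeZero n] (a : ℤ) (u : Site L) (x : Config L n) :
    0 ≤ occupation a u x := by
  unfold occupation; split_ifs <;> norm_num

theorem occupation_eq_one [NeZero n] {a : ℤ} {u : Site L} {x : Config L n} (ha : a ≤ u)
    (hu : pos x 0 = u) : occupation a u x = 1 := by
  unfold occupation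
  rw [if_pos ⟨by rw [hu]; exact ha, 0, Subtype.ext hu⟩]

theorem sum_update (η : Site L → ℝ) (u : Site L) (t : ℝ) (x : Config L n) :
    ∑ j, Function.update η u t (x j) = ∑ j, Function.update η u 0 (x j) +
      open scoped Classical in if ∃ j, x j = u then t else 0 := by
  split_ifs with h
  · obtain ⟨i, hi⟩ := h
    have key : ∀ r : ℝ, ∑ j, Function.update η u r (x j)
        = r + ∑ j ∈ Finset.univ.erase i, η (x j) := fun r => by
      rw [← Finset.add_sum_erase _ _ (Finset.mem_univ i), hi, Function.update_self]
      congr 1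
      exact Finset.sum_congr rfl fun j hj => Function.update_of_ne (fun h' =>
        Finset.ne_of_mem_erase hj (x.injective (h'.trans hi.symm))) _ _
    rw [key, key]
    ring
  · push Not at h
    rw [add_zero]
    exact Finset.sum_congr rfl fun j _ => by
      rw [Function.update_of_ne (h j), Function.update_of_ne (h j)]

/-- Each site carries at most one particle, so the potential at u enters linearly with coefficient 0
or 1. -/
theorem halfHamiltonian_update [NeZero n] (g lam : ℝ) (η : Site L → ℝ) (a : ℤ) (u : Site L)
    (t : ℝ) : halfHamiltonian (n := n) g lam (Function.update η u t) a
      = perturbed (halfHamiltonian g lam (Function.update η u 0) a) (occupation a u) lam t := by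
  classical
  ext x y
  simp only [perturbed, halfHamiltonian, Matrix.add_apply, Matrix.of_apply, Matrix.smul_apply,
    smul_eq_mul, hamiltonian_apply, diagEnergy, occupation, sum_update η u t]
  by_cases hxy : x = y
  · subst hxy
    simp only [Matrix.diagonal_apply_eq, and_self]
    by_cases ha : a ≤ pos x 0
    · by_cases hu : ∃ j, x j = u
      · simp [ha, hu]; ring
      · simp [ha, hu]
    · simp [ha]
  · simp [hxy]

/-- Independence behind the decoupling: particles of a configuration in [a, ∞) never visit a site
left of a. -/
theorem halfHamiltonian_update_of_lt [NeZero n] (g lam : ℝ) (η : Site L → ℝ) {a : ℤ} {u : Site L}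
    (hu : (u : ℤ) < a) (t : ℝ) :
    halfHamiltonian (n := n) g lam (Function.update η u t) a = halfHamiltonian g lam η a := by
  ext x y
  simp only [halfHamiltonian, Matrix.of_apply]
  split_ifs with h
  · have : ∑ j, Function.update η u t (x j) = ∑ j, η (x j) := by
      refine Finset.sum_congr rfl fun j _ => Function.update_of_ne (fun hj => ?_) _ _
      have h1 : pos x 0 ≤ pos x j := (pos_strictMono x).monotone (Fin.zero_le _)
      have h2 : pos x j = u := congrArg Subtype.val hj
      linarith [h.1]
    simp only [hamiltonian_apply, diagEnergy, this]
  · rfl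

/-! ### Half-line resolvents, decay off clustered configurations and decoupling -/

/-- The resolvent of the half-line Hamiltonian. -/
def green [NeZero n] (g lam : ℝ) (η : Site L → ℝ) (a : ℤ) (ζ : ℂ) :
    Matrix (Config L n) (Config L n) ℂ :=
  (halfHamiltonian g lam η a - ζ • (1 : Matrix (Config L n) (Config L n) ℂ))⁻¹

theorem green_update [NeZero n] (g lam : ℝ) (η : Site L → ℝ) (a : ℤ) (u : Site L) (t : ℝ) (ζ : ℂ) :
    green (n := n) g lam (Function.update η u t) a ζ
      = (pencil (halfHamiltonian g lam (Function.update η u 0) a) (occupation a u) lam ζ t)⁻¹ := by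
  rw [green, halfHamiltonian_update, pencil_ofReal]

theorem green_update_of_lt [NeZero n] (g lam : ℝ) (η : Site L → ℝ) {a : ℤ} {u : Site L}
    (hu : (u : ℤ) < a) (t : ℝ) (ζ : ℂ) :
    green (n := n) g lam (Function.update η u t) a ζ = green g lam η a ζ := by
  rw [green, halfHamiltonian_update_of_lt g lam η hu, green]

/-- The Hamiltonian has real symmetric entries, so the resolvent is symmetric under transposition
even at complex ζ. -/
theorem green_symm [NeZero n] (g lam : ℝ) (η : Site L → ℝ) (a : ℤ) (ζ : ℂ) (x y : Config L n) :
    green g lam η a ζ x y = green g lam η a ζ y x := by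
  have h : (halfHamiltonian (n := n) g lam η a - ζ • 1)ᵀ = halfHamiltonian g lam η a - ζ • 1 := by
    ext x y
    simp only [Matrix.transpose_apply, Matrix.sub_apply, Matrix.smul_apply,
      halfHamiltonian_symm g lam η a y x, Matrix.one_apply, eq_comm (a := y)]
  have h2 := Matrix.transpose_nonsing_inv (halfHamiltonian (n := n) g lam η a - ζ • 1)
  rw [h] at h2
  exact congrFun (congrFun h2 y) x

theorem det_ne_zero_of_im_pos [NeZero n] (g lam : ℝ) (η : Site L → ℝ) (a : ℤ) {ζ : ℂ}
    (hζ : 0 < ζ.im) : (halfHamiltonian (n := n) g lam η a - ζ • 1).det ≠ 0 := by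
  have := det_pencil_ne_zero (isHermitian_halfHamiltonian (n := n) g lam η a)
    (N := fun _ => 0) (fun _ => le_rfl) (lam := 0) le_rfl hζ (ξ := 0) (by simp)
  simpa [pencil] using this

theorem mul_green [NeZero n] {g lam : ℝ} {η : Site L → ℝ} {a : ℤ} {ζ : ℂ}
    (hdet : (halfHamiltonian (n := n) g lam η a - ζ • 1).det ≠ 0) :
    (halfHamiltonian (n := n) g lam η a - ζ • 1) * green g lam η a ζ = 1 :=
  Matrix.mul_nonsing_inv _ (Ne.isUnit hdet)

theorem halfHamiltonian_mulVec_green [NeZero n] {g lam : ℝ} {η : Site L → ℝ} {a : ℤ} {ζ : ℂ}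
    (hdet : (halfHamiltonian (n := n) g lam η a - ζ • 1).det ≠ 0) (w y : Config L n) :
    (halfHamiltonian g lam η a *ᵥ fun x => green g lam η a ζ x y) w
      = ζ * green g lam η a ζ w y + (1 : Matrix (Config L n) (Config L n) ℂ) w y := by
  have h := congrFun (congrFun (mul_green hdet) w) y
  rw [Matrix.sub_mul, Matrix.sub_apply, Matrix.smul_mul, Matrix.one_mul, Matrix.smul_apply,
    smul_eq_mul, Matrix.mul_apply] at h
  rw [← h]
  simp only [Matrix.mulVec, dotProduct]
  ring

theorem halfHamiltonian_mulVec_of_lt [NeZero n] (g lam : ℝ) (η : Site L → ℝ) {a : ℤ}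
    {w : Config L n} (hw : pos w 0 < a) (ψ : Config L n → ℂ) :
    (halfHamiltonian g lam η a *ᵥ ψ) w = 0 := by
  simp only [Matrix.mulVec, dotProduct, halfHamiltonian, Matrix.of_apply]
  refine Finset.sum_eq_zero fun y _ => ?_
  rw [if_neg (fun h => absurd h.1 (not_le.2 hw)), zero_mul]

/-- Rows outside the half-line vanish by the extension by zero, so there ζ G = 0 off the diagonal;
the diagonal entry rules out ζ = 0. -/
theorem green_eq_zero [NeZero n] {g lam : ℝ} {η : Site L → ℝ} {a : ℤ} {ζ : ℂ}
    (hdet : (halfHamiltonian (n := n) g lam η a - ζ • 1).det ≠ 0) {w y : Config L n}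
    (hw : pos w 0 < a) (hy : a ≤ pos y 0) : green g lam η a ζ w y = 0 := by
  have h1 := halfHamiltonian_mulVec_green hdet w w
  rw [halfHamiltonian_mulVec_of_lt g lam η hw, Matrix.one_apply_eq] at h1
  have hζ : ζ ≠ 0 := by rintro rfl; simp at h1
  have h2 := halfHamiltonian_mulVec_green hdet w y
  have hne : w ≠ y := by rintro rfl; linarith
  rw [halfHamiltonian_mulVec_of_lt g lam η hw, Matrix.one_apply_ne hne, add_zero] at h2
  exact (mul_eq_zero.1 h2.symm).resolve_left hζ

theorem halfHamiltonian_mulVec_apply [NeZero n] (g lam : ℝ) (η : Site L → ℝ) {a : ℤ}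
    {w : Config L n} (hw : a ≤ pos w 0) (ψ : Config L n → ℂ) :
    (halfHamiltonian g lam η a *ᵥ ψ) w
      = diagEnergy g lam η w * ψ w - ∑ y with dist₁ w y = 1 ∧ a ≤ pos y 0, ψ y := by
  simp only [Matrix.mulVec, dotProduct, halfHamiltonian, Matrix.of_apply, hamiltonian_apply]
  have h : ∀ y, (if a ≤ pos w 0 ∧ a ≤ pos y 0 then
      -(if dist₁ w y = 1 then (1 : ℂ) else 0) + (if w = y then (diagEnergy g lam η w : ℂ) else 0)
      else 0) * ψ y = (if w = y then (diagEnergy g lam η w : ℂ) * ψ y else 0)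
        - if dist₁ w y = 1 ∧ a ≤ pos y 0 then ψ y else 0 := by
    intro y
    by_cases h1 : w = y
    · subst h1
      simp [hw, dist₁_self]
    · by_cases h2 : dist₁ w y = 1 <;> by_cases h3 : a ≤ pos y 0 <;> simp [h1, h2, h3, hw]
  rw [Finset.sum_congr rfl fun y _ => h y, Finset.sum_sub_distrib, Finset.sum_filter]
  simp

open scoped Classical in
/-- Decay away from the clustered configurations of solutions at energies below the threshold. -/
theorem norm_le_sum_clustered [NeZero n] {g lam μT : ℝ} {η : Site L → ℝ} {a : ℤ} {ζ : ℂ}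
    (hμT : 0 < μT) (hlam : 0 ≤ lam) (hη : ∀ α, 0 ≤ η α) (h0 : 0 ≤ ζ.re)
    (hthr : ζ.re < threshold g μT) {ψ : Config L n → ℂ}
    (hψ0 : ∀ w, pos w 0 < a → ψ w = 0)
    (hψ : ∀ w, a ≤ pos w 0 → ¬ IsClustered w → (halfHamiltonian g lam η a *ᵥ ψ) w = ζ * ψ w)
    (w : Config L n) :
    ‖ψ w‖ ≤ ∑ v : Config L n with IsClustered v, Real.exp (-μT * dist₁ w v) * ‖ψ v‖ := by
  refine le_sum_clustered_of_subharmonic hμT.le (f := fun w => ‖ψ w‖) (fun w => norm_nonneg _)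
    (fun w hw => ?_) w
  have hsum0 : (0 : ℝ) ≤ ∑ y : Config L n with dist₁ w y = 1, ‖ψ y‖ :=
    Finset.sum_nonneg fun _ _ => norm_nonneg _
  rcases lt_or_ge (pos w 0) a with hwa | hwa
  · simp only [hψ0 w hwa, norm_zero, mul_zero]
    exact hsum0
  have h1 := hψ w hwa hw
  rw [halfHamiltonian_mulVec_apply g lam η hwa] at h1
  have h2 : ((diagEnergy g lam η w : ℂ) - ζ) * ψ w
      = ∑ y with dist₁ w y = 1 ∧ a ≤ pos y 0, ψ y := by
    linear_combination h1
  have h3 : ‖(diagEnergy g lam η w : ℂ) - ζ‖ * ‖ψ w‖ ≤ ∑ y with dist₁ w y = 1, ‖ψ y‖ := by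
    rw [← norm_mul, h2]
    refine (norm_sum_le _ _).trans ?_
    refine Finset.sum_le_sum_of_subset_of_nonneg (fun y hy => ?_) fun _ _ _ => norm_nonneg _
    simp only [Finset.mem_filter] at hy ⊢
    exact ⟨hy.1, hy.2.1⟩
  refine le_trans (mul_le_mul_of_nonneg_right ?_ (norm_nonneg _)) h3
  have h4 : diagEnergy g lam η w - ζ.re ≤ ‖(diagEnergy g lam η w : ℂ) - ζ‖ := by
    have := Complex.re_le_norm ((diagEnergy g lam η w : ℂ) - ζ)
    simpa using this
  refine le_trans ?_ h4
  have hk : (2 : ℝ) ≤ numClusters w := by exact_mod_cast two_le_numClusters hw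
  have hV : 0 ≤ lam * ∑ j, η (w j) := mul_nonneg hlam (Finset.sum_nonneg fun j _ => hη _)
  rw [threshold] at hthr
  rw [diagEnergy]
  -- With k clusters, 2gk - (4g - 12 exp μT) - 6k exp μT = (2g - 6 exp μT)(k - 2), a product of
  -- nonnegative factors since 0 ≤ ζ.re < 4g - 12 exp μT and k ≥ 2.
  have h5 : 0 ≤ (2 * g - 6 * Real.exp μT) := by linarith
  nlinarith

/-- A hop across the boundary moves the first particle from b to b - 1 and nothing else; hence at
most one such hop from each configuration. -/
theorem pos_of_dist₁_eq_one [NeZero n] {w z : Config L n} {b : ℤ} (h : dist₁ w z = 1)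
    (hw : b ≤ pos w 0) (hz : pos z 0 < b) :
    pos w 0 = b ∧ pos z 0 = b - 1 ∧ ∀ i, i ≠ 0 → pos z i = pos w i := by
  obtain ⟨j, hj, hne⟩ := exists_eq_of_dist₁_eq_one h
  have hj0 : j = 0 := by
    by_contra hcon
    have := hne 0 (Ne.symm hcon)
    linarith
  subst hj0
  rw [abs_eq one_pos.le] at hj
  refine ⟨?_, ?_, hne⟩ <;> rcases hj with hj | hj <;> linarith

/-- The configurations below `b` that are adjacent to a given configuration. -/
def belowNeighbors [NeZero n] (a b : ℤ) (w : Config L n) : Finset (Config L n) :=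
  Finset.univ.filter fun z => dist₁ w z = 1 ∧ a ≤ pos z 0 ∧ pos z 0 < b

theorem card_belowNeighbors_le [NeZero n] (a : ℤ) {b : ℤ} {w : Config L n} (hw : b ≤ pos w 0) :
    (belowNeighbors a b w).card ≤ 1 := by
  refine Finset.card_le_one.2 fun z hz z' hz' => ?_
  simp only [belowNeighbors, Finset.mem_filter] at hz hz'
  obtain ⟨h1, h2, h3⟩ := pos_of_dist₁_eq_one hz.2.1 hw hz.2.2.2
  obtain ⟨h1', h2', h3'⟩ := pos_of_dist₁_eq_one hz'.2.1 hw hz'.2.2.2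
  refine config_ext fun i => ?_
  by_cases hi : i = 0
  · rw [hi, h2, h2']
  · rw [h3 i hi, h3' i hi]

theorem belowNeighbors_eq_empty [NeZero n] (a : ℤ) {b : ℤ} {w : Config L n} (hw : b < pos w 0) :
    belowNeighbors a b w = ∅ := by
  refine Finset.filter_false_of_mem fun z _ hz => ?_
  have := (pos_of_dist₁_eq_one hz.1 hw.le hz.2.2).1
  linarith

/-- A solution on the half-line `[a, ∞)` is determined on `[b, ∞)` by its values just below `b`. -/
theorem eq_sum_green_mul [NeZero n] {g lam : ℝ} {η : Site L → ℝ} {a b : ℤ} (hab : a ≤ b) {ζ : ℂ}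
    (hdet : (halfHamiltonian (n := n) g lam η b - ζ • 1).det ≠ 0) {ψ : Config L n → ℂ}
    (hψ : ∀ w, b ≤ pos w 0 → (halfHamiltonian g lam η a *ᵥ ψ) w = ζ * ψ w)
    {y : Config L n} (hy : b ≤ pos y 0) :
    ψ y = ∑ w with b ≤ pos w 0, green g lam η b ζ y w * ∑ z ∈ belowNeighbors a b w, ψ z := by
  set ψb : Config L n → ℂ := fun w => if b ≤ pos w 0 then ψ w else 0 with hψb
  set φ : Config L n → ℂ := fun w => if b ≤ pos w 0 then ∑ z ∈ belowNeighbors a b w, ψ z else 0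
    with hφ
  -- Restricting the equation to [b, ∞) removes the hops below b. Since hopping enters with a minus
  -- sign, they reappear on the right as a positive source.
  have heq : (halfHamiltonian g lam η b - ζ • (1 : Matrix (Config L n) (Config L n) ℂ)) *ᵥ ψb
      = φ := by
    funext w
    rw [Matrix.sub_mulVec, Pi.sub_apply, Matrix.smul_mulVec, Matrix.one_mulVec, Pi.smul_apply,
      smul_eq_mul]
    by_cases hw : b ≤ pos w 0
    · have h1 := hψ w hw
      rw [halfHamiltonian_mulVec_apply g lam η (hab.trans hw)] at h1
      rw [halfHamiltonian_mulVec_apply g lam η hw]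
      simp only [hψb, hφ, if_pos hw]
      have h2 : ∑ y with dist₁ w y = 1 ∧ b ≤ pos y 0, (if b ≤ pos y 0 then ψ y else 0)
          = ∑ y with dist₁ w y = 1 ∧ b ≤ pos y 0, ψ y :=
        Finset.sum_congr rfl fun y hy => if_pos (Finset.mem_filter.1 hy).2.2
      have h3 : ∑ y with dist₁ w y = 1 ∧ a ≤ pos y 0, ψ y
          = ∑ y with dist₁ w y = 1 ∧ b ≤ pos y 0, ψ y + ∑ z ∈ belowNeighbors a b w, ψ z := by
        rw [belowNeighbors, ← Finset.sum_union]
        · refine Finset.sum_congr ?_ fun _ _ => rfl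
          ext y
          simp only [Finset.mem_filter, Finset.mem_union, Finset.mem_univ, true_and]
          constructor
          · rintro ⟨h4, h5⟩
            rcases lt_or_ge (pos y 0) b with h6 | h6
            · exact Or.inr ⟨h4, h5, h6⟩
            · exact Or.inl ⟨h4, h6⟩
          · rintro (⟨h4, h5⟩ | ⟨h4, h5, -⟩)
            · exact ⟨h4, hab.trans h5⟩
            · exact ⟨h4, h5⟩
        · rw [Finset.disjoint_left]
          intro y h4 h5
          simp only [Finset.mem_filter, Finset.mem_univ, true_and] at h4 h5
          linarith [h4.2, h5.2.2]
      rw [h2]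
      rw [h3] at h1
      linear_combination h1
    · rw [halfHamiltonian_mulVec_of_lt g lam η (not_le.1 hw)]
      simp [hψb, hφ, if_neg hw]
  have h1 : ψb = green g lam η b ζ *ᵥ φ := by
    rw [← heq, Matrix.mulVec_mulVec, green, Matrix.nonsing_inv_mul _ (Ne.isUnit hdet),
      Matrix.one_mulVec]
  have h2 : ψ y = ψb y := by simp only [hψb, if_pos hy]
  rw [h2, h1, Matrix.mulVec, dotProduct, Finset.sum_filter]
  refine Finset.sum_congr rfl fun w _ => ?_
  simp only [hφ]
  split_ifs <;> simp

end Model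

end

end HardCore

namespace HardCore

noncomputable section

open scoped Matrix

/-! ### Resampling a coordinate of a product measure -/

section Resampling

variable {S : Type*} [Fintype S] [DecidableEq S]

theorem map_update_prod (ν : Measure ℝ) [IsProbabilityMeasure ν] (u : S) :
    ((Measure.pi fun _ : S => ν).prod ν).map (fun p => Function.update p.1 u p.2)
      = Measure.pi fun _ : S => ν := by
  have hmeas : Measurable fun p : (S → ℝ) × ℝ => Function.update p.1 u p.2 :=
    measurable_update'
  refine (Measure.pi_eq fun s hs => ?_).symm
  rw [Measure.map_apply hmeas (MeasurableSet.univ_pi hs)]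
  have hpre : (fun p : (S → ℝ) × ℝ => Function.update p.1 u p.2) ⁻¹' (Set.univ.pi s)
      = (Set.univ.pi (Function.update s u Set.univ)) ×ˢ s u := by
    ext ⟨η, t⟩
    simp only [Set.mem_preimage, Set.mem_pi, Set.mem_univ, true_implies, Set.mem_prod]
    constructor
    · intro h
      refine ⟨fun i => ?_, by simpa using h u⟩
      by_cases hi : i = u
      · subst hi; simp
      · have := h i
        rw [Function.update_of_ne hi] at this ⊢
        exact this
    · rintro ⟨h1, h2⟩ i
      by_cases hi : i = u
      · subst hi; simpa using h2
      · have := h1 i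
        rw [Function.update_of_ne hi] at this ⊢
        exact this
  rw [hpre, Measure.prod_prod, Measure.pi_pi, ← Finset.mul_prod_erase _ _ (Finset.mem_univ u),
    ← Finset.mul_prod_erase _ (fun i => ν (s i)) (Finset.mem_univ u), Function.update_self,
    measure_univ, one_mul, mul_comm]
  congr 1
  exact Finset.prod_congr rfl fun i hi => by rw [Function.update_of_ne (Finset.ne_of_mem_erase hi)]

/-- Stated as an inequality for arbitrary F, proved through a measurable minorant with the same
integral, so that no joint measurability of later integrands is required. -/
theorem lintegral_le_lintegral_update (ν : Measure ℝ) [IsProbabilityMeasure ν] (u : S)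
    (F : (S → ℝ) → ℝ≥0∞) :
    ∫⁻ η, F η ∂(Measure.pi fun _ : S => ν)
      ≤ ∫⁻ η, ∫⁻ t, F (Function.update η u t) ∂ν ∂(Measure.pi fun _ : S => ν) := by
  obtain ⟨G, hG, hGF, hint⟩ := exists_measurable_le_lintegral_eq (Measure.pi fun _ : S => ν) F
  have hmeas : Measurable fun p : (S → ℝ) × ℝ => Function.update p.1 u p.2 :=
    measurable_update'
  rw [hint]
  conv_lhs => rw [← map_update_prod ν u]
  rw [lintegral_map hG hmeas,
    lintegral_prod (fun p : (S → ℝ) × ℝ => G (Function.update p.1 u p.2))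
      (hG.comp hmeas).aemeasurable]
  exact lintegral_mono fun η => lintegral_mono fun t => hGF _

theorem ae_pi_nonneg {ν : Measure ℝ} [IsProbabilityMeasure ν] (hν : ∀ᵐ t ∂ν, 0 ≤ t) :
    ∀ᵐ η ∂(Measure.pi fun _ : S => ν), ∀ α, 0 ≤ η α := by
  rw [ae_all_iff]
  intro α
  exact (measurePreserving_eval (fun _ : S => ν) α).quasiMeasurePreserving.ae hν

end Resampling

theorem rpow_sum_le_sum_rpow {ι : Type*} (T : Finset ι) (f : ι → ℝ≥0∞) {s : ℝ} (hs0 : 0 < s)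
    (hs1 : s ≤ 1) : (∑ i ∈ T, f i) ^ s ≤ ∑ i ∈ T, f i ^ s := by
  classical
  induction T using Finset.induction_on with
  | empty => simp [hs0]
  | insert i T hi ih =>
    rw [Finset.sum_insert hi, Finset.sum_insert hi]
    exact (ENNReal.rpow_add_le_add_rpow _ _ hs0.le hs1).trans (add_le_add_right ih _)

/-! ### Fractional moments of the resolvent -/

section FractionalMoments

variable {L n : ℕ} [NeZero n]

theorem measurable_green (g lam : ℝ) (a : ℤ) (ζ : ℂ) (x y : Config L n) :
    Measurable fun η : Site L → ℝ => green g lam η a ζ x y := by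
  refine MeasurableEntries.inv (M := fun η : Site L → ℝ =>
    halfHamiltonian g lam η a - ζ • (1 : Matrix (Config L n) (Config L n) ℂ)) (fun i j => ?_) x y
  simp only [Matrix.sub_apply]
  exact (measurableEntries_halfHamiltonian g lam a i j).sub_const _

/-- A crude bound depending on Im ζ; it only starts the iteration and disappears in the limit. -/
theorem norm_green_le (g lam : ℝ) (η : Site L → ℝ) (a : ℤ) {ζ : ℂ} (hζ : 0 < ζ.im)
    (x y : Config L n) : ‖green g lam η a ζ x y‖ ≤ ζ.im⁻¹ := by
  have hH := isHermitian_halfHamiltonian (n := n) g lam η a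
  rw [green, (inv_apply_eq_sum hH (p := fun E => (E : ℂ) - ζ) ?_ ?_ x y).2]
  · calc _ ≤ ∑ E ∈ realSpectrum (halfHamiltonian (n := n) g lam η a),
          ζ.im⁻¹ * ‖spectralEntry (halfHamiltonian (n := n) g lam η a) E x y‖ := by
          refine (norm_sum_le _ _).trans (Finset.sum_le_sum fun E _ => ?_)
          rw [norm_mul, norm_inv]
          gcongr
          have := Complex.abs_im_le_norm ((E : ℂ) - ζ)
          simp only [Complex.sub_im, Complex.ofReal_im, zero_sub, abs_neg] at this
          exact (le_abs_self _).trans this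
      _ ≤ ζ.im⁻¹ * 1 := by
          rw [← Finset.mul_sum]
          gcongr
          have := correlator_le_one hH Set.univ x y
          rw [correlator_eq] at this
          simpa using this
      _ = _ := mul_one _
  · intro E v hv
    rw [Matrix.sub_mulVec, hv, Matrix.smul_mulVec, Matrix.one_mulVec, ← sub_smul]
  · intro E h
    have := congrArg Complex.im h
    simp at this
    exact hζ.ne' this

theorem green_eq_zero_of_det {g lam : ℝ} {η : Site L → ℝ} {a : ℤ} {ζ : ℂ}
    (hdet : (halfHamiltonian (n := n) g lam η a - ζ • 1).det = 0) :
    green (n := n) g lam η a ζ = 0 :=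
  Matrix.nonsing_inv_apply_not_isUnit _ (by simp [hdet])

open scoped Classical in
-- The column G(·, y) solves the eigenvalue equation away from y. As y is clustered, the source is
-- invisible to the maximum principle.
theorem norm_green_le_sum_clustered {g lam μT : ℝ} {η : Site L → ℝ} {b : ℤ} {ζ : ℂ}
    (hμT : 0 < μT) (hlam : 0 ≤ lam) (hη : ∀ α, 0 ≤ η α) (h0 : 0 ≤ ζ.re)
    (hthr : ζ.re < threshold g μT)
    {y : Config L n} (hy : IsClustered y) (hyb : b ≤ pos y 0) {s : ℝ} (hs0 : 0 < s) (hs1 : s ≤ 1)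
    (w : Config L n) :
    ‖green g lam η b ζ w y‖ₑ ^ s ≤ ∑ v : Config L n with IsClustered v ∧ b ≤ pos v 0,
      ENNReal.ofReal (Real.exp (-(s * μT) * dist₁ w v)) * ‖green g lam η b ζ v y‖ₑ ^ s := by
  by_cases hdet : (halfHamiltonian (n := n) g lam η b - ζ • 1).det = 0
  · rw [green_eq_zero_of_det hdet]
    simp [hs0]
  have h1 := norm_le_sum_clustered hμT hlam hη h0 hthr
    (ψ := fun w => green g lam η b ζ w y) (fun w hw => green_eq_zero hdet hw hyb)
    (fun w hw hc => by
      rw [halfHamiltonian_mulVec_green hdet, Matrix.one_apply_ne, add_zero]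
      rintro rfl
      exact hc hy) w
  have h2 : ‖green g lam η b ζ w y‖ₑ ≤ ∑ v : Config L n with IsClustered v ∧ b ≤ pos v 0,
      ENNReal.ofReal (Real.exp (-μT * dist₁ w v)) * ‖green g lam η b ζ v y‖ₑ := by
    rw [← ofReal_norm]
    refine (ENNReal.ofReal_le_ofReal h1).trans ?_
    rw [ENNReal.ofReal_sum_of_nonneg fun v _ => by positivity]
    refine le_of_eq ?_
    rw [← Finset.filter_filter, Finset.sum_filter (p := fun v : Config L n => b ≤ pos v 0)]
    refine Finset.sum_congr rfl fun v _ => ?_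
    split_ifs with hv
    · rw [ENNReal.ofReal_mul (Real.exp_pos _).le, ofReal_norm]
    · rw [green_eq_zero hdet (not_le.1 hv) hyb]
      simp
  refine (ENNReal.rpow_le_rpow h2 hs0.le).trans ((rpow_sum_le_sum_rpow _ _ hs0 hs1).trans ?_)
  refine le_of_eq (Finset.sum_congr rfl fun v _ => ?_)
  rw [ENNReal.mul_rpow_of_nonneg _ _ hs0.le, ENNReal.ofReal_rpow_of_pos (Real.exp_pos _),
    ← Real.exp_mul, show -μT * (dist₁ w v : ℝ) * s = -(s * μT) * dist₁ w v by ring]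

/-- The constant in the a priori bound on fractional moments. -/
def aPriori (K s lam : ℝ) : ℝ := K * (4 * (Real.pi * (4 / lam) ^ s / Real.cos (Real.pi * s / 2)))

theorem lintegral_update_green_le {K : ℝ} (hK : 0 < K) {ν : Measure ℝ}
    (hν : ∀ g : ℝ → ℝ≥0∞, ∫⁻ t, g t ∂ν
        ≤ ENNReal.ofReal K * ∫⁻ t : ℝ, ENNReal.ofReal ((1 + t ^ 2)⁻¹) * g t)
    {s : ℝ} (hs0 : 0 < s) (hs1 : s < 1) {g lam : ℝ} (hlam : 0 < lam) (η : Site L → ℝ) {a : ℤ}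
    {u : Site L} (hau : a ≤ u) {ζ : ℂ} (hζ : 0 < ζ.im) {x z : Config L n} (hx : pos x 0 = u)
    (hz : pos z 0 = u) :
    ∫⁻ t, ‖green g lam (Function.update η u t) a ζ z x‖ₑ ^ s ∂ν
      ≤ ENNReal.ofReal (aPriori K s lam) := by
  refine (hν _).trans ?_
  simp only [green_update]
  rw [aPriori, ENNReal.ofReal_mul hK.le]
  refine mul_le_mul_right ?_ _
  exact lintegral_cauchy_norm_rpow_inv_pencil_le (isHermitian_halfHamiltonian _ _ _ _)
    (occupation_nonneg a u) hlam hζ (occupation_eq_one hau hz) (occupation_eq_one hau hx) hs0 hs1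

theorem enorm_rpow_le_sum_green {g lam : ℝ} {η : Site L → ℝ} {a b : ℤ} (hab : a ≤ b) {ζ : ℂ}
    (hdet : (halfHamiltonian (n := n) g lam η b - ζ • 1).det ≠ 0) {ψ : Config L n → ℂ}
    (hψ : ∀ w, b ≤ pos w 0 → (halfHamiltonian g lam η a *ᵥ ψ) w = ζ * ψ w)
    {y : Config L n} (hy : b ≤ pos y 0) {s : ℝ} (hs0 : 0 < s) (hs1 : s ≤ 1) :
    ‖ψ y‖ₑ ^ s ≤ ∑ w with pos w 0 = b, ∑ z ∈ belowNeighbors a b w,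
      ‖green g lam η b ζ y w‖ₑ ^ s * ‖ψ z‖ₑ ^ s := by
  have h1 : ψ y = ∑ w with pos w 0 = b, ∑ z ∈ belowNeighbors a b w,
      green g lam η b ζ y w * ψ z := by
    rw [eq_sum_green_mul hab hdet hψ hy]
    simp only [Finset.mul_sum]
    symm
    refine Finset.sum_subset (fun w hw => ?_) fun w hw hw' => ?_
    · simp only [Finset.mem_filter, Finset.mem_univ, true_and] at hw ⊢
      exact hw.ge
    · simp only [Finset.mem_filter, Finset.mem_univ, true_and] at hw hw'
      rw [belowNeighbors_eq_empty a (lt_of_le_of_ne hw (Ne.symm hw')), Finset.sum_empty]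
  rw [h1]
  refine (ENNReal.rpow_le_rpow (enorm_sum_le _ _) hs0.le).trans ?_
  refine (rpow_sum_le_sum_rpow _ _ hs0 hs1).trans (Finset.sum_le_sum fun w _ => ?_)
  refine (ENNReal.rpow_le_rpow (enorm_sum_le _ _) hs0.le).trans ?_
  refine (rpow_sum_le_sum_rpow _ _ hs0 hs1).trans (Finset.sum_le_sum fun z _ => ?_)
  rw [enorm_mul, ENNReal.mul_rpow_of_nonneg _ _ hs0.le]

/-- Decoupling: averaging over the potential at the first site of a configuration. -/
theorem lintegral_green_le_sum {K : ℝ} (hK : 0 < K) {ν : Measure ℝ} [IsProbabilityMeasure ν]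
    (hν : ∀ g : ℝ → ℝ≥0∞, ∫⁻ t, g t ∂ν
        ≤ ENNReal.ofReal K * ∫⁻ t : ℝ, ENNReal.ofReal ((1 + t ^ 2)⁻¹) * g t)
    {s : ℝ} (hs0 : 0 < s) (hs1 : s < 1) {g lam : ℝ} (hlam : 0 < lam) {a : ℤ}
    {ζ : ℂ} (hζ : 0 < ζ.im) {x y : Config L n} (hax : a ≤ pos x 0) (hxy : pos x 0 < pos y 0) :
    ∫⁻ η, ‖green g lam η a ζ y x‖ₑ ^ s ∂(Measure.pi fun _ : Site L => ν)
      ≤ ENNReal.ofReal (aPriori K s lam) * ∑ w : Config L n with pos w 0 = pos x 0 + 1,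
        ∫⁻ η, ‖green g lam η (pos x 0 + 1) ζ y w‖ₑ ^ s ∂(Measure.pi fun _ : Site L => ν) := by
  set b := pos x 0 + 1 with hb
  set u : Site L := x 0 with hu
  have hux : pos x 0 = u := rfl
  have hub : (u : ℤ) < b := by rw [← hux]; linarith
  have hmeas : ∀ (a : ℤ) (x y : Config L n),
      Measurable fun η : Site L → ℝ => ‖green g lam η a ζ x y‖ₑ ^ s := fun a x y =>
    (measurable_green g lam a ζ x y).enorm.pow_const s
  have hpt : ∀ η : Site L → ℝ, ‖green g lam η a ζ y x‖ₑ ^ s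
      ≤ ∑ w with pos w 0 = b, ∑ z ∈ belowNeighbors a b w,
        ‖green g lam η b ζ y w‖ₑ ^ s * ‖green g lam η a ζ z x‖ₑ ^ s := fun η =>
    enorm_rpow_le_sum_green (by linarith) (det_ne_zero_of_im_pos g lam η b hζ)
      (ψ := fun w => green g lam η a ζ w x) (fun w hw => by
        rw [halfHamiltonian_mulVec_green (det_ne_zero_of_im_pos g lam η a hζ),
          Matrix.one_apply_ne, add_zero]
        rintro rfl
        linarith) (by linarith) hs0 hs1.le
  refine (lintegral_mono hpt).trans ((lintegral_le_lintegral_update ν u _).trans ?_)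
  have hinner : ∀ η : Site L → ℝ, ∫⁻ t, ∑ w with pos w 0 = b, ∑ z ∈ belowNeighbors a b w,
        ‖green g lam (Function.update η u t) b ζ y w‖ₑ ^ s *
          ‖green g lam (Function.update η u t) a ζ z x‖ₑ ^ s ∂ν
      ≤ ∑ w : Config L n with pos w 0 = b, ENNReal.ofReal (aPriori K s lam) *
        ‖green g lam η b ζ y w‖ₑ ^ s := by
    intro η
    have hm : ∀ w z : Config L n, Measurable fun t : ℝ =>
        ‖green g lam (Function.update η u t) b ζ y w‖ₑ ^ s *
          ‖green g lam (Function.update η u t) a ζ z x‖ₑ ^ s := fun w z =>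
      ((hmeas b y w).comp (measurable_update η)).mul ((hmeas a z x).comp (measurable_update η))
    rw [lintegral_finsetSum _ fun w _ => Finset.measurable_fun_sum _ fun z _ => hm w z]
    refine Finset.sum_le_sum fun w hw => ?_
    have hw' : pos w 0 = b := (Finset.mem_filter.1 hw).2
    rw [lintegral_finsetSum _ fun z _ => hm w z]
    calc _ ≤ ∑ z ∈ belowNeighbors a b w,
          ENNReal.ofReal (aPriori K s lam) * ‖green g lam η b ζ y w‖ₑ ^ s := by
          refine Finset.sum_le_sum fun z hz => ?_
          -- The resolvent of H_b does not see the potential at u and leaves the integral over t; z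
          -- starts at b - 1 = u, as does x, so the a priori bound applies to the other factor.
          simp only [green_update_of_lt g lam η hub]
          rw [lintegral_const_mul' _ _ (ENNReal.rpow_ne_top_of_nonneg hs0.le enorm_ne_top), mul_comm]
          refine mul_le_mul_left ?_ _
          have hz' := Finset.mem_filter.1 hz
          have hz0 := (pos_of_dist₁_eq_one hz'.2.1 hw'.ge hz'.2.2.2).2.1
          exact lintegral_update_green_le hK hν hs0 hs1 hlam η (by rw [← hux]; exact hax) hζ hux
            (by rw [hz0, hb, ← hux]; ring)
      _ = (belowNeighbors a b w).card *
          (ENNReal.ofReal (aPriori K s lam) * ‖green g lam η b ζ y w‖ₑ ^ s) := by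
          rw [Finset.sum_const, nsmul_eq_mul]
      _ ≤ 1 * (ENNReal.ofReal (aPriori K s lam) * ‖green g lam η b ζ y w‖ₑ ^ s) := by
          gcongr
          exact_mod_cast card_belowNeighbors_le a hw'.ge
      _ = _ := one_mul _
  refine (lintegral_mono hinner).trans (le_of_eq ?_)
  rw [lintegral_finsetSum _ fun w _ => (hmeas b y w).const_mul _, Finset.mul_sum]
  exact Finset.sum_congr rfl fun w _ => lintegral_const_mul _ (hmeas b y w)

open scoped Classical in
/-- Summation over the intermediate configurations in one decoupling step. -/
theorem sum_sum_exp_le {κ κ₁ κ₂ μ' : ℝ} (hκ₂ : 0 < κ₂) (hμ' : 0 ≤ μ') (hμκ : μ' < κ₁)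
    (hκ : κ₁ + κ₂ ≤ κ) (b c : ℤ) :
    ∑ w : Config L n with pos w 0 = b, ∑ v : Config L n with IsClustered v ∧ b ≤ pos v 0,
      Real.exp (-κ * dist₁ w v) * Real.exp (-μ' * |pos v 0 - c|)
      ≤ clusterSum κ₂ * expSum (κ₁ - μ') * Real.exp (-μ' * (c - b)) := by
  calc _ ≤ ∑ w : Config L n with pos w 0 = b, ∑ v : Config L n with IsClustered v,
        Real.exp (-κ₂ * dist₁ w v) *
          (Real.exp (-(κ₁ - μ') * |pos v 0 - b|) * Real.exp (-μ' * (c - b))) := by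
        refine Finset.sum_le_sum fun w hw => ?_
        have hw' : pos w 0 = b := (Finset.mem_filter.1 hw).2
        refine le_trans (Finset.sum_le_sum fun v _ => ?_) (Finset.sum_le_sum_of_subset_of_nonneg
          (fun v hv => ?_) fun v _ _ => by positivity)
        · rw [← Real.exp_add, ← Real.exp_add, ← Real.exp_add]
          refine Real.exp_le_exp.2 ?_
          -- The decay κ is split: κ₂ pays for summing over w, while κ₁ pays, through |v₀ - b| ≤
          -- d(w, v), for transporting the rate μ' from v₀ to b and for summing over v.
          have h1 : (|pos v 0 - b| : ℝ) ≤ dist₁ w v := by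
            have := abs_pos_sub_le_dist₁ w v 0
            rw [hw', abs_sub_comm] at this
            exact_mod_cast this
          have h2 : ((c : ℝ) - b) ≤ |(pos v 0 : ℝ) - b| + |(pos v 0 : ℝ) - c| := by
            have := abs_sub_le (c : ℝ) (pos v 0) b
            rw [abs_sub_comm (c : ℝ) (pos v 0)] at this
            linarith [le_abs_self ((c : ℝ) - b)]
          have h3 := abs_nonneg ((pos v 0 : ℝ) - b)
          push_cast
          have h4 : (κ₁ + κ₂) * (dist₁ w v : ℝ) ≤ κ * dist₁ w v :=
            mul_le_mul_of_nonneg_right hκ (by exact_mod_cast dist₁_nonneg w v)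
          have h5 : κ₁ * |(pos v 0 : ℝ) - b| ≤ κ₁ * dist₁ w v :=
            mul_le_mul_of_nonneg_left h1 (by linarith)
          have h6 := mul_le_mul_of_nonneg_left h2 hμ'
          linarith
        · simp only [Finset.mem_filter] at hv ⊢
          exact ⟨hv.1, hv.2.1⟩
    _ ≤ ∑ v : Config L n with IsClustered v, ∑ w : Config L n, Real.exp (-κ₂ * dist₁ w v) *
          (Real.exp (-(κ₁ - μ') * |pos v 0 - b|) * Real.exp (-μ' * (c - b))) := by
        rw [Finset.sum_comm]
        refine Finset.sum_le_sum fun v _ => ?_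
        exact Finset.sum_le_sum_of_subset_of_nonneg (Finset.filter_subset _ _)
          fun _ _ _ => by positivity
    _ ≤ ∑ v : Config L n with IsClustered v, clusterSum κ₂ *
          (Real.exp (-(κ₁ - μ') * |pos v 0 - b|) * Real.exp (-μ' * (c - b))) := by
        refine Finset.sum_le_sum fun v hv => ?_
        rw [← Finset.sum_mul]
        exact mul_le_mul_of_nonneg_right (sum_exp_dist₁_le hκ₂ (Finset.mem_filter.1 hv).2)
          (by positivity)
    _ = clusterSum κ₂ * Real.exp (-μ' * (c - b)) *
          ∑ v : Config L n with IsClustered v, Real.exp (-(κ₁ - μ') * |pos v 0 - b|) := by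
        rw [Finset.mul_sum]
        exact Finset.sum_congr rfl fun v _ => by ring
    _ ≤ clusterSum κ₂ * Real.exp (-μ' * (c - b)) * expSum (κ₁ - μ') := by
        refine mul_le_mul_of_nonneg_left ?_ (mul_nonneg (clusterSum_pos _).le (Real.exp_pos _).le)
        exact_mod_cast sum_clustered_exp_le (by linarith) b
    _ = _ := by ring

/-- Converts a bound D for moments between clustered configurations into one for the boundary sum
produced by decoupling, at the cost of a constant independent of n, L and lam. -/
theorem sum_lintegral_green_le {ν : Measure ℝ} [IsProbabilityMeasure ν]
    (hν0 : ∀ᵐ t ∂ν, 0 ≤ t) {s : ℝ} (hs0 : 0 < s) (hs1 : s < 1) {g lam μT κ₁ κ₂ μ' : ℝ}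
    (hlam : 0 ≤ lam) (hμT : 0 < μT) (hκ₂ : 0 < κ₂) (hμ' : 0 ≤ μ') (hμκ : μ' < κ₁)
    (hκ : κ₁ + κ₂ ≤ s * μT) {b : ℤ} {ζ : ℂ} (h0 : 0 ≤ ζ.re) (hthr : ζ.re < threshold g μT)
    {y : Config L n} (hy : IsClustered y) (hyb : b ≤ pos y 0) {D : ℝ≥0∞}
    (hD : ∀ v : Config L n, IsClustered v → b ≤ pos v 0 →
      ∫⁻ η, ‖green g lam η b ζ v y‖ₑ ^ s ∂(Measure.pi fun _ : Site L => ν)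
        ≤ D * ENNReal.ofReal (Real.exp (-μ' * |pos v 0 - pos y 0|))) :
    ∑ w : Config L n with pos w 0 = b,
        ∫⁻ η, ‖green g lam η b ζ y w‖ₑ ^ s ∂(Measure.pi fun _ : Site L => ν)
      ≤ D * ENNReal.ofReal
        (clusterSum κ₂ * expSum (κ₁ - μ') * Real.exp (-μ' * (pos y 0 - b))) := by
  classical
  have hmeas : ∀ v : Config L n, Measurable fun η : Site L → ℝ => ‖green g lam η b ζ v y‖ₑ ^ s :=
    fun v => (measurable_green g lam b ζ v y).enorm.pow_const s
  calc _ ≤ ∑ w : Config L n with pos w 0 = b,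
        ∑ v : Config L n with IsClustered v ∧ b ≤ pos v 0,
          D * ENNReal.ofReal (Real.exp (-(s * μT) * dist₁ w v) *
            Real.exp (-μ' * |pos v 0 - pos y 0|)) := by
        refine Finset.sum_le_sum fun w _ => ?_
        calc _ ≤ ∫⁻ η, ∑ v : Config L n with IsClustered v ∧ b ≤ pos v 0,
              ENNReal.ofReal (Real.exp (-(s * μT) * dist₁ w v)) *
                ‖green g lam η b ζ v y‖ₑ ^ s ∂(Measure.pi fun _ : Site L => ν) := by
              refine lintegral_mono_ae ?_
              filter_upwards [ae_pi_nonneg (S := Site L) hν0] with η hη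
              rw [green_symm]
              exact norm_green_le_sum_clustered hμT hlam hη h0 hthr hy hyb hs0 hs1.le w
          _ = ∑ v : Config L n with IsClustered v ∧ b ≤ pos v 0,
              ENNReal.ofReal (Real.exp (-(s * μT) * dist₁ w v)) *
                ∫⁻ η, ‖green g lam η b ζ v y‖ₑ ^ s ∂(Measure.pi fun _ : Site L => ν) := by
              rw [lintegral_finsetSum _ fun v _ => (hmeas v).const_mul _]
              exact Finset.sum_congr rfl fun v _ => lintegral_const_mul _ (hmeas v)
          _ ≤ _ := by
              refine Finset.sum_le_sum fun v hv => ?_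
              obtain ⟨-, hv1, hv2⟩ := Finset.mem_filter.1 hv
              rw [ENNReal.ofReal_mul (Real.exp_pos _).le, mul_left_comm]
              exact mul_le_mul_right (hD v hv1 hv2) _
    _ = D * ENNReal.ofReal (∑ w : Config L n with pos w 0 = b,
          ∑ v : Config L n with IsClustered v ∧ b ≤ pos v 0,
          Real.exp (-(s * μT) * dist₁ w v) * Real.exp (-μ' * |pos v 0 - pos y 0|)) := by
        rw [ENNReal.ofReal_sum_of_nonneg fun w _ => Finset.sum_nonneg fun v _ => by positivity,
          Finset.mul_sum]
        refine Finset.sum_congr rfl fun w _ => ?_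
        rw [ENNReal.ofReal_sum_of_nonneg fun v _ => by positivity, Finset.mul_sum]
    _ ≤ _ := by
        refine mul_le_mul_right (ENNReal.ofReal_le_ofReal ?_) _
        exact sum_sum_exp_le hκ₂ hμ' hμκ hκ b (pos y 0)

theorem aPriori_pos {K s lam : ℝ} (hK : 0 < K) (hs0 : 0 < s) (hs1 : s < 1) (hlam : 0 < lam) :
    0 < aPriori K s lam := by
  have hpi := Real.pi_pos
  have hcos : 0 < Real.cos (Real.pi * s / 2) :=
    Real.cos_pos_of_mem_Ioo ⟨by nlinarith, by nlinarith⟩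
  unfold aPriori
  positivity

/-- Exponential decay of fractional moments of the resolvent between clustered configurations, off
the real axis. -/
theorem lintegral_green_le_of_im_pos {K : ℝ} (hK : 0 < K) {ν : Measure ℝ} [IsProbabilityMeasure ν]
    (hν : ∀ g : ℝ → ℝ≥0∞, ∫⁻ t, g t ∂ν
        ≤ ENNReal.ofReal K * ∫⁻ t : ℝ, ENNReal.ofReal ((1 + t ^ 2)⁻¹) * g t)
    (hν0 : ∀ᵐ t ∂ν, 0 ≤ t) {s : ℝ} (hs0 : 0 < s) (hs1 : s < 1) {g lam μT κ₁ κ₂ μ' : ℝ}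
    (hlam : 0 < lam) (hμT : 0 < μT) (hκ₂ : 0 < κ₂) (hμ' : 0 ≤ μ') (hμκ : μ' < κ₁)
    (hκ : κ₁ + κ₂ ≤ s * μT)
    (hsmall : aPriori K s lam * (clusterSum κ₂ * expSum (κ₁ - μ') * Real.exp μ') ≤ 1 / 2)
    {ζ : ℂ} (hζ : 0 < ζ.im) (h0 : 0 ≤ ζ.re) (hthr : ζ.re < threshold g μT)
    {a : ℤ} {x y : Config L n} (hx : IsClustered x) (hy : IsClustered y) (hax : a ≤ pos x 0)
    (hay : a ≤ pos y 0) :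
    ∫⁻ η, ‖green g lam η a ζ x y‖ₑ ^ s ∂(Measure.pi fun _ : Site L => ν)
      ≤ ENNReal.ofReal (aPriori K s lam) *
        ENNReal.ofReal (Real.exp (-μ' * |pos x 0 - pos y 0|)) := by
  set A := ENNReal.ofReal (aPriori K s lam) with hA
  have hA0 := aPriori_pos hK hs0 hs1 hlam
  -- First sites differ by at most 2L, so the factor exp(2Lμ') turns the crude bound into one of the
  -- desired exponential form.
  set M : ℝ≥0∞ := ENNReal.ofReal (ζ.im⁻¹ ^ s * Real.exp (μ' * (2 * L))) with hM
  -- Bootstrap: each decoupling step halves the bad constant M and leaves A, because (A + M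
  -- 2^(-k))/2 ≤ A + M 2^(-k-1). All half-lines a are treated simultaneously.
  have hind : ∀ k : ℕ, ∀ (a : ℤ) (x y : Config L n), IsClustered x → IsClustered y →
      a ≤ pos x 0 → a ≤ pos y 0 → pos x 0 ≤ pos y 0 →
      ∫⁻ η, ‖green g lam η a ζ x y‖ₑ ^ s ∂(Measure.pi fun _ : Site L => ν)
      ≤ (A + M * ENNReal.ofReal (1 / 2) ^ k) *
        ENNReal.ofReal (Real.exp (-μ' * |pos x 0 - pos y 0|)) := by
    intro k
    induction k with
    | zero =>
      intro a x y _ _ _ _ _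
      rw [pow_zero, mul_one]
      calc _ ≤ ∫⁻ _ : Site L → ℝ, ENNReal.ofReal (ζ.im⁻¹ ^ s)
              ∂(Measure.pi fun _ : Site L => ν) := by
            refine lintegral_mono fun η => ?_
            rw [← ofReal_norm, ENNReal.ofReal_rpow_of_nonneg (norm_nonneg _) hs0.le]
            exact ENNReal.ofReal_le_ofReal (Real.rpow_le_rpow (norm_nonneg _)
              (norm_green_le g lam η a hζ x y) hs0.le)
        _ = ENNReal.ofReal (ζ.im⁻¹ ^ s) := by simp
        _ ≤ M * ENNReal.ofReal (Real.exp (-μ' * |pos x 0 - pos y 0|)) := by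
            rw [hM, ← ENNReal.ofReal_mul (by positivity)]
            refine ENNReal.ofReal_le_ofReal ?_
            rw [mul_assoc, ← Real.exp_add]
            refine le_mul_of_one_le_right (by positivity) (Real.one_le_exp ?_)
            have h1 : (|pos x 0 - pos y 0| : ℝ) ≤ 2 * L := by
              have h2 := pos_mem x 0
              have h3 := pos_mem y 0
              have : |pos x 0 - pos y 0| ≤ 2 * (L : ℤ) := by
                rw [abs_le]; constructor <;> linarith
              exact_mod_cast this
            push_cast
            nlinarith
        _ ≤ _ := by gcongr; exact le_add_self
    | succ k ih =>
      intro a x y hx hy hax hay hxy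
      rcases hxy.eq_or_lt with heq | hlt
      · have hxy' : x = y := eq_of_isClustered hx hy heq
        subst hxy'
        rw [sub_self, abs_zero, Int.cast_zero, mul_zero, Real.exp_zero, ENNReal.ofReal_one, mul_one]
        refine le_trans ?_ le_self_add
        refine (lintegral_le_lintegral_update ν (x 0) _).trans ?_
        calc _ ≤ ∫⁻ _ : Site L → ℝ, A ∂(Measure.pi fun _ : Site L => ν) := by
              refine lintegral_mono fun η => ?_
              exact lintegral_update_green_le hK hν hs0 hs1 hlam η hax hζ rfl rfl
          _ = A := by simp
      · simp only [green_symm g lam _ a ζ x y]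
        refine (lintegral_green_le_sum hK hν hs0 hs1 hlam hζ hax hlt).trans ?_
        have hsum := sum_lintegral_green_le (ν := ν) hν0 hs0 hs1 hlam.le hμT hκ₂ hμ' hμκ hκ
          (b := pos x 0 + 1) h0 hthr hy (by linarith)
          (D := A + M * ENNReal.ofReal (1 / 2) ^ k) (fun v hv hbv => by
            -- The intermediate v may lie beyond y, so the distance need not decrease; the iteration
            -- runs over k, and symmetry of the resolvent covers this case.
            rcases le_total (pos v 0) (pos y 0) with h | h
            · exact ih _ v y hv hy hbv (by linarith) h
            · simp only [green_symm g lam _ _ ζ v y]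
              rw [abs_sub_comm]
              exact ih _ y v hy hv (by linarith) hbv h)
        refine (mul_le_mul_right hsum _).trans ?_
        have hexp : clusterSum κ₂ * expSum (κ₁ - μ') *
              Real.exp (-μ' * (pos y 0 - (pos x 0 + 1 : ℤ)))
            = (clusterSum κ₂ * expSum (κ₁ - μ') * Real.exp μ') *
              Real.exp (-μ' * |pos x 0 - pos y 0|) := by
          rw [mul_assoc _ (Real.exp μ'), ← Real.exp_add]
          congr 2
          have : |(pos x 0 : ℝ) - pos y 0| = pos y 0 - pos x 0 := by
            rw [abs_sub_comm, abs_of_pos]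
            exact sub_pos.2 (by exact_mod_cast hlt)
          push_cast
          rw [this]
          ring
        rw [hexp]
        have hc0 : 0 ≤ clusterSum κ₂ * expSum (κ₁ - μ') * Real.exp μ' :=
          mul_nonneg (mul_nonneg (clusterSum_pos _).le (expSum_pos (by linarith)).le)
            (Real.exp_pos _).le
        rw [ENNReal.ofReal_mul hc0, mul_left_comm, ← mul_assoc A, hA, ← ENNReal.ofReal_mul hA0.le,
          ← mul_assoc, ← hA]
        refine mul_le_mul_left ?_ _
        calc _ ≤ (A + M * ENNReal.ofReal (1 / 2) ^ k) * ENNReal.ofReal (1 / 2) := by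
              gcongr
          _ = A * ENNReal.ofReal (1 / 2) + M * ENNReal.ofReal (1 / 2) ^ (k + 1) := by
              rw [add_mul, pow_succ, mul_assoc M]
          _ ≤ _ := by
              gcongr
              refine mul_le_of_le_one_right' ?_
              rw [← ENNReal.ofReal_one]
              exact ENNReal.ofReal_le_ofReal (by norm_num)
  have hlim : Filter.Tendsto (fun k : ℕ => (A + M * ENNReal.ofReal (1 / 2) ^ k) *
        ENNReal.ofReal (Real.exp (-μ' * |pos x 0 - pos y 0|))) Filter.atTop
      (nhds ((A + M * 0) * ENNReal.ofReal (Real.exp (-μ' * |pos x 0 - pos y 0|)))) := by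
    refine ENNReal.Tendsto.mul_const ?_ (Or.inr ENNReal.ofReal_ne_top)
    refine tendsto_const_nhds.add (ENNReal.Tendsto.const_mul ?_ (Or.inr ENNReal.ofReal_ne_top))
    refine ENNReal.tendsto_pow_atTop_nhds_zero_of_lt_one ?_
    rw [← ENNReal.ofReal_one]
    exact (ENNReal.ofReal_lt_ofReal_iff one_pos).2 (by norm_num)
  rw [mul_zero, add_zero] at hlim
  refine ge_of_tendsto' hlim fun k => ?_
  rcases le_total (pos x 0) (pos y 0) with h | h
  · exact hind k a x y hx hy hax hay h
  · simp only [green_symm g lam _ a ζ x y]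
    rw [abs_sub_comm]
    exact hind k a y x hy hx hay hax h

/-- Exponential decay of fractional moments of the resolvent at real energies. -/
theorem lintegral_green_le {K : ℝ} (hK : 0 < K) {ν : Measure ℝ} [IsProbabilityMeasure ν]
    (hν : ∀ g : ℝ → ℝ≥0∞, ∫⁻ t, g t ∂ν
        ≤ ENNReal.ofReal K * ∫⁻ t : ℝ, ENNReal.ofReal ((1 + t ^ 2)⁻¹) * g t)
    (hν0 : ∀ᵐ t ∂ν, 0 ≤ t) {s : ℝ} (hs0 : 0 < s) (hs1 : s < 1) {g lam μT κ₁ κ₂ μ' : ℝ}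
    (hlam : 0 < lam) (hμT : 0 < μT) (hκ₂ : 0 < κ₂) (hμ' : 0 ≤ μ') (hμκ : μ' < κ₁)
    (hκ : κ₁ + κ₂ ≤ s * μT)
    (hsmall : aPriori K s lam * (clusterSum κ₂ * expSum (κ₁ - μ') * Real.exp μ') ≤ 1 / 2)
    {E : ℝ} (h0 : 0 ≤ E) (hthr : E < threshold g μT)
    {a : ℤ} {x y : Config L n} (hx : IsClustered x) (hy : IsClustered y) (hax : a ≤ pos x 0)
    (hay : a ≤ pos y 0) :
    ∫⁻ η, ‖green g lam η a E x y‖ₑ ^ s ∂(Measure.pi fun _ : Site L => ν)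
      ≤ ENNReal.ofReal (aPriori K s lam) *
        ENNReal.ofReal (Real.exp (-μ' * |pos x 0 - pos y 0|)) := by
  set ζ : ℕ → ℂ := fun k => E + (1 / ((k : ℝ) + 1) : ℝ) * Complex.I with hζ
  have hζim : ∀ k, 0 < (ζ k).im := fun k => by
    have : (ζ k).im = 1 / ((k : ℝ) + 1) := by
      simp only [hζ, Complex.add_im, Complex.ofReal_im, Complex.im_ofReal_mul, Complex.I_im]
      ring
    rw [this]; positivity
  have hζre : ∀ k, (ζ k).re = E := fun k => by
    simp only [hζ, Complex.add_re, Complex.ofReal_re, Complex.re_ofReal_mul, Complex.I_re]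
    ring
  have hζt : Filter.Tendsto ζ Filter.atTop (nhds (E : ℂ)) := by
    have h1 := (Complex.continuous_ofReal.tendsto _).comp
      (tendsto_one_div_add_atTop_nhds_zero_nat (𝕜 := ℝ))
    have h2 := (h1.mul_const Complex.I).const_add (E : ℂ)
    simpa [hζ] using h2
  calc _ ≤ ∫⁻ η, Filter.liminf (fun k => ‖green g lam η a (ζ k) x y‖ₑ ^ s) Filter.atTop
          ∂(Measure.pi fun _ : Site L => ν) := by
        refine lintegral_mono fun η => ?_
        -- At a singular energy the matrix inverse is zero by convention and the bound is trivial;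
        -- otherwise the resolvent is continuous at E and Fatou's lemma applies.
        by_cases hdet : (halfHamiltonian (n := n) g lam η a - (E : ℂ) • 1).det = 0
        · simp only [green_eq_zero_of_det hdet]
          simp [hs0]
        · refine le_of_eq (Filter.Tendsto.liminf_eq ?_).symm
          have hd : DifferentiableAt ℂ (fun z => green g lam η a z x y) (E : ℂ) :=
            differentiableAt_inv (M := fun z => halfHamiltonian (n := n) g lam η a - z • 1)
              (fun i j => by
                simp only [Matrix.sub_apply, Matrix.smul_apply]
                fun_prop) hdet x y
          exact (ENNReal.continuous_rpow_const.tendsto _).comp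
            ((continuous_enorm.tendsto _).comp (hd.continuousAt.tendsto.comp hζt))
    _ ≤ Filter.liminf (fun k => ∫⁻ η, ‖green g lam η a (ζ k) x y‖ₑ ^ s
          ∂(Measure.pi fun _ : Site L => ν)) Filter.atTop :=
        lintegral_liminf_le fun k => (measurable_green g lam a _ x y).enorm.pow_const s
    _ ≤ _ := by
        refine (Filter.liminf_le_liminf (Filter.Eventually.of_forall fun k => ?_)).trans_eq
          (Filter.liminf_const _)
        exact lintegral_green_le_of_im_pos hK hν hν0 hs0 hs1 hlam hμT hκ₂ hμ' hμκ hκ hsmall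
          (hζim k) (by rw [hζre]; exact h0) (by rw [hζre]; exact hthr) hx hy hax hay

end FractionalMoments

end

end HardCore

namespace HardCore

noncomputable section

open scoped Matrix

/-! ### The eigenfunction correlator -/

section Interpolation

variable {ι : Type} [Fintype ι] [DecidableEq ι]

/-- Both factors are at most powers of the sum of the weights, with exponents s and 1 - s adding to
1. The mixed quantity thereby becomes two spectral measures, each accessible to averaging. -/
theorem norm_spectralEntry_rpow_mul_le (H : Matrix ι ι ℂ) (E : ℝ) (x z : ι) {s : ℝ} (hs0 : 0 < s)
    (hs1 : s < 1) :
    ‖spectralEntry H E z x‖ₑ ^ s * ENNReal.ofReal (spectralWeight H E x) ^ (1 - s)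
      ≤ ENNReal.ofReal (spectralWeight H E x) + ENNReal.ofReal (spectralWeight H E z) := by
  have hx := spectralWeight_nonneg H E x
  have hz := spectralWeight_nonneg H E z
  rw [← ENNReal.ofReal_add hx hz, ← ofReal_norm]
  set m := spectralWeight H E x + spectralWeight H E z with hm
  have h1 : ‖spectralEntry H E z x‖ ≤ m := by
    refine le_of_sq_le_sq ?_ (by positivity)
    have := norm_spectralEntry_sq_le H E z x
    nlinarith
  calc _ ≤ ENNReal.ofReal m ^ s * ENNReal.ofReal m ^ (1 - s) := by
        gcongr
        linarith
    _ = ENNReal.ofReal m := by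
        rw [← ENNReal.rpow_add_of_nonneg _ _ hs0.le (by linarith)]
        simp

/-- Interpolation between the eigenfunction correlator and its fractional version. -/
theorem correlator_rpow_le {H : Matrix ι ι ℂ} (hH : H.IsHermitian) (I : Set ℝ) (x y : ι) {s : ℝ}
    (hs0 : 0 < s) (hs1 : s < 1) :
    ENNReal.ofReal (correlator H I x y) ^ (2 - s) ≤ ∑ E ∈ realSpectrum H, I.indicator
      (fun E => ‖spectralEntry H E x y‖ₑ ^ s *
        ENNReal.ofReal (spectralWeight H E x) ^ (1 - s)) E := by
  have hp1 : 1 < 2 - s := by linarith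
  -- From |P|² ≤ P(x,x)P(y,y) follows |P|^(2-s) ≤ |P|^s P(x,x)^(1-s) P(y,y)^(1-s). With these
  -- exponents the y-weights enter Hölder's inequality to the power 1 and sum to 1.
  have hpq : (2 - s).HolderConjugate ((2 - s) / (1 - s)) := by
    rw [Real.holderConjugate_iff]
    refine ⟨hp1, ?_⟩
    have h1 : 2 - s ≠ 0 := by linarith
    have h2 : 1 - s ≠ 0 := by linarith
    field_simp
    ring
  set p := 2 - s with hp
  set q := (2 - s) / (1 - s) with hq
  have hp0 : 0 < p := by linarith
  have hq0 : 0 < q := hpq.symm.pos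
  set F : ℝ → ℝ≥0∞ := fun E => I.indicator (fun E => ‖spectralEntry H E x y‖ₑ ^ s *
        ENNReal.ofReal (spectralWeight H E x) ^ (1 - s)) E with hF
  have hterm : ∀ E, ENNReal.ofReal (I.indicator (fun E => ‖spectralEntry H E x y‖) E)
      ≤ F E ^ (1 / p) * ENNReal.ofReal (spectralWeight H E y) ^ (1 / q) := by
    intro E
    by_cases hE : E ∈ I
    · simp only [hF, Set.indicator_of_mem hE, ofReal_norm]
      have h1 : ‖spectralEntry H E x y‖ₑ ^ (2 : ℝ) ≤ ENNReal.ofReal (spectralWeight H E x) *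
          ENNReal.ofReal (spectralWeight H E y) := by
        rw [← ENNReal.ofReal_mul (spectralWeight_nonneg _ _ _), ← ofReal_norm,
          ENNReal.ofReal_rpow_of_nonneg (norm_nonneg _) (by norm_num)]
        refine ENNReal.ofReal_le_ofReal ?_
        have := norm_spectralEntry_sq_le H E x y
        exact_mod_cast this
      have hq' : 1 / q = (1 - s) * (1 / p) := by rw [hq, hp, one_div_div]; ring
      rw [hq', ENNReal.rpow_mul, ← ENNReal.mul_rpow_of_nonneg _ _ (by positivity),
        one_div, ENNReal.le_rpow_inv_iff hp0]
      calc ‖spectralEntry H E x y‖ₑ ^ p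
          = ‖spectralEntry H E x y‖ₑ ^ s * (‖spectralEntry H E x y‖ₑ ^ (2 : ℝ)) ^ (1 - s) := by
            rw [← ENNReal.rpow_mul, ← ENNReal.rpow_add_of_nonneg _ _ hs0.le (by linarith)]
            congr 1
            rw [hp]; ring
        _ ≤ ‖spectralEntry H E x y‖ₑ ^ s * (ENNReal.ofReal (spectralWeight H E x) *
            ENNReal.ofReal (spectralWeight H E y)) ^ (1 - s) := by
            gcongr
        _ = _ := by rw [ENNReal.mul_rpow_of_nonneg _ _ (by linarith), mul_assoc]
    · simp only [Set.indicator_of_notMem hE, ENNReal.ofReal_zero]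
      exact zero_le
  have hsum : ENNReal.ofReal (correlator H I x y) ≤ (∑ E ∈ realSpectrum H, F E) ^ (1 / p) := by
    rw [correlator_eq, ENNReal.ofReal_sum_of_nonneg fun E _ =>
      Set.indicator_nonneg (fun _ _ => norm_nonneg _) E]
    refine (Finset.sum_le_sum fun E _ => hterm E).trans ?_
    refine (ENNReal.inner_le_Lp_mul_Lq _ _ _ hpq).trans ?_
    simp only [← ENNReal.rpow_mul, one_div, inv_mul_cancel₀ hp0.ne', inv_mul_cancel₀ hq0.ne',
      ENNReal.rpow_one]
    rw [← ENNReal.ofReal_sum_of_nonneg fun E _ => spectralWeight_nonneg H E y,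
      sum_spectralWeight hH, ENNReal.ofReal_one, ENNReal.one_rpow, mul_one]
  rw [one_div] at hsum
  exact (ENNReal.le_rpow_inv_iff hp0).1 hsum

end Interpolation

/-! ### The correlator reduced to half-line fractional moments -/

section Correlator

variable {L n : ℕ} [NeZero n]

theorem measurableEntries_hamiltonian (g lam : ℝ) :
    MeasurableEntries fun η : Site L → ℝ => hamiltonian n g lam η := by
  simp only [← halfHamiltonian_eq]
  exact measurableEntries_halfHamiltonian g lam _

theorem isHermitian_hamiltonian (g lam : ℝ) (η : Site L → ℝ) :
    (hamiltonian n g lam η).IsHermitian := by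
  rw [← halfHamiltonian_eq]
  exact isHermitian_halfHamiltonian g lam η _

/-- The energies at which the half-line resolvent is not defined. -/
def singularEnergies (n : ℕ) [NeZero n] (g lam : ℝ) (η : Site L → ℝ) (b : ℤ) : Set ℝ :=
  {E | (halfHamiltonian (n := n) g lam η b - (E : ℂ) • 1).det = 0}

theorem singularEnergies_subset (g lam : ℝ) (η : Site L → ℝ) (b : ℤ) :
    singularEnergies n g lam η b ⊆ realSpectrum (halfHamiltonian (n := n) g lam η b) := by
  intro E hE
  rw [realSpectrum, Set.Finite.coe_toFinset, ← spectrum.algebraMap_mem_iff ℂ, spectrum.mem_iff,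
    Matrix.isUnit_iff_isUnit_det, isUnit_iff_ne_zero, not_not, ← neg_sub, Matrix.det_neg]
  have : (halfHamiltonian (n := n) g lam η b - (E : ℂ) • 1).det = 0 := hE
  rw [Algebra.algebraMap_eq_smul_one]
  simp only [Complex.coe_algebraMap]
  rw [this, mul_zero]

theorem volume_singularEnergies (g lam : ℝ) (η : Site L → ℝ) (b : ℤ) :
    volume (singularEnergies n g lam η b) = 0 :=
  measure_mono_null (singularEnergies_subset g lam η b) (Finset.measure_zero _ _)

theorem measurableSet_singularEnergies (g lam : ℝ) (η : Site L → ℝ) (b : ℤ) :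
    MeasurableSet (singularEnergies n g lam η b) :=
  ((Finset.finite_toSet _).subset (singularEnergies_subset g lam η b)).measurableSet

theorem measurable_green_prod (g lam : ℝ) (b : ℤ) (x y : Config L n) :
    Measurable fun p : (Site L → ℝ) × ℝ => green g lam p.1 b (p.2 : ℂ) x y := by
  refine MeasurableEntries.inv (M := fun p : (Site L → ℝ) × ℝ =>
    halfHamiltonian g lam p.1 b - (p.2 : ℂ) • (1 : Matrix (Config L n) (Config L n) ℂ))
    (fun i j => ?_) x y
  simp only [Matrix.sub_apply, Matrix.smul_apply]
  have h : Measurable fun p : (Site L → ℝ) × ℝ => halfHamiltonian (n := n) g lam p.1 b i j :=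
    (measurableEntries_halfHamiltonian g lam b i j).comp measurable_fst
  exact h.sub ((Complex.measurable_ofReal.comp measurable_snd).smul_const _)

/-- The fractional moment integrand of the half-line resolvent, restricted to `I`. -/
def greenWeight (g lam : ℝ) (η : Site L → ℝ) (b : ℤ) (I : Set ℝ) (s : ℝ) (y w : Config L n)
    (E : ℝ) : ℝ≥0∞ :=
  I.indicator (fun E => ‖green g lam η b (E : ℂ) y w‖ₑ ^ s) E

theorem measurable_greenWeight (g lam : ℝ) (η : Site L → ℝ) (b : ℤ) {I : Set ℝ}
    (hI : MeasurableSet I) (s : ℝ) (y w : Config L n) :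
    Measurable (greenWeight g lam η b I s y w) := by
  refine Measurable.indicator ?_ hI
  exact (((measurable_green_prod g lam b y w).comp
    (measurable_const.prodMk measurable_id)).enorm.pow_const s)

/-- A pointwise bound of the eigenfunction correlator by spectral measures at configurations that
occupy a common site. -/
theorem correlator_rpow_le_lintegral (g lam : ℝ) (η : Site L → ℝ) (I : Set ℝ)
    {x y : Config L n} (hxy : pos x 0 < pos y 0) {s : ℝ} (hs0 : 0 < s) (hs1 : s < 1) :
    ENNReal.ofReal (correlator (hamiltonian n g lam η) I x y) ^ (2 - s)
      ≤ (∑ w : Config L n with pos w 0 = pos x 0 + 1,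
          ∑ z ∈ belowNeighbors (-(L : ℤ)) (pos x 0 + 1) w,
          (∫⁻ E, greenWeight g lam η (pos x 0 + 1) I s y w E
              ∂spectralMeasure (hamiltonian n g lam η) x +
            ∫⁻ E, greenWeight g lam η (pos x 0 + 1) I s y w E
              ∂spectralMeasure (hamiltonian n g lam η) z)) +
        ∫⁻ E, (singularEnergies n g lam η (pos x 0 + 1)).indicator (fun _ => ∞) E
          ∂spectralMeasure (hamiltonian n g lam η) x := by
  set b := pos x 0 + 1 with hb
  set H := hamiltonian n g lam η with hHdef
  have hLb : -(L : ℤ) ≤ b := by linarith [(pos_mem x 0).1]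
  refine (correlator_rpow_le (isHermitian_hamiltonian g lam η) I x y hs0 hs1).trans ?_
  simp only [lintegral_spectralMeasure, ← Finset.sum_add_distrib]
  have hcomm : ∀ (f : Config L n → Config L n → ℝ → ℝ≥0∞),
      ∑ w : Config L n with pos w 0 = b, ∑ z ∈ belowNeighbors (-(L : ℤ)) b w,
        ∑ E ∈ realSpectrum H, f w z E
      = ∑ E ∈ realSpectrum H, ∑ w : Config L n with pos w 0 = b,
        ∑ z ∈ belowNeighbors (-(L : ℤ)) b w, f w z E := by
    intro f
    rw [Finset.sum_comm]
    refine Finset.sum_congr rfl fun w _ => ?_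
    rw [Finset.sum_comm]
  rw [hcomm, ← Finset.sum_add_distrib]
  refine Finset.sum_le_sum fun E _ => ?_
  by_cases hEI : E ∈ I
  swap
  · rw [Set.indicator_of_notMem hEI]; exact zero_le
  rw [Set.indicator_of_mem hEI]
  -- Decoupling fails if E also belongs to the half-line spectrum. Such energies are charged an
  -- infinite penalty, harmless because they form a null set after averaging.
  by_cases hE : E ∈ singularEnergies n g lam η b
  · rw [Set.indicator_of_mem hE]
    refine le_trans ?_ le_add_self
    by_cases hw : spectralWeight H E x = 0
    · have h1 := norm_spectralEntry_sq_le H E x y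
      rw [hw, zero_mul] at h1
      have h2 : spectralEntry H E x y = 0 := by
        rw [← norm_eq_zero]
        exact pow_eq_zero_iff two_ne_zero |>.1 (le_antisymm h1 (sq_nonneg _))
      change ‖spectralEntry H E x y‖ₑ ^ s * _ ≤ _
      rw [h2, enorm_zero, ENNReal.zero_rpow_of_pos hs0, zero_mul]
      exact zero_le
    · have hpos : 0 < spectralWeight H E x :=
        lt_of_le_of_ne (spectralWeight_nonneg H E x) (Ne.symm hw)
      rw [ENNReal.mul_top (by simpa using hpos)]
      exact le_top
  · refine le_trans ?_ le_self_add
    have h1 := enorm_rpow_le_sum_green hLb (ζ := (E : ℂ)) (g := g) (lam := lam) (η := η) hE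
      (ψ := fun z => spectralEntry H E z x) (fun w _ => by
        have := congrFun (mulVec_spectralEntry H E x) w
        rw [halfHamiltonian_eq]
        exact this) (y := y) (by linarith) hs0 hs1.le
    have hsymm : ‖spectralEntry H E x y‖ₑ = ‖spectralEntry H E y x‖ₑ := by
      rw [← ofReal_norm, ← ofReal_norm, spectralEntry_symm]
    rw [hsymm]
    refine (mul_le_mul_left h1 _).trans ?_
    rw [Finset.sum_mul]
    refine Finset.sum_le_sum fun w _ => ?_
    rw [Finset.sum_mul]
    refine Finset.sum_le_sum fun z _ => ?_
    rw [greenWeight, Set.indicator_of_mem hEI, ← add_mul, mul_comm (_ + _), mul_assoc]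
    exact mul_le_mul_right (norm_spectralEntry_rpow_mul_le H E x z hs0 hs1) _

/-- The averaged correlator is bounded by fractional moments of the half-line resolvent. -/
theorem lintegral_correlator_rpow_le {K : ℝ} (hK : 0 < K) {ν : Measure ℝ} [IsProbabilityMeasure ν]
    (hν : ∀ g : ℝ → ℝ≥0∞, ∫⁻ t, g t ∂ν
        ≤ ENNReal.ofReal K * ∫⁻ t : ℝ, ENNReal.ofReal ((1 + t ^ 2)⁻¹) * g t)
    {s : ℝ} (hs0 : 0 < s) (hs1 : s < 1) {g lam : ℝ} (hlam : 0 < lam) {I : Set ℝ}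
    (hI : MeasurableSet I) {x y : Config L n} (hxy : pos x 0 < pos y 0) :
    ∫⁻ η, ENNReal.ofReal (correlator (hamiltonian n g lam η) I x y) ^ (2 - s)
        ∂(Measure.pi fun _ : Site L => ν)
      ≤ ENNReal.ofReal (2 * (K * Real.pi / lam)) * ∫⁻ E in I,
        ∑ w : Config L n with pos w 0 = pos x 0 + 1,
          ∫⁻ η, ‖green g lam η (pos x 0 + 1) (E : ℂ) y w‖ₑ ^ s
            ∂(Measure.pi fun _ : Site L => ν) := by
  set b := pos x 0 + 1 with hb
  set u : Site L := x 0 with hu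
  have hux : pos x 0 = u := rfl
  have hub : (u : ℤ) < b := by rw [← hux]; linarith
  have hLu : -(L : ℤ) ≤ u := (Finset.mem_Icc.1 u.2).1
  have hpi := Real.pi_pos
  set c := ENNReal.ofReal (K * Real.pi / lam) with hc
  refine (lintegral_mono fun η => correlator_rpow_le_lintegral g lam η I hxy hs0 hs1).trans ?_
  refine (lintegral_le_lintegral_update ν u _).trans ?_
  rw [← hb]
  have hGW : ∀ (η : Site L → ℝ) (t : ℝ) (w : Config L n),
      greenWeight g lam (Function.update η u t) b I s y w = greenWeight g lam η b I s y w := by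
    intro η t w
    funext E
    simp only [greenWeight, green_update_of_lt g lam η hub]
  have hSE : ∀ (η : Site L → ℝ) (t : ℝ),
      singularEnergies n g lam (Function.update η u t) b = singularEnergies n g lam η b := by
    intro η t
    simp only [singularEnergies, halfHamiltonian_update_of_lt g lam η hub]
  have hHu : ∀ (η : Site L → ℝ) (t : ℝ), hamiltonian n g lam (Function.update η u t)
      = perturbed (halfHamiltonian g lam (Function.update η u 0) (-(L : ℤ)))
        (occupation (-(L : ℤ)) u) lam t := by
    intro η t
    rw [← halfHamiltonian_eq, halfHamiltonian_update]
  have havg : ∀ (η : Site L → ℝ) (z : Config L n), pos z 0 = u → ∀ f : ℝ → ℝ≥0∞, Measurable f →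
      ∫⁻ t, ∫⁻ E, f E ∂spectralMeasure (hamiltonian n g lam (Function.update η u t)) z ∂ν
        ≤ c * ∫⁻ E, f E := by
    intro η z hz f hf
    simp only [hHu]
    exact lintegral_spectralMeasure_perturbed_le (isHermitian_halfHamiltonian _ _ _ _)
      (occupation_nonneg _ u) hlam hK hν (occupation_eq_one hLu hz) hf
  have hmeas : ∀ (η : Site L → ℝ) (z : Config L n) (f : ℝ → ℝ≥0∞), Measurable f →
      Measurable fun t =>
        ∫⁻ E, f E ∂spectralMeasure (hamiltonian n g lam (Function.update η u t)) z := by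
    intro η z f hf
    refine (Measure.measurable_lintegral hf).comp (measurable_spectralMeasure
      (fun i j => ?_) (fun t => isHermitian_hamiltonian g lam _) z)
    exact (measurableEntries_hamiltonian g lam i j).comp (measurable_update η)
  calc _ ≤ ∫⁻ η, (∑ w : Config L n with pos w 0 = b, ENNReal.ofReal (2 * (K * Real.pi / lam)) *
          ∫⁻ E, greenWeight g lam η b I s y w E) ∂(Measure.pi fun _ : Site L => ν) := by
        refine lintegral_mono fun η => ?_
        simp only [hGW, hSE]
        have hmG := fun w => measurable_greenWeight g lam η b hI s y w
        have hmS : Measurable ((singularEnergies n g lam η b).indicator fun _ => (∞ : ℝ≥0∞)) :=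
          measurable_const.indicator (measurableSet_singularEnergies g lam η b)
        rw [lintegral_add_right _ (hmeas η x _ hmS)]
        -- The singular energies of H_b do not depend on the resampled potential, so they are a
        -- fixed finite set, of measure zero for the averaged spectral measure.
        have hsing : ∫⁻ t, ∫⁻ E, (singularEnergies n g lam η b).indicator (fun _ => ∞) E
            ∂spectralMeasure (hamiltonian n g lam (Function.update η u t)) x ∂ν ≤ 0 := by
          refine (havg η x hux _ hmS).trans ?_
          rw [lintegral_indicator (measurableSet_singularEnergies g lam η b), setLIntegral_const,
            volume_singularEnergies]
          simp
        refine (add_le_add_right hsing _).trans ?_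
        have hm2 : ∀ w z : Config L n, Measurable fun t =>
            ∫⁻ E, greenWeight g lam η b I s y w E
                ∂spectralMeasure (hamiltonian n g lam (Function.update η u t)) x +
              ∫⁻ E, greenWeight g lam η b I s y w E
                ∂spectralMeasure (hamiltonian n g lam (Function.update η u t)) z := fun w z =>
          (hmeas η x _ (hmG w)).add (hmeas η z _ (hmG w))
        rw [add_zero, lintegral_finsetSum _ fun w _ => Finset.measurable_fun_sum _ fun z _ =>
          hm2 w z]
        refine Finset.sum_le_sum fun w hw => ?_
        have hw' : pos w 0 = b := (Finset.mem_filter.1 hw).2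
        rw [lintegral_finsetSum _ fun z _ => hm2 w z]
        have h2c : ENNReal.ofReal (2 * (K * Real.pi / lam)) = c + c := by
          rw [hc, ← ENNReal.ofReal_add (by positivity) (by positivity)]
          congr 1
          ring
        calc _ ≤ ∑ z ∈ belowNeighbors (-(L : ℤ)) b w, ENNReal.ofReal (2 * (K * Real.pi / lam)) *
              ∫⁻ E, greenWeight g lam η b I s y w E := by
              refine Finset.sum_le_sum fun z hz => ?_
              have hz' := Finset.mem_filter.1 hz
              have hz0 := (pos_of_dist₁_eq_one hz'.2.1 hw'.ge hz'.2.2.2).2.1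
              rw [lintegral_add_left (hmeas η x _ (hmG w)), h2c, add_mul]
              exact add_le_add (havg η x hux _ (hmG w))
                (havg η z (by rw [hz0, hb, ← hux]; ring) _ (hmG w))
          _ = (belowNeighbors (-(L : ℤ)) b w).card * (ENNReal.ofReal (2 * (K * Real.pi / lam)) *
              ∫⁻ E, greenWeight g lam η b I s y w E) := by rw [Finset.sum_const, nsmul_eq_mul]
          _ ≤ 1 * (ENNReal.ofReal (2 * (K * Real.pi / lam)) *
              ∫⁻ E, greenWeight g lam η b I s y w E) := by
              gcongr
              exact_mod_cast card_belowNeighbors_le (-(L : ℤ)) hw'.ge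
          _ = _ := one_mul _
    _ = _ := by
        have hjoint : ∀ w : Config L n, Measurable fun p : (Site L → ℝ) × ℝ =>
            ‖green g lam p.1 b (p.2 : ℂ) y w‖ₑ ^ s := fun w =>
          (measurable_green_prod g lam b y w).enorm.pow_const s
        have hGWint : ∀ (η : Site L → ℝ) (w : Config L n), ∫⁻ E, greenWeight g lam η b I s y w E
            = ∫⁻ E in I, ‖green g lam η b (E : ℂ) y w‖ₑ ^ s := fun η w => by
          rw [← lintegral_indicator hI]; rfl
        simp only [hGWint]
        rw [lintegral_finsetSum _ fun w _ => (hjoint w).lintegral_prod_right'.const_mul _,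
          lintegral_finsetSum _ fun w _ => (hjoint w).lintegral_prod_left', Finset.mul_sum]
        refine Finset.sum_congr rfl fun w _ => ?_
        rw [lintegral_const_mul _ (hjoint w).lintegral_prod_right']
        congr 1
        exact lintegral_lintegral_swap (hjoint w).aemeasurable

end Correlator

end

end HardCore

namespace HardCore

noncomputable section

open scoped Matrix

/-! ### Localization -/

section Localization

theorem exp_dist₁_le {L n : ℕ} {μ μT : ℝ} (h : μ ≤ μT) (x w : Config L n) :
    Real.exp (-μT * dist₁ x w) ≤ Real.exp (-μ * dist₁ x w) := by
  have : (0 : ℝ) ≤ dist₁ x w := by exact_mod_cast dist₁_nonneg x w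
  exact Real.exp_le_exp.2 (by nlinarith)

variable {L n : ℕ} [NeZero n]

theorem integrable_correlator (π : Measure (Site L → ℝ)) [IsFiniteMeasure π] (g lam : ℝ)
    {I : Set ℝ} (hI : MeasurableSet I) (x y : Config L n) :
    Integrable (fun η => correlator (hamiltonian n g lam η) I x y) π := by
  refine Integrable.of_bound (measurable_correlator (measurableEntries_hamiltonian g lam)
    (isHermitian_hamiltonian g lam) hI x y).aestronglyMeasurable 1
    (Filter.Eventually.of_forall fun η => ?_)
  rw [Real.norm_of_nonneg (correlator_nonneg _ _ _ _)]
  exact correlator_le_one (isHermitian_hamiltonian g lam η) I x y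

open scoped Classical in
/-- At energies below the threshold, the correlator is controlled by clustered configurations. -/
theorem correlator_le_sum_clustered {g lam μT : ℝ} {η : Site L → ℝ} (hμT : 0 < μT)
    (hlam : 0 ≤ lam) (hη : ∀ α, 0 ≤ η α) {I : Set ℝ} (hI : I ⊆ Set.Ico 0 (threshold g μT))
    (x y : Config L n) :
    correlator (hamiltonian n g lam η) I x y ≤ ∑ w : Config L n with IsClustered w,
      Real.exp (-μT * dist₁ x w) * correlator (hamiltonian n g lam η) I w y := by
  simp only [correlator_eq, Finset.mul_sum]
  rw [Finset.sum_comm]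
  refine Finset.sum_le_sum fun E _ => ?_
  by_cases hE : E ∈ I
  · simp only [Set.indicator_of_mem hE]
    refine norm_le_sum_clustered (ζ := (E : ℂ)) (a := -(L : ℤ)) hμT hlam hη (hI hE).1 (hI hE).2
      (ψ := fun z => spectralEntry (hamiltonian n g lam η) E z y)
      (fun w hw => absurd (pos_mem w 0).1 (not_le.2 hw)) (fun w _ _ => ?_) x
    rw [halfHamiltonian_eq]
    exact congrFun (mulVec_spectralEntry (hamiltonian n g lam η) E y) w
  · simp [Set.indicator_of_notMem hE]

open scoped Classical in
theorem integral_correlator_le_sum {ν : Measure ℝ} [IsProbabilityMeasure ν]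
    (hν0 : ∀ᵐ t ∂ν, 0 ≤ t) {g lam μT : ℝ} (hμT : 0 < μT)
    (hlam : 0 ≤ lam) {I : Set ℝ} (hIm : MeasurableSet I) (hI : I ⊆ Set.Ico 0 (threshold g μT))
    (x y : Config L n) :
    ∫ η, correlator (hamiltonian n g lam η) I x y ∂(Measure.pi fun _ : Site L => ν)
      ≤ ∑ w : Config L n with IsClustered w, Real.exp (-μT * dist₁ x w) *
        ∫ η, correlator (hamiltonian n g lam η) I w y ∂(Measure.pi fun _ : Site L => ν) := by
  have hint := fun w => integrable_correlator (Measure.pi fun _ : Site L => ν) g lam hIm w y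
  calc _ ≤ ∫ η, ∑ w : Config L n with IsClustered w,
        Real.exp (-μT * dist₁ x w) * correlator (hamiltonian n g lam η) I w y
          ∂(Measure.pi fun _ : Site L => ν) := by
        refine integral_mono_ae (hint x)
          (integrable_finsetSum _ fun w _ => (hint w).const_mul _) ?_
        filter_upwards [ae_pi_nonneg (S := Site L) hν0] with η hη
        exact correlator_le_sum_clustered hμT hlam hη hI x y
    _ = _ := by
        rw [integral_finsetSum _ fun w _ => (hint w).const_mul _]
        exact Finset.sum_congr rfl fun w _ => integral_const_mul _ _

/-- Decay of the averaged correlator between distinct clustered configurations. -/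
theorem lintegral_correlator_rpow_le_exp {K : ℝ} (hK : 0 < K) {ν : Measure ℝ}
    [IsProbabilityMeasure ν]
    (hν : ∀ g : ℝ → ℝ≥0∞, ∫⁻ t, g t ∂ν
        ≤ ENNReal.ofReal K * ∫⁻ t : ℝ, ENNReal.ofReal ((1 + t ^ 2)⁻¹) * g t)
    (hν0 : ∀ᵐ t ∂ν, 0 ≤ t) {s : ℝ} (hs0 : 0 < s) (hs1 : s < 1) {g lam μT κ₁ κ₂ μ' : ℝ}
    (hlam : 1 ≤ lam) (hμT : 0 < μT) (hκ₂ : 0 < κ₂) (hμ' : 0 ≤ μ') (hμκ : μ' < κ₁)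
    (hκ : κ₁ + κ₂ ≤ s * μT)
    (hsmall : aPriori K s lam * (clusterSum κ₂ * expSum (κ₁ - μ') * Real.exp μ') ≤ 1 / 2)
    {I : Set ℝ} (hIm : MeasurableSet I) (hI : I ⊆ Set.Ico 0 (threshold g μT))
    {x y : Config L n} (hy : IsClustered y) (hxy : pos x 0 < pos y 0) :
    ∫⁻ η, ENNReal.ofReal (correlator (hamiltonian n g lam η) I x y) ^ (2 - s)
        ∂(Measure.pi fun _ : Site L => ν)
      ≤ ENNReal.ofReal (K * Real.pi * threshold g μT *
        Real.exp (-μ' * |pos x 0 - pos y 0|)) := by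
  have hlam0 : 0 < lam := by linarith
  have hpi := Real.pi_pos
  set e := Real.exp (-μ' * |pos x 0 - pos y 0|) with he
  have he0 : 0 < e := Real.exp_pos _
  refine (lintegral_correlator_rpow_le hK hν hs0 hs1 hlam0 hIm hxy).trans ?_
  have hA0 := aPriori_pos hK hs0 hs1 hlam0
  have hinner : ∀ E ∈ I, ∑ w : Config L n with pos w 0 = pos x 0 + 1,
      ∫⁻ η, ‖green g lam η (pos x 0 + 1) (E : ℂ) y w‖ₑ ^ s
        ∂(Measure.pi fun _ : Site L => ν) ≤ ENNReal.ofReal (1 / 2 * e) := by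
    intro E hE
    refine (sum_lintegral_green_le hν0 hs0 hs1 hlam0.le hμT hκ₂ hμ' hμκ hκ (hI hE).1 (hI hE).2 hy
      (by linarith) (D := ENNReal.ofReal (aPriori K s lam)) fun v hv hbv =>
        lintegral_green_le hK hν hν0 hs0 hs1 hlam0 hμT hκ₂ hμ' hμκ hκ hsmall (hI hE).1 (hI hE).2
          hv hy hbv (by linarith)).trans ?_
    rw [← ENNReal.ofReal_mul hA0.le]
    refine ENNReal.ofReal_le_ofReal ?_
    have hexp : Real.exp (-μ' * (pos y 0 - (pos x 0 + 1 : ℤ))) = Real.exp μ' * e := by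
      rw [he, ← Real.exp_add]
      congr 1
      have : |(pos x 0 : ℝ) - pos y 0| = pos y 0 - pos x 0 := by
        rw [abs_sub_comm, abs_of_pos]
        exact sub_pos.2 (by exact_mod_cast hxy)
      push_cast
      rw [this]
      ring
    rw [hexp]
    calc _ = aPriori K s lam * (clusterSum κ₂ * expSum (κ₁ - μ') * Real.exp μ') * e := by ring
      _ ≤ _ := mul_le_mul_of_nonneg_right hsmall he0.le
  -- The factor 1/lam is discarded using lam ≥ 1, and I has length at most the threshold, so the
  -- constant does not depend on lam.
  calc _ ≤ ENNReal.ofReal (2 * (K * Real.pi)) *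
        (ENNReal.ofReal (1 / 2 * e) * ENNReal.ofReal (threshold g μT)) := by
        gcongr
        · exact div_le_self (by positivity) hlam
        · refine (setLIntegral_mono measurable_const hinner).trans ?_
          rw [setLIntegral_const]
          gcongr
          refine (measure_mono hI).trans ?_
          rw [Real.volume_Ico, sub_zero]
    _ = _ := by
        rw [← ENNReal.ofReal_mul (by positivity), ← ENNReal.ofReal_mul (by positivity)]
        congr 1
        ring

theorem lintegral_le_rpow_lintegral_rpow {α : Type*} [MeasurableSpace α] (P : Measure α)
    [IsProbabilityMeasure P] {f : α → ℝ≥0∞} (hf : AEMeasurable f P) {p : ℝ} (hp : 1 < p) :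
    ∫⁻ a, f a ∂P ≤ (∫⁻ a, f a ^ p ∂P) ^ (1 / p) := by
  have h := ENNReal.lintegral_mul_le_Lp_mul_Lq P (Real.HolderConjugate.conjExponent hp) hf
    (g := fun _ => 1) aemeasurable_const
  simpa using h

/-- Decay of the averaged correlator between clustered configurations. -/
theorem integral_correlator_le_exp {K : ℝ} (hK : 0 < K) {ν : Measure ℝ}
    [IsProbabilityMeasure ν]
    (hν : ∀ g : ℝ → ℝ≥0∞, ∫⁻ t, g t ∂ν
        ≤ ENNReal.ofReal K * ∫⁻ t : ℝ, ENNReal.ofReal ((1 + t ^ 2)⁻¹) * g t)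
    (hν0 : ∀ᵐ t ∂ν, 0 ≤ t) {s : ℝ} (hs0 : 0 < s) (hs1 : s < 1) {g lam μT κ₁ κ₂ μ : ℝ}
    (hlam : 1 ≤ lam) (hμT : 0 < μT) (hκ₂ : 0 < κ₂) (hμ : 0 ≤ μ) (hμκ : (2 - s) * μ < κ₁)
    (hκ : κ₁ + κ₂ ≤ s * μT)
    (hsmall : aPriori K s lam *
      (clusterSum κ₂ * expSum (κ₁ - (2 - s) * μ) * Real.exp ((2 - s) * μ)) ≤ 1 / 2)
    (hthr : 0 < threshold g μT)
    {I : Set ℝ} (hIm : MeasurableSet I) (hI : I ⊆ Set.Ico 0 (threshold g μT))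
    {x y : Config L n} (hx : IsClustered x) (hy : IsClustered y) :
    ∫ η, correlator (hamiltonian n g lam η) I x y ∂(Measure.pi fun _ : Site L => ν)
      ≤ (1 + (K * Real.pi * threshold g μT) ^ (1 / (2 - s))) *
        Real.exp (-μ * |pos x 0 - pos y 0|) := by
  have hpi := Real.pi_pos
  set B := K * Real.pi * threshold g μT with hB
  have hB0 : 0 < B := by positivity
  have hBp : 0 < B ^ (1 / (2 - s)) := Real.rpow_pos_of_pos hB0 _
  have hp0 : 0 < 2 - s := by linarith
  have hlt : ∀ x y : Config L n, IsClustered y → pos x 0 < pos y 0 →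
      ∫ η, correlator (hamiltonian n g lam η) I x y ∂(Measure.pi fun _ : Site L => ν)
      ≤ (1 + B ^ (1 / (2 - s))) * Real.exp (-μ * |pos x 0 - pos y 0|) := by
    intro x y hy hxy
    have hint := integrable_correlator (Measure.pi fun _ : Site L => ν) g lam hIm x y
    have h1 : ENNReal.ofReal
        (∫ η, correlator (hamiltonian n g lam η) I x y ∂(Measure.pi fun _ : Site L => ν))
        ≤ ENNReal.ofReal (B ^ (1 / (2 - s)) * Real.exp (-μ * |pos x 0 - pos y 0|)) := by
      rw [ofReal_integral_eq_lintegral_ofReal hint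
        (Filter.Eventually.of_forall fun η => correlator_nonneg _ _ _ _)]
      refine (lintegral_le_rpow_lintegral_rpow _ hint.1.aemeasurable.ennreal_ofReal
        (p := 2 - s) (by linarith)).trans ?_
      -- Jensen's inequality takes the root of order 2 - s and divides the decay rate by it; the
      -- moments are therefore used with rate (2 - s)μ.
      refine (ENNReal.rpow_le_rpow (lintegral_correlator_rpow_le_exp hK hν hν0 hs0 hs1 hlam hμT
        hκ₂ (by positivity) hμκ hκ hsmall hIm hI hy hxy) (by positivity)).trans_eq ?_
      rw [ENNReal.ofReal_rpow_of_pos (by positivity), Real.mul_rpow hB0.le (Real.exp_pos _).le,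
        ← Real.exp_mul]
      congr 3
      field_simp
    rw [ENNReal.ofReal_le_ofReal_iff (by positivity)] at h1
    refine h1.trans (mul_le_mul_of_nonneg_right (by linarith) (Real.exp_pos _).le)
  rcases lt_trichotomy (pos x 0) (pos y 0) with h | h | h
  · exact hlt x y hy h
  -- Equal first sites offer no room for decoupling; the bound Q ≤ 1 accounts for the summand 1 in
  -- the constant.
  · rw [h, sub_self, abs_zero, Int.cast_zero, mul_zero, Real.exp_zero, mul_one]
    calc _ ≤ ∫ _ : Site L → ℝ, (1 : ℝ) ∂(Measure.pi fun _ : Site L => ν) :=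
          integral_mono (integrable_correlator _ g lam hIm x y) (integrable_const 1) fun η =>
            correlator_le_one (isHermitian_hamiltonian g lam η) I x y
      _ = 1 := by simp
      _ ≤ _ := by linarith
  · simp only [correlator_symm _ I x y]
    rw [abs_sub_comm]
    exact hlt y x hx h

/-- A bound between clustered configurations extends to all configurations. -/
theorem integral_correlator_le_decay {ν : Measure ℝ} [IsProbabilityMeasure ν]
    (hν0 : ∀ᵐ t ∂ν, 0 ≤ t) {g lam μT μ C : ℝ} (hμT : 0 < μT) (hμ : μ ≤ μT)
    (hlam : 0 ≤ lam) {I : Set ℝ} (hIm : MeasurableSet I) (hI : I ⊆ Set.Ico 0 (threshold g μT))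
    (h : ∀ x y : Config L n, IsClustered x → IsClustered y →
      ∫ η, correlator (hamiltonian n g lam η) I x y ∂(Measure.pi fun _ : Site L => ν)
        ≤ C * Real.exp (-μ * |pos x 0 - pos y 0|)) (x y : Config L n) :
    ∫ η, correlator (hamiltonian n g lam η) I x y ∂(Measure.pi fun _ : Site L => ν)
      ≤ C * decay μ x y := by
  classical
  set J : Config L n → Config L n → ℝ := fun x y =>
    ∫ η, correlator (hamiltonian n g lam η) I x y ∂(Measure.pi fun _ : Site L => ν) with hJ
  have hsymm : ∀ x y, J x y = J y x := fun x y => by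
    simp only [hJ, correlator_symm _ I x y]
  have hleft : ∀ x y (b : Config L n → ℝ), (∀ w, IsClustered w → J w y ≤ C * b w) →
      J x y ≤ ∑ w : Config L n with IsClustered w, C * (Real.exp (-μ * dist₁ x w) * b w) := by
    intro x y b hb
    refine (integral_correlator_le_sum hν0 hμT hlam hIm hI x y).trans
      (Finset.sum_le_sum fun w hw => ?_)
    have hJ0 : 0 ≤ J w y := integral_nonneg fun η => correlator_nonneg _ _ _ _
    calc _ ≤ Real.exp (-μ * dist₁ x w) * J w y :=
          mul_le_mul_of_nonneg_right (exp_dist₁_le hμ x w) hJ0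
      _ ≤ Real.exp (-μ * dist₁ x w) * (C * b w) :=
          mul_le_mul_of_nonneg_left (hb w (Finset.mem_filter.1 hw).2) (Real.exp_pos _).le
      _ = _ := by ring
  have hright : ∀ x y, IsClustered x → J x y ≤ ∑ v : Config L n with IsClustered v,
      C * Real.exp (-μ * (|pos x 0 - pos v 0| + dist₁ v y)) := by
    intro x y hx
    rw [hsymm]
    refine (hleft y x (fun v => Real.exp (-μ * |pos x 0 - pos v 0|)) fun v hv => ?_).trans_eq
      (Finset.sum_congr rfl fun v _ => ?_)
    · rw [hsymm]
      exact h x v hx hv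
    · rw [← Real.exp_add, dist₁_comm y v]
      congr 2
      ring
  change J x y ≤ _
  by_cases hx : IsClustered x <;> by_cases hy : IsClustered y
  · simp only [decay, hx, hy, if_true]
    exact h x y hx hy
  · simp only [decay, hx, hy, if_true, if_false, Finset.mul_sum]
    exact_mod_cast hright x y hx
  · simp only [decay, hx, hy, if_true, if_false, Finset.mul_sum]
    refine (hleft x y (fun w => Real.exp (-μ * |pos w 0 - pos y 0|)) fun w hw =>
      h w y hw hy).trans_eq (Finset.sum_congr rfl fun w _ => ?_)
    rw [← Real.exp_add]
    congr 2
    push_cast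
    ring
  · simp only [decay, hx, hy, if_false, Finset.mul_sum]
    refine (hleft x y (fun w => ∑ v : Config L n with IsClustered v,
      Real.exp (-μ * (|pos w 0 - pos v 0| + dist₁ v y))) fun w hw => ?_).trans_eq
      (Finset.sum_congr rfl fun w _ => ?_)
    · rw [Finset.mul_sum]
      exact hright w y hw
    · rw [Finset.mul_sum, Finset.mul_sum]
      refine Finset.sum_congr rfl fun v _ => ?_
      rw [← Real.exp_add]
      congr 2
      push_cast
      ring

end Localization

/-! ### Random potentials -/

/-- The a priori constant scales like lam^(-s); this is where large disorder makes the iteration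
contract. -/
theorem tendsto_aPriori {K s : ℝ} (hs0 : 0 < s) :
    Filter.Tendsto (aPriori K s) Filter.atTop (nhds 0) := by
  have h1 : Filter.Tendsto (fun lam : ℝ => (4 / lam) ^ s) Filter.atTop (nhds 0) := by
    have h := (Filter.Tendsto.const_div_atTop Filter.tendsto_id (4 : ℝ)).rpow_const
      (p := s) (Or.inr hs0.le)
    rwa [Real.zero_rpow hs0.ne'] at h
  have h2 := (((h1.const_mul Real.pi).div_const (Real.cos (Real.pi * s / 2))).const_mul
    4).const_mul K
  simp only [mul_zero, zero_div] at h2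
  exact h2

theorem IsBoundedDensity.isProbabilityMeasure {ρ : ℝ → ℝ} {ωmax : ℝ}
    (hρ : IsBoundedDensity ρ ωmax) :
    IsProbabilityMeasure (volume.withDensity fun t => ENNReal.ofReal (ρ t)) :=
  ⟨by rw [withDensity_apply _ MeasurableSet.univ, Measure.restrict_univ, hρ.lintegral_eq_one]⟩

theorem IsBoundedDensity.ae_nonneg {ρ : ℝ → ℝ} {ωmax : ℝ} (hρ : IsBoundedDensity ρ ωmax) :
    ∀ᵐ t ∂(volume.withDensity fun t => ENNReal.ofReal (ρ t)), 0 ≤ t := by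
  have hm : AEMeasurable (fun t => ENNReal.ofReal (ρ t)) volume :=
    hρ.memLp_top.1.aemeasurable.ennreal_ofReal
  rw [ae_withDensity_iff' hm]
  filter_upwards [hρ.support] with t ht h
  by_contra hneg
  exact h (by rw [ht fun hmem => hneg hmem.1, ENNReal.ofReal_zero])

theorem IsIIDWithDensity.map_eq_pi {S Ω : Type*} [Fintype S] [MeasurableSpace Ω] {P : Measure Ω}
    [IsProbabilityMeasure P] {ω : S → Ω → ℝ} {ρ : ℝ → ℝ} (h : IsIIDWithDensity P ω ρ) :
    P.map (fun s α => ω α s)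
      = Measure.pi fun _ : S => volume.withDensity fun t => ENNReal.ofReal (ρ t) := by
  have h1 := (iIndepFun_iff_map_fun_eq_pi_map fun α => (h.measurable α).aemeasurable).1 h.indep
  simpa only [h.law] using h1

end

end HardCore


/-! ### Choice of constants and conclusion -/

theorem theorem1p3 (g μT μ ωmax : ℝ) (I : Set ℝ) (ρ : ℝ → ℝ)
    (hg : 1 < g) (hμT : 0 < μT) (hE : 0 < HardCore.threshold g μT)
    (hIc : IsCompact I) (hIi : I.OrdConnected) (hI : I ⊆ Set.Ico 0 (HardCore.threshold g μT))
    (hμ : μ ∈ Set.Ioo 0 μT) (hρ : HardCore.IsBoundedDensity ρ ωmax) :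
    ∃ lam₀ C : ℝ, 0 < lam₀ ∧ 0 < C ∧
      ∀ (n : ℕ) [NeZero n], 2 ≤ n → ∀ (L : ℕ)
        (Ω : Type*) [MeasurableSpace Ω] (P : MeasureTheory.Measure Ω)
        [MeasureTheory.IsProbabilityMeasure P] (ω : HardCore.Site L → Ω → ℝ),
        HardCore.IsIIDWithDensity P ω ρ →
        ∀ (x y : HardCore.Config L n) (lam : ℝ), lam₀ < lam →
          MeasureTheory.Integrable
            (fun s => HardCore.correlator
              (HardCore.hamiltonian n g lam (fun α => ω α s)) I x y) P ∧
          ∫ s, |HardCore.correlator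
              (HardCore.hamiltonian n g lam (fun α => ω α s)) I x y| ∂P
            ≤ C * HardCore.decay μ x y := by
  obtain ⟨hμ0, hμ1⟩ := hμ
  obtain ⟨K, hK, hν⟩ := HardCore.exists_lintegral_density_le hρ
  have := hρ.isProbabilityMeasure
  set ν : Measure ℝ := volume.withDensity fun t => ENNReal.ofReal (ρ t) with hνdef
  have hν0 : ∀ᵐ t ∂ν, 0 ≤ t := hρ.ae_nonneg
  have hpi := Real.pi_pos
  -- The available rate sμT must exceed the rate (2 - s)μ needed before Jensen, i.e. s > 2μ/(μT +
  -- μ), which is below 1 exactly because μ < μT. The surplus d is then shared equally between κ₂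
  -- and κ₁ - (2 - s)μ.
  obtain ⟨s, hs0, hs1, hs⟩ : ∃ s : ℝ, 0 < s ∧ s < 1 ∧ (2 - s) * μ < s * μT := by
    have hr : 2 * μ / (μT + μ) < 1 := (div_lt_one (by linarith)).2 (by linarith)
    obtain ⟨s, h1, h2⟩ := exists_between hr
    have h0 : 0 < 2 * μ / (μT + μ) := by positivity
    rw [div_lt_iff₀ (by linarith)] at h1
    exact ⟨s, by nlinarith, h2, by linarith⟩
  set d := s * μT - (2 - s) * μ with hd
  set c := HardCore.clusterSum (d / 2) *
    HardCore.expSum ((2 - s) * μ + d / 2 - (2 - s) * μ) * Real.exp ((2 - s) * μ) with hc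
  have hlim : Filter.Tendsto (fun lam => HardCore.aPriori K s lam * c) Filter.atTop (nhds 0) := by
    simpa using (HardCore.tendsto_aPriori (K := K) hs0).mul_const c
  obtain ⟨N, hN⟩ := Filter.eventually_atTop.1
    (hlim.eventually (eventually_le_nhds (show (0 : ℝ) < 1 / 2 by norm_num)))
  set C := 1 + (K * Real.pi * HardCore.threshold g μT) ^ (1 / (2 - s)) with hC
  have hC0 : 0 < C := by positivity
  -- Beyond N the contraction factor is at most 1/2; the 1 provides lam ≥ 1. Neither N nor C
  -- involves n, L or the probability space.
  refine ⟨max 1 N, C, by positivity, hC0, ?_⟩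
  intro n _ _ L Ω _ P _ ω hω x y lam hlam
  have hlam1 : 1 ≤ lam := (le_max_left _ _).trans hlam.le
  have hIm : MeasurableSet I := hIc.measurableSet
  have hmeas : Measurable fun (t : Ω) (α : HardCore.Site L) => ω α t :=
    measurable_pi_lambda _ hω.measurable
  have hint := HardCore.integrable_correlator
    (Measure.pi fun _ : HardCore.Site L => ν) g lam hIm x y
  rw [← hω.map_eq_pi] at hint
  refine ⟨hint.comp_measurable hmeas, ?_⟩
  have hbound := HardCore.integral_correlator_le_decay (ν := ν) hν0 hμT hμ1.le
    (by linarith) hIm hI (fun x y hx hy => HardCore.integral_correlator_le_exp hK hν hν0 hs0 hs1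
      hlam1 hμT (κ₁ := (2 - s) * μ + d / 2) (κ₂ := d / 2) (by linarith) hμ0.le (by linarith)
      (by linarith) (hN lam ((le_max_right _ _).trans hlam.le)) hE hIm hI hx hy) x y
  rw [← hω.map_eq_pi, integral_map hmeas.aemeasurable hint.1] at hbound
  simpa only [abs_of_nonneg (HardCore.correlator_nonneg _ _ _ _)] using hbound
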